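/- Throughout, $f:\mathbb R\to\mathbb C$, $[\,\cdot\,]$ is the integer part, and $\|f\|_{S^1}=\sup_{u\in\mathbb R}\frac1\pi\int_u^{u+\pi}|f(t)|\,dt$. Stepanov almost periodic functions are the measurable functions in the closure of the trigonometric polynomials $\sum_{j} b_je^{ir_jt}$ ($r_j\in\mathbb R$, finite sums) with respect to $\|\cdot\|_{S^1}$. For such $f$ put $A_r(f)=\lim_{L\to\infty}\frac1L\int_0^Lf(t)e^{-irt}\,dt$; the real numbers $r$ with $A_r(f)\ne0$ are the Fourier exponents of $f$, and $S_\gamma f(x)=\sum_{|r|\le\gamma}A_r(f)e^{irx}$, the sum being over Fourier exponents $r$. For $\alpha>0$ let $\Omega_{\alpha,1}$ be the set of bounded Stepanov almost periodic $f$ such that any two distinct positive numbers that are absolute values of Fourier exponents of $f$ differ by at least $\alpha$. Let $w_x:[0,\infty)\to\mathbb R$ be nondecreasing and continuous with $w_x(0)=0$ and $w_x(\delta_1+\delta_2)\le w_x(\delta_1)+w_x(\delta_2)$ for $\delta_1,\delta_2\ge0$. For $x\in\mathbb R$ put $\varphi_x(t)=f(x+t)+f(x-t)-2f(x)$. We say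 that $f\in\Omega_{\alpha,1,2}(w_x)$ with constant $M\ge 0$ if $f\in\Omega_{\alpha,1}$ and, for all $\gamma,\delta>0$ and both signs, $$\frac1\delta\int_0^\delta|\varphi_x(t)-\varphi_x(t\pm\gamma)|\,dt\le M\,w_x(\gamma),\qquad \Big\{\sum_{k=0}^{[\pi/(\alpha\delta)]}\Big(\frac1{(k+1)\delta}\int_{k\delta}^{(k+1)\delta}|\varphi_x(t)|\,dt\Big)^2\Big\}^{1/2}\le M\,w_x(\delta).$$ Let $E_\sigma(f)_{S^1}=\inf_g\|f-g\|_{S^1}$, where $g$ runs over the entire functions of exponential type at most $\sigma$ that are bounded on $\mathbb R$. **Theorem 5.** Let $\alpha>0$, $0<q\le2$, $c>1$, $K\ge0$, $M\ge 0$. There is a constant $C>0$, depending only on $\alpha,q,c,K,M$, with the following property. Let $x\in\mathbb R$, let $w_x$ be as above, let $f\in\Omega_{\alpha,1,2}(w_x)$ with constant $M$, and let $(a_{n,k})_{n,k\ge0}$ be a matrix of nonnegative real numbers such that $\sum_{k=0}^\infty a_{n,k}=1$ for every $n$, $\lim_{n\to\infty}a_{n,0}=0$, and every row lies in $GM(_2\beta)$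 with the parameter $c$ and the constant $K$, that is, $$\sum_{k=m}^{2m-1}|a_{n,k}-a_{n,k+1}|\le K\sum_{k=[m/c]}^{[cm]}\frac{a_{n,k}}k$$ for all $n\ge0$ and all integers $m\ge c$ (those for which $[m/c]\ge1$). Then, for $n=0,1,2,\dots$, $$\Big\{\sum_{k=0}^\infty a_{n,k}\big|S_{\alpha k/2}f(x)-f(x)\big|^q\Big\}^{1/q}\le C\Big\{\sum_{k=0}^\infty a_{n,k}\Big[w_x\Big(\frac\pi{k+1}\Big)+E_{\alpha k/2^{1+[c]}}(f)_{S^1}\Big]^q\Big\}^{1/q}.$$ -/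

import Mathlib

open MeasureTheory Filter Topology
open scoped ENNReal

noncomputable section

namespace StepanovApprox

/-- The Stepanov norm `sup_u (1/π) ∫_u^{u+π} |f(t)| dt`, with values in `[0, ∞]`. -/
def stepanovNorm (f : ℝ → ℂ) : ℝ≥0∞ :=
  ⨆ u : ℝ, ENNReal.ofReal (1 / Real.pi) * ∫⁻ t in Set.Ioc u (u + Real.pi), ‖f t‖ₑ

/-- The trigonometric polynomial `∑_{r ∈ s} b_r e^{i r t}` with real frequencies. -/
def trigPoly (s : Finset ℝ) (b : ℝ → ℂ) (t : ℝ) : ℂ :=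
  ∑ r ∈ s, b r * Complex.exp (Complex.I * r * t)

/-- Almost periodic functions in the sense of Stepanov (exponent 1): the closure of the
trigonometric polynomials in the Stepanov norm. -/
def IsStepanovAP (f : ℝ → ℂ) : Prop :=
  AEStronglyMeasurable f volume ∧
    ∀ ε : ℝ≥0∞, 0 < ε → ∃ (s : Finset ℝ) (b : ℝ → ℂ),
      stepanovNorm (fun t => f t - trigPoly s b t) < ε

/-- The Fourier coefficient at the frequency `r`, the limit of
`(1/L) ∫_0^L f(t) e^{-i r t} dt` as `L → ∞` (it exists for Stepanov almost periodic `f`). -/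
def fourierCoef (f : ℝ → ℂ) (r : ℝ) : ℂ :=
  limUnder atTop (fun L : ℝ =>
    ((1 / L : ℝ) : ℂ) * ∫ t in (0 : ℝ)..L, f t * Complex.exp (-(Complex.I * r * t)))

/-- The set of Fourier exponents of `f`. -/
def exponents (f : ℝ → ℂ) : Set ℝ := {r | fourierCoef f r ≠ 0}

/-- The partial sum `∑_{|r| ≤ γ} A_r e^{i r x}` over the Fourier exponents `r` of `f`. The sum is
finite for the functions considered below, as their exponents are separated. -/
def partialSum (f : ℝ → ℂ) (γ : ℝ) (x : ℝ) : ℂ :=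
  ∑ᶠ r ∈ {r : ℝ | r ∈ exponents f ∧ |r| ≤ γ}, fourierCoef f r * Complex.exp (Complex.I * r * x)

/-- The class `Ω_{α,1}`: bounded Stepanov almost periodic functions such that distinct positive
values of `|r|`, `r` a Fourier exponent, differ by at least `α`. -/
structure MemOmega (α : ℝ) (f : ℝ → ℂ) : Prop where
  almostPeriodic : IsStepanovAP f
  bounded : ∃ B : ℝ, ∀ t, ‖f t‖ ≤ B
  gap : ∀ r ∈ exponents f, ∀ s ∈ exponents f, 0 < |r| → |r| < |s| → α ≤ |s| - |r|

/-- `φ_x(t) = f(x+t) + f(x-t) - 2 f(x)`. -/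
def phi (f : ℝ → ℂ) (x t : ℝ) : ℂ := f (x + t) + f (x - t) - 2 * f x

/-- `G_x f(δ)_{2,1}`, with values in `[0, ∞]`. -/
def gabisonia (α : ℝ) (f : ℝ → ℂ) (x δ : ℝ) : ℝ≥0∞ :=
  (∑ k ∈ Finset.range (⌊Real.pi / (α * δ)⌋₊ + 1),
    (ENNReal.ofReal (1 / (((k : ℝ) + 1) * δ)) *
      ∫⁻ t in Set.Ioc ((k : ℝ) * δ) (((k : ℝ) + 1) * δ), ‖phi f x t‖ₑ) ^ (2 : ℝ)) ^ (1 / 2 : ℝ)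

/-- Functions of modulus of continuity type on `[0, ∞)`. -/
structure IsModulusType (w : ℝ → ℝ) : Prop where
  continuousOn : ContinuousOn w (Set.Ici 0)
  monotoneOn : MonotoneOn w (Set.Ici 0)
  zero : w 0 = 0
  subadd : ∀ s t : ℝ, 0 ≤ s → 0 ≤ t → w (s + t) ≤ w s + w t

/-- The class `Ω_{α,1,2}(w)` at the point `x`; `M` is the constant implied in its two
`≪` conditions. -/
structure MemOmegaW (α M : ℝ) (w : ℝ → ℝ) (x : ℝ) (f : ℝ → ℂ) : Prop extends MemOmega α f where
  shift_add : ∀ γ δ : ℝ, 0 < γ → 0 < δ →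
    ENNReal.ofReal (1 / δ) * ∫⁻ t in Set.Ioc 0 δ, ‖phi f x t - phi f x (t + γ)‖ₑ
      ≤ ENNReal.ofReal (M * w γ)
  shift_sub : ∀ γ δ : ℝ, 0 < γ → 0 < δ →
    ENNReal.ofReal (1 / δ) * ∫⁻ t in Set.Ioc 0 δ, ‖phi f x t - phi f x (t - γ)‖ₑ
      ≤ ENNReal.ofReal (M * w γ)
  gabisonia_le : ∀ δ : ℝ, 0 < δ → gabisonia α f x δ ≤ ENNReal.ofReal (M * w δ)

/-- `B_σ`: entire functions of exponential type (at most) `σ`, bounded on the real axis. -/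
structure MemB (σ : ℝ) (g : ℂ → ℂ) : Prop where
  entire : Differentiable ℂ g
  expType : ∀ ε : ℝ, 0 < ε → ∃ C : ℝ, ∀ z : ℂ, ‖g z‖ ≤ C * Real.exp ((σ + ε) * ‖z‖)
  bounded : ∃ B : ℝ, ∀ t : ℝ, ‖g t‖ ≤ B

/-- The best approximation `E_σ(f)` in the Stepanov norm by elements of `B_σ`. -/
def bestApprox (σ : ℝ) (f : ℝ → ℂ) : ℝ≥0∞ :=
  ⨅ (g : ℂ → ℂ) (_ : MemB σ g), stepanovNorm (fun t => f t - g t)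

/-- The sequence `a` is in `GM(₂β)` with parameter `c` and constant `K`. The inequality is asked for
all `m ≥ c`, that is, for all `m ≥ 1` for which no term of its right side is divided by zero. -/
def IsGM (c K : ℝ) (a : ℕ → ℝ) : Prop :=
  ∀ m : ℕ, c ≤ m →
    ∑ k ∈ Finset.Ico m (2 * m), |a k - a (k + 1)|
      ≤ K * ∑ k ∈ Finset.Icc ⌊(m : ℝ) / c⌋₊ ⌊c * (m : ℝ)⌋₊, |a k| / (k : ℝ)

/-- The strong mean `{∑_k a_k |S_{γ_k} f(x) - f(x)|^q}^{1/q}` of a nonnegative sequence `a`,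
with values in `[0, ∞]`. -/
def strongMean (q : ℝ) (a : ℕ → ℝ) (γ : ℕ → ℝ) (f : ℝ → ℂ) (x : ℝ) : ℝ≥0∞ :=
  (∑' k : ℕ, ENNReal.ofReal (a k) * ‖partialSum f (γ k) x - f x‖ₑ ^ q) ^ (1 / q)

end StepanovApprox

end

open StepanovApprox

/-! Put l = αk/2 and h = α/2. There is a kernel of size O(1/(1 + t²)) whose cosine transform is the
trapezoid equal to 1 on |r| ≤ l and to 0 on |r| ≥ l + h. Convolution of f with it is uniformly
almost periodic with finite spectrum, hence, by uniqueness (`IsUniformAP.eq_trigPoly`), a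
trigonometric polynomial: the partial sum at l plus the terms with l < |r| ≤ l + h. The gap
condition leaves at most the two exponents ±r there. Their coefficients are at most 2E_l(f), since
bounded entire functions of type l have mean zero against e^{-irt} when |r| > l. So the deviation is
at most |∫₀^∞ φ_x · kernel| + 4E_l(f) (`MemOmega.enorm_partialSum_sub_le`).

The core is the bound O(m w_x(π/(αm))²) for the sum of the squares of these integrals over a block m
≤ k < 2m (`MemOmegaW.sum_sq_norm_integral_le`). With δ = π/(αm) and A = π/(2α), the half-line is cut
at δ and A. On (0, δ] the kernel is O(m). Beyond A it is a difference of two cosines over t², and a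
half-period shift turns φ_x into φ_x(t) - φ_x(t + γ), which the first condition of the class
controls. In between the kernel is an amplitude O(1/t) that does not depend on k, times a sine whose
frequency runs through an arithmetic progression of step α/2. A large sieve inequality
(`large_sieve`) bounds the sum over the progression by m times the sum of squared L¹ norms over
cells of length δ, and with the weight 1/t this is the sum in the second condition of the class.

Jensen's inequality passes from exponent 2 to q ≤ 2 on each block. The variation condition bounds
each a_k in a dyadic block by an average of the row over a range comparable to the block
(`IsGM.mul_le_sum`). These ranges overlap boundedly, so the blocks can be summed. An index j ≤ cm of
such a range satisfies αj/2^{1+[c]} ≤ αm/2, which explains the index of E on the right side. The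
term k = 0 is reduced to k = 1. -/

namespace StepanovApprox

/-! ### Means and Fourier coefficients under Stepanov approximation -/

/-- The mean value of `u` over `[0, L]`. -/
noncomputable def mean (u : ℝ → ℂ) (L : ℝ) : ℂ :=
  ((1 / L : ℝ) : ℂ) * ∫ t in (0 : ℝ)..L, u t

lemma lintegral_Ioc_le_stepanovNorm (u : ℝ → ℂ) (y : ℝ) :
    ∫⁻ t in Set.Ioc y (y + Real.pi), ‖u t‖ₑ ≤ ENNReal.ofReal Real.pi * stepanovNorm u := by
  have h := le_iSup (fun y : ℝ => ENNReal.ofReal (1 / Real.pi) *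
    ∫⁻ t in Set.Ioc y (y + Real.pi), ‖u t‖ₑ) y
  calc ∫⁻ t in Set.Ioc y (y + Real.pi), ‖u t‖ₑ
      = ENNReal.ofReal Real.pi * (ENNReal.ofReal (1 / Real.pi) *
        ∫⁻ t in Set.Ioc y (y + Real.pi), ‖u t‖ₑ) := by
        rw [← mul_assoc, ← ENNReal.ofReal_mul Real.pi_pos.le,
          mul_one_div_cancel Real.pi_pos.ne', ENNReal.ofReal_one, one_mul]
    _ ≤ _ := by gcongr; exact h

lemma lintegral_Ioc_nat_mul_le (u : ℝ → ℂ) (y : ℝ) (n : ℕ) :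
    ∫⁻ t in Set.Ioc y (y + n * Real.pi), ‖u t‖ₑ
      ≤ ENNReal.ofReal (n * Real.pi) * stepanovNorm u := by
  induction n with
  | zero => simp
  | succ n ih =>
    have e : Set.Ioc y (y + (n + 1 : ℕ) * Real.pi) = Set.Ioc y (y + n * Real.pi) ∪
        Set.Ioc (y + n * Real.pi) (y + n * Real.pi + Real.pi) := by
      rw [Set.Ioc_union_Ioc_eq_Ioc]
      · push_cast; congr 1; ring
      · have := Real.pi_pos; nlinarith [(n.cast_nonneg : (0 : ℝ) ≤ n)]
      · have := Real.pi_pos; linarith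
    rw [e]
    refine (lintegral_union_le _ _ _).trans ?_
    refine (add_le_add ih (lintegral_Ioc_le_stepanovNorm u _)).trans ?_
    rw [← add_mul, ← ENNReal.ofReal_add (by positivity) (by positivity)]
    push_cast
    rw [add_mul, one_mul]

lemma lintegral_Ioc_le_two_mul (u : ℝ → ℂ) (y : ℝ) {L : ℝ} (hL : Real.pi ≤ L) :
    ∫⁻ t in Set.Ioc y (y + L), ‖u t‖ₑ ≤ ENNReal.ofReal (2 * L) * stepanovNorm u := by
  have hp := Real.pi_pos
  have h1 : L ≤ ⌈L / Real.pi⌉₊ * Real.pi := by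
    rw [← div_le_iff₀ hp]; exact Nat.le_ceil _
  have h2 : ⌈L / Real.pi⌉₊ * Real.pi ≤ 2 * L := by
    have := (Nat.ceil_lt_add_one (div_nonneg (hp.le.trans hL) hp.le)).le
    calc ⌈L / Real.pi⌉₊ * Real.pi ≤ (L / Real.pi + 1) * Real.pi := by gcongr
      _ = L + Real.pi := by field_simp
      _ ≤ 2 * L := by linarith
  calc _ ≤ ∫⁻ t in Set.Ioc y (y + ⌈L / Real.pi⌉₊ * Real.pi), ‖u t‖ₑ :=
        lintegral_mono_set (Set.Ioc_subset_Ioc_right (by linarith))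
    _ ≤ _ := lintegral_Ioc_nat_mul_le u y _
    _ ≤ _ := by gcongr

lemma enorm_mean_le (u : ℝ → ℂ) {L : ℝ} (hL : Real.pi ≤ L) :
    ‖mean u L‖ₑ ≤ 2 * stepanovNorm u := by
  have hL0 : 0 < L := Real.pi_pos.trans_le hL
  rw [mean, enorm_mul, intervalIntegral.integral_of_le hL0.le]
  have h1 : ‖((1 / L : ℝ) : ℂ)‖ₑ = ENNReal.ofReal (1 / L) := by
    rw [← ofReal_norm, Complex.norm_real, Real.norm_of_nonneg (by positivity)]
  calc _ ≤ ENNReal.ofReal (1 / L) * (ENNReal.ofReal (2 * L) * stepanovNorm u) := by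
        rw [h1]; gcongr
        refine (enorm_integral_le_lintegral_enorm _).trans ?_
        simpa using lintegral_Ioc_le_two_mul u 0 hL
    _ = 2 * stepanovNorm u := by
        rw [← mul_assoc, ← ENNReal.ofReal_mul (by positivity)]
        congr 1
        rw [show 1 / L * (2 * L) = 2 by field_simp]; simp

lemma stepanovNorm_congr {u v : ℝ → ℂ} (h : ∀ t, ‖u t‖ = ‖v t‖) :
    stepanovNorm u = stepanovNorm v := by
  have : ∀ t, ‖u t‖ₑ = ‖v t‖ₑ := fun t => by
    rw [← ofReal_norm, ← ofReal_norm, h]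
  simp only [stepanovNorm, this]

lemma locallyIntegrable_intervalIntegrable {u : ℝ → ℂ} (hu : LocallyIntegrable u) (a b : ℝ) :
    IntervalIntegrable u volume a b :=
  (hu.integrableOn_isCompact isCompact_uIcc).intervalIntegrable

lemma mean_sub {u v : ℝ → ℂ} (hu : LocallyIntegrable u) (hv : LocallyIntegrable v) (L : ℝ) :
    mean (fun t => u t - v t) L = mean u L - mean v L := by
  rw [mean, intervalIntegral.integral_sub (locallyIntegrable_intervalIntegrable hu _ _)
    (locallyIntegrable_intervalIntegrable hv _ _), mul_sub]; rfl

/-- Means converge along Stepanov approximation. -/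
lemma exists_tendsto_mean {u : ℝ → ℂ} (hu : LocallyIntegrable u)
    (h : ∀ ε : ℝ≥0∞, 0 < ε → ∃ v : ℝ → ℂ, LocallyIntegrable v ∧
      stepanovNorm (fun t => u t - v t) < ε ∧ ∃ b, Tendsto (mean v) atTop (𝓝 b)) :
    ∃ b, Tendsto (mean u) atTop (𝓝 b) := by
  refine cauchy_map_iff_exists_tendsto.mp ?_
  rw [EMetric.cauchy_iff]
  refine ⟨NeBot.ne inferInstance, fun ε hε => ?_⟩
  -- Late means of `u` lie within 2·ε/8 of those of `v`, hence within 3·ε/8 of `b`; two of them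
  -- differ by less than 6·ε/8.
  have hε8 : 0 < ε / 8 := ENNReal.div_pos hε.ne' (by norm_num)
  obtain ⟨v, hv, hlt, b, hb⟩ := h (ε / 8) hε8
  have hb' := (EMetric.tendsto_nhds.mp hb) (ε / 8) hε8
  refine ⟨mean u '' {L | Real.pi ≤ L ∧ edist (mean v L) b < ε / 8}, ?_, ?_⟩
  · refine image_mem_map ?_
    filter_upwards [hb', eventually_ge_atTop Real.pi] with L h1 h2 using ⟨h2, h1⟩
  · have key : ∀ L, Real.pi ≤ L → edist (mean v L) b < ε / 8 → edist (mean u L) b < 3 * (ε / 8) := by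
      intro L hL hvb
      have h1 : edist (mean u L) (mean v L) ≤ 2 * (ε / 8) := by
        rw [edist_eq_enorm_sub, ← mean_sub hu hv]
        exact (enorm_mean_le _ hL).trans (by gcongr)
      by_cases htop : ε = ⊤
      · subst htop
        have : (3 : ℝ≥0∞) * (⊤ / 8) = ⊤ := by
          rw [ENNReal.top_div_of_ne_top (by norm_num)]; simp
        rw [this]; exact edist_lt_top _ _
      calc edist (mean u L) b ≤ edist (mean u L) (mean v L) + edist (mean v L) b :=
            edist_triangle _ _ _
        _ < 2 * (ε / 8) + ε / 8 := ENNReal.add_lt_add_of_le_of_lt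
            (ENNReal.mul_ne_top (by norm_num) (ENNReal.div_ne_top htop (by norm_num))
              |> fun h => ne_top_of_le_ne_top h h1) h1 hvb
        _ = 3 * (ε / 8) := by ring
    rintro _ ⟨L, ⟨hL, hLb⟩, rfl⟩ _ ⟨L', ⟨hL', hLb'⟩, rfl⟩
    calc edist (mean u L) (mean u L') ≤ edist (mean u L) b + edist (mean u L') b :=
          edist_triangle_right _ _ _
      _ < 3 * (ε / 8) + 3 * (ε / 8) := ENNReal.add_lt_add (key L hL hLb) (key L' hL' hLb')
      _ ≤ 8 * (ε / 8) := by rw [← add_mul]; gcongr; norm_num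
      _ = ε := ENNReal.mul_div_cancel (by norm_num) (by norm_num)

lemma enorm_sub_le_of_tendsto_mean {u v : ℝ → ℂ} (hu : LocallyIntegrable u)
    (hv : LocallyIntegrable v) {a b : ℂ} (ha : Tendsto (mean u) atTop (𝓝 a))
    (hb : Tendsto (mean v) atTop (𝓝 b)) :
    ‖a - b‖ₑ ≤ 2 * stepanovNorm (fun t => u t - v t) := by
  refine le_of_tendsto (ha.sub hb).enorm ?_
  filter_upwards [eventually_ge_atTop Real.pi] with L hL
  rw [← mean_sub hu hv]
  exact enorm_mean_le _ hL

/-- The function whose mean is the Fourier coefficient at `r`. -/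
noncomputable def twist (u : ℝ → ℂ) (r t : ℝ) : ℂ := u t * Complex.exp (-(Complex.I * r * t))

lemma fourierCoef_eq (f : ℝ → ℂ) (r : ℝ) : fourierCoef f r = limUnder atTop (mean (twist f r)) := rfl

lemma norm_exp_neg_I (r t : ℝ) : ‖Complex.exp (-(Complex.I * r * t))‖ = 1 := by
  rw [Complex.norm_exp]; simp

lemma norm_exp_I (r t : ℝ) : ‖Complex.exp (Complex.I * r * t)‖ = 1 := by
  rw [Complex.norm_exp]; simp

lemma stepanovNorm_twist_sub (u v : ℝ → ℂ) (r : ℝ) :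
    stepanovNorm (fun t => twist u r t - twist v r t) = stepanovNorm (fun t => u t - v t) := by
  apply stepanovNorm_congr
  intro t
  simp only [twist]
  rw [← sub_mul, norm_mul, norm_exp_neg_I, mul_one]

lemma locallyIntegrable_twist {u : ℝ → ℂ} (hu : LocallyIntegrable u) (r : ℝ) :
    LocallyIntegrable (twist u r) := by
  have := (LocallyIntegrable.locallyIntegrableOn hu Set.univ).mul_continuousOn
    (g := fun t : ℝ => Complex.exp (-(Complex.I * r * t))) (by fun_prop)
      isClosed_univ.isLocallyClosed
  rw [locallyIntegrableOn_univ] at this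
  exact this

lemma continuous_trigPoly (s : Finset ℝ) (b : ℝ → ℂ) : Continuous (trigPoly s b) := by
  unfold trigPoly; fun_prop

lemma tendsto_mean_exp (l : ℝ) :
    Tendsto (mean fun t => Complex.exp (Complex.I * l * t)) atTop (𝓝 (if l = 0 then 1 else 0)) := by
  split_ifs with h
  · subst h
    refine tendsto_const_nhds.congr' ?_
    filter_upwards [eventually_gt_atTop 0] with L hL
    simp [mean, hL.ne']
  · have hI : Complex.I * l ≠ 0 := by simp [h]
    rw [tendsto_zero_iff_norm_tendsto_zero]
    refine squeeze_zero' (g := fun L : ℝ => (2 / |l|) * L⁻¹) (Eventually.of_forall fun _ => norm_nonneg _) ?_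
      (by simpa using tendsto_inv_atTop_zero.const_mul (2 / |l|))
    filter_upwards [eventually_gt_atTop 0] with L hL
    rw [mean, integral_exp_mul_complex hI, norm_mul, norm_div, Complex.norm_real,
      Real.norm_of_nonneg (by positivity), norm_mul, Complex.norm_I, one_mul, Complex.norm_real,
      Real.norm_eq_abs, one_div, mul_comm]
    gcongr
    refine (norm_sub_le _ _).trans ?_
    rw [norm_exp_I, norm_exp_I]; norm_num

lemma tendsto_mean_trigPoly (s : Finset ℝ) (b : ℝ → ℂ) (r : ℝ) :
    Tendsto (mean (twist (trigPoly s b) r)) atTop (𝓝 (if r ∈ s then b r else 0)) := by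
  have h1 : mean (twist (trigPoly s b) r) = fun L => ∑ q ∈ s,
      b q * mean (fun t => Complex.exp (Complex.I * (q - r : ℝ) * t)) L := by
    funext L
    have e : ∀ t, twist (trigPoly s b) r t
        = ∑ q ∈ s, b q * Complex.exp (Complex.I * (q - r : ℝ) * t) := by
      intro t
      simp only [twist, trigPoly, Finset.sum_mul]
      refine Finset.sum_congr rfl fun q _ => ?_
      rw [mul_assoc, ← Complex.exp_add]; congr 2; push_cast; ring
    simp only [mean, e]
    rw [intervalIntegral.integral_finsetSum
      (fun q _ => Continuous.intervalIntegrable (by fun_prop) _ _), Finset.mul_sum]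
    refine Finset.sum_congr rfl fun q _ => ?_
    rw [intervalIntegral.integral_const_mul]; ring
  rw [h1]
  have h2 := tendsto_finsetSum s fun q _ => (tendsto_mean_exp (q - r)).const_mul (b q)
  convert h2 using 2
  simp [sub_eq_zero]

/-- `fourierCoef` is a `limUnder`, meaningless without convergence. The means of trigonometric
polynomials converge, and a mean over length L ≥ π is at most twice the Stepanov norm, so
convergence passes to the closure. -/
lemma tendsto_fourierCoef {f : ℝ → ℂ} (hf : IsStepanovAP f) (hl : LocallyIntegrable f) (r : ℝ) :
    Tendsto (mean (twist f r)) atTop (𝓝 (fourierCoef f r)) := by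
  rw [fourierCoef_eq]
  refine tendsto_nhds_limUnder (exists_tendsto_mean (locallyIntegrable_twist hl r) fun ε hε => ?_)
  obtain ⟨s, b, h⟩ := hf.2 ε hε
  refine ⟨twist (trigPoly s b) r, locallyIntegrable_twist (continuous_trigPoly s b).locallyIntegrable r, ?_, _,
    tendsto_mean_trigPoly s b r⟩
  rwa [stepanovNorm_twist_sub]

lemma fourierCoef_sub_trigPoly_le {f : ℝ → ℂ} (hf : IsStepanovAP f) (hl : LocallyIntegrable f)
    (s : Finset ℝ) (b : ℝ → ℂ) (r : ℝ) :
    ‖fourierCoef f r - if r ∈ s then b r else 0‖ₑ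
      ≤ 2 * stepanovNorm (fun t => f t - trigPoly s b t) := by
  rw [← stepanovNorm_twist_sub _ _ r]
  exact enorm_sub_le_of_tendsto_mean (locallyIntegrable_twist hl r) (locallyIntegrable_twist (continuous_trigPoly s b).locallyIntegrable r)
    (tendsto_fourierCoef hf hl r) (tendsto_mean_trigPoly s b r)

lemma MemOmega.locallyIntegrable {α : ℝ} {f : ℝ → ℂ} (hf : MemOmega α f) : LocallyIntegrable f := by
  obtain ⟨B, hB⟩ := hf.bounded
  exact (locallyIntegrable_const B).mono hf.almostPeriodic.1
    (Eventually.of_forall fun t => (hB t).trans (Real.le_norm_self B))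

/-! ### Bounded entire functions of exponential type -/

lemma MemB.comp_neg {σ : ℝ} {g : ℂ → ℂ} (hg : MemB σ g) : MemB σ (fun z => g (-z)) where
  entire := hg.entire.comp differentiable_neg
  expType ε hε := by
    obtain ⟨C, hC⟩ := hg.expType ε hε
    exact ⟨C, fun z => by simpa using hC (-z)⟩
  bounded := by
    obtain ⟨B, hB⟩ := hg.bounded
    exact ⟨B, fun t => by simpa using hB (-t)⟩

lemma MemB.mono {σ σ' : ℝ} (h : σ ≤ σ') {g : ℂ → ℂ} (hg : MemB σ g) : MemB σ' g where
  entire := hg.entire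
  expType ε hε := by
    obtain ⟨C, hC⟩ := hg.expType ε hε
    refine ⟨C, fun z => (hC z).trans ?_⟩
    have hC0 : 0 ≤ C := by
      have := (norm_nonneg _).trans (hC 0)
      simpa using this
    gcongr
  bounded := hg.bounded

/-- Growth of a bounded function of exponential type off the real axis. -/
lemma MemB.norm_le {σ σ' B : ℝ} (h : σ < σ') {g : ℂ → ℂ} (hg : MemB σ g) (hB : ∀ t : ℝ, ‖g t‖ ≤ B)
    (s : ℝ) {y : ℝ} (hy : 0 ≤ y) : ‖g (s + y * Complex.I)‖ ≤ B * Real.exp (σ' * y) := by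
  obtain ⟨C, hC⟩ := hg.expType (σ' - σ) (by linarith)
  have hC' : ∀ z, ‖g z‖ ≤ C * Real.exp (σ' * ‖z‖) := fun z => by simpa using hC z
  -- The rotation by i carries the right half-plane to the upper one. The exponential factor makes
  -- `F` bounded by `C` on the positive real axis and leaves |g| ≤ B on the imaginary axis, so
  -- Phragmén–Lindelöf gives the bound `B` throughout.
  set F : ℂ → ℂ := fun z => g (Complex.I * z) * Complex.exp (-(σ' * z)) with hF
  have hFn : ∀ z, ‖F z‖ = ‖g (Complex.I * z)‖ * Real.exp (-(σ' * z.re)) := fun z => by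
    simp only [hF]
    rw [norm_mul, Complex.norm_exp]; simp
  have hd : Differentiable ℂ F := by
    have := hg.entire
    simp only [hF]; fun_prop
  have hmain := PhragmenLindelof.right_half_plane_of_bounded_on_real (f := F) (C := B)
    (z := y - s * Complex.I) hd.diffContOnCl ?_ ?_ ?_ ?_
  · have e1 : Complex.I * (y - s * Complex.I) = s + y * Complex.I := by
      linear_combination (-s : ℂ) * Complex.I_mul_I
    rw [hFn, e1] at hmain
    simp only [Complex.sub_re, Complex.ofReal_re, Complex.mul_re, Complex.I_re, mul_zero,
      Complex.ofReal_im, Complex.I_im, mul_one, sub_self, sub_zero] at hmain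
    calc _ = ‖g (s + y * Complex.I)‖ * Real.exp (-(σ' * y)) * Real.exp (σ' * y) := by
          rw [mul_assoc, ← Real.exp_add]; simp
      _ ≤ _ := by gcongr
  · refine ⟨1, by norm_num, 2 * |σ'|, Asymptotics.IsBigO.of_bound C (Eventually.of_forall fun z => ?_)⟩
    rw [hFn, Real.rpow_one, Real.norm_of_nonneg (Real.exp_pos _).le]
    have hC0 : 0 ≤ C := by simpa using (norm_nonneg _).trans (hC 0)
    calc _ ≤ C * Real.exp (σ' * ‖Complex.I * z‖) * Real.exp (-(σ' * z.re)) := by gcongr; exact hC' _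
      _ = C * Real.exp (σ' * ‖z‖ - σ' * z.re) := by
        rw [mul_assoc, ← Real.exp_add, norm_mul, Complex.norm_I, one_mul]; ring_nf
      _ ≤ _ := by
        gcongr
        have h1 : σ' * ‖z‖ ≤ |σ'| * ‖z‖ := by gcongr; exact le_abs_self _
        have h2 : -(σ' * z.re) ≤ |σ'| * ‖z‖ := by
          refine (neg_le_abs _).trans ?_
          rw [abs_mul]; gcongr; exact Complex.abs_re_le_norm z
        linarith
  · refine isBoundedUnder_of_eventually_le (a := C) ?_
    filter_upwards [eventually_ge_atTop 0] with x hx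
    rw [hFn]
    calc _ ≤ C * Real.exp (σ' * ‖Complex.I * x‖) * Real.exp (-(σ' * (x : ℂ).re)) := by
          gcongr; exact hC' _
      _ = C := by
        rw [mul_assoc, ← Real.exp_add, norm_mul, Complex.norm_I, one_mul, Complex.norm_real,
          Real.norm_of_nonneg hx]; simp
  · intro x
    rw [hFn]
    have e1 : Complex.I * (x * Complex.I) = ((-x : ℝ) : ℂ) := by
      push_cast; linear_combination (x : ℂ) * Complex.I_mul_I
    rw [e1]
    simpa using hB (-x)
  · simpa using hy

/-- Cauchy's theorem on the rectangle over [a, b] of height Y. Each vertical side costs at most B/κ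
and the top tends to 0 as Y → ∞, so the bound does not depend on a and b. -/
lemma norm_integral_le_of_decay {F : ℂ → ℂ} (hF : Differentiable ℂ F) {B κ : ℝ} (hκ : 0 < κ)
    (hB : ∀ s y : ℝ, 0 ≤ y → ‖F (s + y * Complex.I)‖ ≤ B * Real.exp (-(κ * y))) (a b : ℝ) :
    ‖∫ t in a..b, F t‖ ≤ 2 * (B / κ) := by
  have hB0 : 0 ≤ B := by simpa using (norm_nonneg _).trans (hB 0 0 le_rfl)
  have hvert : ∀ s Y : ℝ, 0 ≤ Y → ‖∫ y in (0 : ℝ)..Y, F (s + y * Complex.I)‖ ≤ B / κ := by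
    intro s Y hY
    calc _ ≤ ∫ y in (0 : ℝ)..Y, B * Real.exp (-(κ * y)) :=
          intervalIntegral.norm_integral_le_of_norm_le hY
            (Eventually.of_forall fun y hy => hB s y hy.1.le)
            (Continuous.intervalIntegrable (by fun_prop) _ _)
      _ = B * ((1 - Real.exp (-(κ * Y))) / κ) := by
          rw [intervalIntegral.integral_const_mul]
          congr 1
          have : ∀ y ∈ Set.uIcc 0 Y, HasDerivAt (fun y => -Real.exp (-(κ * y)) / κ)
              (Real.exp (-(κ * y))) y := by
            intro y _
            have h1 : HasDerivAt (fun y : ℝ => -(κ * y)) (-κ) y := by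
              simpa using ((hasDerivAt_id y).const_mul κ).fun_neg
            have h2 := h1.exp.fun_neg.div_const κ
            rwa [mul_neg, neg_neg, mul_div_assoc, div_self hκ.ne', mul_one] at h2
          rw [intervalIntegral.integral_eq_sub_of_hasDerivAt this
            (Continuous.intervalIntegrable (by fun_prop) _ _)]
          simp; ring
      _ ≤ B * (1 / κ) := by gcongr; linarith [Real.exp_pos (-(κ * Y))]
      _ = B / κ := by ring
  have hle : ∀ Y : ℝ, 0 ≤ Y →
      ‖∫ t in a..b, F t‖ ≤ B * Real.exp (-(κ * Y)) * |b - a| + 2 * (B / κ) := by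
    intro Y hY
    have h := Complex.integral_boundary_rect_eq_zero_of_differentiableOn F a (b + Y * Complex.I)
      hF.differentiableOn
    simp only [Complex.ofReal_re, Complex.add_re, Complex.mul_re, Complex.I_re, mul_zero,
      Complex.ofReal_im, Complex.I_im, mul_one, sub_self, add_zero, Complex.add_im,
      Complex.mul_im, zero_add, Complex.ofReal_zero, zero_mul] at h
    have h1 : ‖∫ x in a..b, F (x + Y * Complex.I)‖ ≤ B * Real.exp (-(κ * Y)) * |b - a| :=
      intervalIntegral.norm_integral_le_of_norm_le_const fun x _ => hB x Y hY
    have h2 := hvert b Y hY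
    have h3 := hvert a Y hY
    have e : ∫ t in a..b, F t = (∫ x in a..b, F (x + Y * Complex.I))
        - Complex.I * (∫ y in (0 : ℝ)..Y, F (b + y * Complex.I))
        + Complex.I * (∫ y in (0 : ℝ)..Y, F (a + y * Complex.I)) := by
      simp only [smul_eq_mul] at h
      linear_combination h
    rw [e]
    refine (norm_add_le _ _).trans ((add_le_add_left (norm_sub_le _ _) _).trans ?_)
    simp only [norm_mul, Complex.norm_I, one_mul]
    linarith
  have hlim : Tendsto (fun Y : ℝ => B * Real.exp (-(κ * Y)) * |b - a| + 2 * (B / κ)) atTop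
      (𝓝 (B * 0 * |b - a| + 2 * (B / κ))) := by
    refine Tendsto.add_const _ (Tendsto.mul_const _ (Tendsto.const_mul _ ?_))
    exact Real.tendsto_exp_neg_atTop_nhds_zero.comp (tendsto_id.const_mul_atTop hκ)
  have := ge_of_tendsto hlim ((eventually_ge_atTop 0).mono hle)
  simpa using this

/-- For r < -σ' the function g(z)e^{-irz} decays in the upper half-plane at rate -r - σ', so the
contour shift applies. Positive r reduces to this by t ↦ -t. Bounded integrals have vanishing means:
frequencies beyond the type do not occur in `g`. -/
lemma MemB.exists_norm_integral_le {σ r : ℝ} {g : ℂ → ℂ} (hg : MemB σ g) (hr : σ < |r|) :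
    ∃ K, ∀ L : ℝ, ‖∫ t in (0 : ℝ)..L, twist (fun t => g t) r t‖ ≤ K := by
  obtain ⟨B, hB⟩ := hg.bounded
  obtain ⟨σ', h1, h2⟩ := exists_between hr
  have key : ∀ (g : ℂ → ℂ) (r : ℝ), MemB σ g → (∀ t : ℝ, ‖g t‖ ≤ B) → r < -σ' → ∀ a b : ℝ,
      ‖∫ t in a..b, g t * Complex.exp (-(Complex.I * r * t))‖ ≤ 2 * (B / (-r - σ')) := by
    intro g r hg hB hr a b
    refine norm_integral_le_of_decay (F := fun z => g z * Complex.exp (-(Complex.I * r * z))) ?_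
      (by linarith) ?_ a b
    · have := hg.entire
      fun_prop
    · intro s y hy
      rw [norm_mul, Complex.norm_exp]
      calc _ ≤ B * Real.exp (σ' * y) * Real.exp (r * y) := by
            refine mul_le_mul (hg.norm_le h1 hB s hy) (le_of_eq (by simp)) (Real.exp_pos _).le ?_
            exact (norm_nonneg _).trans (hg.norm_le h1 hB s hy)
        _ = _ := by rw [mul_assoc, ← Real.exp_add]; ring_nf
  rcases le_total 0 r with h0 | h0
  · rw [abs_of_nonneg h0] at h2
    refine ⟨2 * (B / (r - σ')), fun L => ?_⟩
    have h := key (fun z => g (-z)) (-r) hg.comp_neg (fun t => by simpa using hB (-t))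
      (by linarith) (-L) 0
    have e := intervalIntegral.integral_comp_neg (a := -L) (b := 0)
      (fun t : ℝ => twist (fun t : ℝ => g t) r t)
    simp only [neg_zero, neg_neg, twist] at e ⊢
    rw [← e]
    simpa using h
  · rw [abs_of_nonpos h0] at h2
    exact ⟨_, fun L => key g r hg hB (by linarith) 0 L⟩

lemma MemB.tendsto_mean {σ r : ℝ} {g : ℂ → ℂ} (hg : MemB σ g) (hr : σ < |r|) :
    Tendsto (mean (twist (fun t => g t) r)) atTop (𝓝 0) := by
  obtain ⟨K, hK⟩ := hg.exists_norm_integral_le hr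
  rw [tendsto_zero_iff_norm_tendsto_zero]
  refine squeeze_zero' (g := fun L : ℝ => L⁻¹ * K) (Eventually.of_forall fun _ => norm_nonneg _) ?_
    (by simpa using tendsto_inv_atTop_zero.mul_const K)
  filter_upwards [eventually_gt_atTop 0] with L hL
  rw [mean, norm_mul, Complex.norm_real, Real.norm_of_nonneg (by positivity), one_div]
  gcongr
  exact hK L

/-- Subtracting any admissible `g` leaves the coefficient at r unchanged, and a coefficient is at
most twice the Stepanov norm. -/
lemma enorm_fourierCoef_le {f : ℝ → ℂ} (hf : IsStepanovAP f) (hl : LocallyIntegrable f) {σ r : ℝ}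
    (hr : σ < |r|) : ‖fourierCoef f r‖ₑ ≤ 2 * bestApprox σ f := by
  simp only [bestApprox, ENNReal.mul_iInf_of_ne (two_ne_zero) (ENNReal.ofNat_ne_top)]
  refine le_iInf₂ fun g hg => ?_
  have hgl : LocallyIntegrable (fun t : ℝ => g t) :=
    (hg.entire.continuous.comp Complex.continuous_ofReal).locallyIntegrable
  rw [← stepanovNorm_twist_sub _ _ r]
  simpa using enorm_sub_le_of_tendsto_mean (locallyIntegrable_twist hl r)
    (locallyIntegrable_twist hgl r) (tendsto_fourierCoef hf hl r) (hg.tendsto_mean hr)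

lemma bestApprox_anti {σ σ' : ℝ} (h : σ ≤ σ') (f : ℝ → ℂ) : bestApprox σ' f ≤ bestApprox σ f :=
  le_iInf₂ fun g hg => iInf₂_le g (hg.mono h)

/-! ### Weighted tail integrals and the trapezoidal kernel -/

/-- Dyadic summation of a weighted tail integral. -/
lemma lintegral_Ioi_mul_le {g : ℝ → ℝ≥0∞} {A : ℝ} (hA : 0 < A) {D : ℝ≥0∞} (p : ℕ)
    (h : ∀ T, A ≤ T → ∫⁻ t in Set.Ioc 0 T, g t ≤ D * ENNReal.ofReal (T ^ p)) :
    ∫⁻ t in Set.Ioi A, g t * ENNReal.ofReal (1 / t ^ (p + 1))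
      ≤ D * ENNReal.ofReal (2 ^ (p + 1) / A) := by
  have hpow : ∀ i : ℕ, 0 < 2 ^ i * A := fun i => by positivity
  have hsub : Set.Ioi A ⊆ ⋃ i : ℕ, Set.Ioc (2 ^ i * A) (2 ^ (i + 1) * A) := by
    intro t ht
    have ht : A < t := ht
    have hr : 1 < t / A := by rwa [one_lt_div hA]
    obtain ⟨n, hn1, hn2⟩ : ∃ n : ℕ, (2 : ℝ) ^ n < t / A ∧ t / A ≤ 2 ^ (n + 1) := by
      have hex : ∃ n : ℕ, t / A ≤ 2 ^ n :=
        (pow_unbounded_of_one_lt (t / A) (by norm_num : (1 : ℝ) < 2)).imp fun _ => le_of_lt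
      classical
      have h0 : Nat.find hex ≠ 0 := by
        intro h0
        have := Nat.find_spec hex
        rw [h0, pow_zero] at this
        linarith
      obtain ⟨k, hk⟩ := Nat.exists_eq_succ_of_ne_zero h0
      refine ⟨k, not_le.mp (Nat.find_min hex (by omega)), ?_⟩
      have := Nat.find_spec hex
      rwa [hk] at this
    refine Set.mem_iUnion.mpr ⟨n, ?_, ?_⟩
    · rwa [lt_div_iff₀ hA] at hn1
    · rwa [div_le_iff₀ hA] at hn2
  have hblock : ∀ i : ℕ, ∫⁻ t in Set.Ioc (2 ^ i * A) (2 ^ (i + 1) * A),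
      g t * ENNReal.ofReal (1 / t ^ (p + 1)) ≤ D * ENNReal.ofReal (2 ^ p / A * (1 / 2) ^ i) := by
    intro i
    have hAi : A ≤ 2 ^ (i + 1) * A := le_mul_of_one_le_left hA.le (one_le_pow₀ (by norm_num))
    calc _ ≤ ∫⁻ t in Set.Ioc (2 ^ i * A) (2 ^ (i + 1) * A),
          g t * ENNReal.ofReal (1 / (2 ^ i * A) ^ (p + 1)) := by
          refine setLIntegral_mono' measurableSet_Ioc fun t ht => ?_
          have := ht.1
          have := hpow i
          gcongr
      _ = (∫⁻ t in Set.Ioc (2 ^ i * A) (2 ^ (i + 1) * A), g t) *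
          ENNReal.ofReal (1 / (2 ^ i * A) ^ (p + 1)) := lintegral_mul_const' _ _ ENNReal.ofReal_ne_top
      _ ≤ (D * ENNReal.ofReal ((2 ^ (i + 1) * A) ^ p)) *
          ENNReal.ofReal (1 / (2 ^ i * A) ^ (p + 1)) := by
          gcongr
          exact (lintegral_mono_set (Set.Ioc_subset_Ioc_left (hpow i).le)).trans (h _ hAi)
      _ = _ := by
          rw [mul_assoc, ← ENNReal.ofReal_mul (by positivity)]
          congr 2
          rw [pow_succ (2 : ℝ) i, pow_succ (2 ^ i * A) p, mul_comm ((2 : ℝ) ^ i) 2, mul_assoc 2,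
            mul_pow 2 (2 ^ i * A), one_div_pow]
          have := hpow i
          field_simp
  calc _ ≤ ∫⁻ t in ⋃ i : ℕ, Set.Ioc (2 ^ i * A) (2 ^ (i + 1) * A),
        g t * ENNReal.ofReal (1 / t ^ (p + 1)) := lintegral_mono_set hsub
    _ ≤ ∑' i : ℕ, ∫⁻ t in Set.Ioc (2 ^ i * A) (2 ^ (i + 1) * A),
        g t * ENNReal.ofReal (1 / t ^ (p + 1)) := lintegral_iUnion_le _ _
    _ ≤ ∑' i : ℕ, D * ENNReal.ofReal (2 ^ p / A * (1 / 2) ^ i) := ENNReal.tsum_le_tsum hblock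
    _ = D * ENNReal.ofReal (2 ^ (p + 1) / A) := by
        rw [ENNReal.tsum_mul_left, ← ENNReal.ofReal_tsum_of_nonneg (fun i => by positivity)
          (summable_geometric_two.mul_left _), tsum_mul_left, tsum_geometric_two]
        congr 2; ring

lemma one_sub_cos_div_sq_le (a t : ℝ) :
    (1 - Real.cos (a * t)) / t ^ 2 ≤ (a ^ 2 / 2 + 2) * (1 + t ^ 2)⁻¹ := by
  rcases eq_or_ne t 0 with rfl | ht
  · simp; positivity
  have h1 : 1 - Real.cos (a * t) ≤ a ^ 2 / 2 * t ^ 2 := by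
    have := Real.one_sub_sq_div_two_le_cos (x := a * t); nlinarith
  have h2 : 1 - Real.cos (a * t) ≤ 2 := by linarith [Real.neg_one_le_cos (a * t)]
  have ht2 : 0 < t ^ 2 := by positivity
  rw [← div_eq_mul_inv, div_le_div_iff₀ ht2 (by positivity)]
  nlinarith

lemma one_sub_cos_div_sq_nonneg (a t : ℝ) : 0 ≤ (1 - Real.cos (a * t)) / t ^ 2 :=
  div_nonneg (by linarith [Real.cos_le_one (a * t)]) (by positivity)

lemma integrable_one_sub_cos_div_sq (a : ℝ) :
    Integrable (fun t : ℝ => (1 - Real.cos (a * t)) / t ^ 2) := by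
  refine (integrable_inv_one_add_sq.const_mul (a ^ 2 / 2 + 2)).mono'
    (Measurable.aestronglyMeasurable (by fun_prop)) (Eventually.of_forall fun t => ?_)
  rw [Real.norm_of_nonneg (one_sub_cos_div_sq_nonneg a t)]
  exact one_sub_cos_div_sq_le a t

/-- The constant `∫_0^∞ (1 - cos t) / t²`. -/
noncomputable def cosConst : ℝ := ∫ t in Set.Ioi (0 : ℝ), (1 - Real.cos t) / t ^ 2

/-- Only positivity matters: the kernel is normalised by `cosConst` itself, so its value π/2 never
enters. -/
lemma cosConst_pos : 0 < cosConst := by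
  have hi : IntegrableOn (fun t : ℝ => (1 - Real.cos t) / t ^ 2) (Set.Ioi 0) := by
    simpa using (integrable_one_sub_cos_div_sq 1).integrableOn (s := Set.Ioi 0)
  rw [cosConst, setIntegral_pos_iff_support_of_nonneg_ae
    (Eventually.of_forall fun t => by simpa using one_sub_cos_div_sq_nonneg 1 t) hi]
  refine lt_of_lt_of_le ?_ (measure_mono (s := Set.Ioo 0 Real.pi) ?_)
  · rw [Real.volume_Ioo]; simp [Real.pi_pos]
  · intro t ht
    refine ⟨?_, ht.1⟩
    have h1 : Real.cos t < 1 := by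
      rw [← Real.cos_zero]
      exact Real.cos_lt_cos_of_nonneg_of_le_pi le_rfl ht.2.le ht.1
    have : 0 < (1 - Real.cos t) / t ^ 2 := div_pos (by linarith) (by have := ht.1; positivity)
    exact this.ne'

/-- Scaling t ↦ at. The absolute values produced here are the pieces from which the trapezoid is
assembled. -/
lemma integral_one_sub_cos_div_sq (a : ℝ) :
    ∫ t in Set.Ioi (0 : ℝ), (1 - Real.cos (a * t)) / t ^ 2 = |a| * cosConst := by
  have key : ∀ a : ℝ, 0 < a →
      ∫ t in Set.Ioi (0 : ℝ), (1 - Real.cos (a * t)) / t ^ 2 = a * cosConst := by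
    intro a ha
    have h := integral_comp_mul_left_Ioi (fun t : ℝ => (1 - Real.cos t) / t ^ 2) 0 ha
    rw [mul_zero, smul_eq_mul] at h
    have e : ∀ t : ℝ, (1 - Real.cos (a * t)) / t ^ 2
        = a ^ 2 * ((1 - Real.cos (a * t)) / (a * t) ^ 2) := fun t => by
      rcases eq_or_ne t 0 with rfl | ht
      · simp
      · field_simp
    simp_rw [e]
    rw [integral_const_mul, h, cosConst]
    field_simp
  rcases lt_trichotomy a 0 with ha | rfl | ha
  · rw [abs_of_neg ha, ← key (-a) (by linarith)]
    simp
  · simp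
  · rw [abs_of_pos ha, key a ha]

/-- The kernel whose cosine transform is a trapezoid. -/
noncomputable def kernel (h l t : ℝ) : ℝ :=
  (Real.cos (l * t) - Real.cos ((l + h) * t)) / (2 * cosConst * h * t ^ 2)

/-- The trapezoid equal to `1` on `|r| ≤ l` and to `0` on `|r| ≥ l + h`. -/
noncomputable def trapezoid (h l r : ℝ) : ℝ :=
  (|l + h + r| + |l + h - r| - |l + r| - |l - r|) / (2 * h)

lemma trapezoid_eq_one {h l r : ℝ} (hh : 0 < h) (hr : |r| ≤ l) : trapezoid h l r = 1 := by
  have := abs_le.mp hr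
  rw [trapezoid, abs_of_nonneg (by linarith), abs_of_nonneg (by linarith),
    abs_of_nonneg (by linarith), abs_of_nonneg (by linarith)]
  field_simp; ring

lemma trapezoid_eq_zero {h l r : ℝ} (hh : 0 < h) (hl : 0 ≤ l) (hr : l + h ≤ |r|) :
    trapezoid h l r = 0 := by
  rw [trapezoid]
  rcases le_abs'.mp hr with h1 | h1
  · rw [abs_of_nonpos (by linarith : l + h + r ≤ 0), abs_of_nonneg (by linarith : 0 ≤ l + h - r),
      abs_of_nonpos (by linarith : l + r ≤ 0), abs_of_nonneg (by linarith : 0 ≤ l - r)]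
    ring
  · rw [abs_of_nonneg (by linarith : 0 ≤ l + h + r), abs_of_nonpos (by linarith : l + h - r ≤ 0),
      abs_of_nonneg (by linarith : 0 ≤ l + r), abs_of_nonpos (by linarith : l - r ≤ 0)]
    ring

lemma abs_trapezoid_le {h : ℝ} (hh : 0 < h) (l r : ℝ) : |trapezoid h l r| ≤ 1 := by
  rw [trapezoid, abs_div, abs_of_pos (by positivity : 0 < 2 * h), div_le_one (by positivity)]
  have h1 := abs_abs_sub_abs_le_abs_sub (l + h + r) (l + r)
  have h2 := abs_abs_sub_abs_le_abs_sub (l + h - r) (l - r)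
  rw [show l + h + r - (l + r) = h by ring, abs_of_pos hh] at h1
  rw [show l + h - r - (l - r) = h by ring, abs_of_pos hh] at h2
  rw [abs_le] at h1 h2 ⊢
  constructor <;> linarith

lemma kernel_eq (h l t : ℝ) : kernel h l t = (2 * cosConst * h)⁻¹ *
    ((1 - Real.cos ((l + h) * t)) / t ^ 2 - (1 - Real.cos (l * t)) / t ^ 2) := by
  rw [kernel, ← sub_div, ← div_eq_inv_mul, div_div, mul_comm (t ^ 2)]
  congr 1; ring

lemma exists_abs_kernel_le (h l : ℝ) :
    ∃ D : ℝ, 0 ≤ D ∧ ∀ t, |kernel h l t| ≤ D * (1 + t ^ 2)⁻¹ := by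
  refine ⟨|(2 * cosConst * h)⁻¹| * (((l + h) ^ 2 / 2 + 2) + (l ^ 2 / 2 + 2)), by positivity, fun t => ?_⟩
  rw [kernel_eq, abs_mul, mul_assoc |_|]
  refine mul_le_mul_of_nonneg_left ?_ (abs_nonneg _)
  have h1 := one_sub_cos_div_sq_le (l + h) t
  have h2 := one_sub_cos_div_sq_le l t
  have h3 := one_sub_cos_div_sq_nonneg (l + h) t
  have h4 := one_sub_cos_div_sq_nonneg l t
  rw [abs_le]
  constructor <;> linarith

lemma integrable_kernel (h l : ℝ) : Integrable (kernel h l) := by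
  have : kernel h l = fun t => (2 * cosConst * h)⁻¹ *
    ((1 - Real.cos ((l + h) * t)) / t ^ 2 - (1 - Real.cos (l * t)) / t ^ 2) :=
    funext (kernel_eq h l)
  rw [this]
  exact ((integrable_one_sub_cos_div_sq _).sub (integrable_one_sub_cos_div_sq _)).const_mul _

/-- The product formula 2 cos(rt) cos(at) = cos((a+r)t) + cos((a-r)t), for a = l and a = l + h,
splits the integrand into four terms (1 - cos)/t². -/
lemma integral_kernel_mul_cos {h : ℝ} (hh : 0 < h) (l r : ℝ) :
    ∫ t in Set.Ioi (0 : ℝ), 2 * Real.cos (r * t) * kernel h l t = trapezoid h l r := by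
  have e : ∀ t : ℝ, 2 * Real.cos (r * t) * kernel h l t = (2 * cosConst * h)⁻¹ *
      (((1 - Real.cos ((l + h + r) * t)) / t ^ 2 + (1 - Real.cos ((l + h - r) * t)) / t ^ 2)
        - ((1 - Real.cos ((l + r) * t)) / t ^ 2 + (1 - Real.cos ((l - r) * t)) / t ^ 2)) := by
    intro t
    rw [kernel_eq, add_mul (l + h), sub_mul (l + h), add_mul l r, sub_mul l r, Real.cos_add _ (r * t),
      Real.cos_sub _ (r * t), Real.cos_add _ (r * t), Real.cos_sub _ (r * t)]
    ring
  have hi := fun a : ℝ => (integrable_one_sub_cos_div_sq a).integrableOn (s := Set.Ioi 0)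
  simp_rw [e]
  rw [integral_const_mul, integral_sub (Integrable.fun_add (hi _) (hi _)) (Integrable.fun_add (hi _) (hi _)),
    integral_add (hi _) (hi _), integral_add (hi _) (hi _)]
  simp_rw [integral_one_sub_cos_div_sq]
  rw [trapezoid]
  have := cosConst_pos
  field_simp
  ring

lemma integral_two_mul_kernel {h l : ℝ} (hh : 0 < h) (hl : 0 ≤ l) :
    ∫ t in Set.Ioi (0 : ℝ), 2 * kernel h l t = 1 := by
  have := integral_kernel_mul_cos hh l 0
  rw [trapezoid_eq_one hh (by simpa using hl)] at this
  simpa using this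

/-! ### Uniform almost periodicity and uniqueness -/

/-- Uniform almost periodicity: uniform approximability by trigonometric polynomials. -/
def IsUniformAP (F : ℝ → ℂ) : Prop :=
  ∀ ε : ℝ, 0 < ε → ∃ (s : Finset ℝ) (b : ℝ → ℂ), ∀ t, ‖F t - trigPoly s b t‖ ≤ ε

lemma stepanovNorm_le_of_norm_le {u : ℝ → ℂ} {B : ℝ} (h : ∀ t, ‖u t‖ ≤ B) :
    stepanovNorm u ≤ ENNReal.ofReal B := by
  refine iSup_le fun y => ?_
  calc _ ≤ ENNReal.ofReal (1 / Real.pi) *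
        ∫⁻ t in Set.Ioc y (y + Real.pi), ENNReal.ofReal B := by
        gcongr with t
        rw [← ofReal_norm]
        exact ENNReal.ofReal_le_ofReal (h t)
    _ = ENNReal.ofReal B := by
        have hp := Real.pi_pos
        rw [setLIntegral_const, Real.volume_Ioc, add_sub_cancel_left, mul_comm, mul_assoc,
          ← ENNReal.ofReal_mul hp.le, mul_one_div_cancel hp.ne']
        simp

lemma IsUniformAP.continuous {F : ℝ → ℂ} (hF : IsUniformAP F) : Continuous F := by
  refine continuous_of_uniform_approx_of_continuous fun u hu => ?_
  obtain ⟨ε, hε, hεu⟩ := Metric.mem_uniformity_dist.mp hu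
  obtain ⟨s, b, h⟩ := hF (ε / 2) (by linarith)
  refine ⟨trigPoly s b, continuous_trigPoly s b, fun t => hεu ?_⟩
  rw [dist_eq_norm]
  linarith [h t]

lemma IsUniformAP.isStepanovAP {F : ℝ → ℂ} (hF : IsUniformAP F) : IsStepanovAP F := by
  refine ⟨hF.continuous.aestronglyMeasurable, fun ε hε => ?_⟩
  obtain ⟨δ, hδ0, hδ⟩ := ENNReal.lt_iff_exists_nnreal_btwn.mp hε
  obtain ⟨s, b, h⟩ := hF δ (by exact_mod_cast hδ0)
  refine ⟨s, b, (stepanovNorm_le_of_norm_le h).trans_lt ?_⟩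
  simpa using hδ

lemma norm_trigPoly_le (s : Finset ℝ) (b : ℝ → ℂ) (t : ℝ) :
    ‖trigPoly s b t‖ ≤ ∑ r ∈ s, ‖b r‖ := by
  refine (norm_sum_le _ _).trans (le_of_eq (Finset.sum_congr rfl fun r _ => ?_))
  rw [norm_mul, norm_exp_I, mul_one]

lemma IsUniformAP.exists_bound {F : ℝ → ℂ} (hF : IsUniformAP F) : ∃ B, 0 ≤ B ∧ ∀ t, ‖F t‖ ≤ B := by
  obtain ⟨s, b, h⟩ := hF 1 one_pos
  refine ⟨1 + ∑ r ∈ s, ‖b r‖, by positivity, fun t => ?_⟩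
  calc ‖F t‖ = ‖(F t - trigPoly s b t) + trigPoly s b t‖ := by simp
    _ ≤ _ := (norm_add_le _ _).trans (add_le_add (h t) (norm_trigPoly_le s b t))

lemma norm_mean_le {u : ℝ → ℂ} {B : ℝ} (h : ∀ t, ‖u t‖ ≤ B) {L : ℝ} (hL : 0 < L) :
    ‖mean u L‖ ≤ B := by
  have h1 : ‖∫ t in (0 : ℝ)..L, u t‖ ≤ B * |L - 0| :=
    intervalIntegral.norm_integral_le_of_norm_le_const fun t _ => h t
  rw [mean, norm_mul, Complex.norm_real, Real.norm_of_nonneg (by positivity)]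
  calc _ ≤ 1 / L * (B * |L - 0|) := by gcongr
    _ = B := by rw [sub_zero, abs_of_pos hL]; field_simp

/-- If all Fourier coefficients vanish, so does the quadratic mean. -/
lemma IsUniformAP.tendsto_mean_normSq {F : ℝ → ℂ} (hF : IsUniformAP F)
    (h0 : ∀ r, Tendsto (mean (twist F r)) atTop (𝓝 0)) :
    Tendsto (mean fun t => ((‖F t‖ ^ 2 : ℝ) : ℂ)) atTop (𝓝 0) := by
  obtain ⟨B, hB0, hB⟩ := hF.exists_bound
  have hc := hF.continuous
  rw [Metric.tendsto_nhds]
  intro ε hε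
  obtain ⟨s, b, h⟩ := hF (ε / (2 * (B + 1))) (by positivity)
  have hP : Tendsto (mean fun t => F t * (starRingEnd ℂ) (trigPoly s b t)) atTop (𝓝 0) := by
    have e : (mean fun t => F t * (starRingEnd ℂ) (trigPoly s b t)) =
        fun L => ∑ r ∈ s, (starRingEnd ℂ) (b r) * mean (twist F r) L := by
      funext L
      have e1 : ∀ t, F t * (starRingEnd ℂ) (trigPoly s b t)
          = ∑ r ∈ s, (starRingEnd ℂ) (b r) * twist F r t := by
        intro t
        simp only [trigPoly, map_sum, map_mul, twist, Finset.mul_sum, ← Complex.exp_conj,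
          Complex.conj_I, Complex.conj_ofReal]
        refine Finset.sum_congr rfl fun r _ => ?_
        rw [neg_mul, neg_mul]; ring
      simp only [mean, e1]
      rw [intervalIntegral.integral_finsetSum, Finset.mul_sum]
      · refine Finset.sum_congr rfl fun q _ => ?_
        rw [intervalIntegral.integral_const_mul]; ring
      · intro r _
        apply Continuous.intervalIntegrable
        unfold twist; fun_prop
    rw [e]
    simpa using tendsto_finsetSum s fun r _ => (h0 r).const_mul ((starRingEnd ℂ) (b r))
  filter_upwards [Metric.tendsto_nhds.mp hP (ε / 2) (by linarith), eventually_gt_atTop 0] with L h1 hL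
  have hcP := continuous_trigPoly s b
  -- With P the approximating polynomial, |F|² = F·P̄ + F·(F - P)‾. The first mean is a finite
  -- combination of Fourier means of F and tends to 0; the second is at most ε/2 by the choice of P.
  have e : mean (fun t => ((‖F t‖ ^ 2 : ℝ) : ℂ)) L =
      mean (fun t => F t * (starRingEnd ℂ) (trigPoly s b t)) L +
      mean (fun t => F t * (starRingEnd ℂ) (F t - trigPoly s b t)) L := by
    simp only [mean]
    rw [← mul_add, ← intervalIntegral.integral_add]
    · congr 1
      refine intervalIntegral.integral_congr fun t _ => ?_
      simp only [← mul_add, ← map_add, add_sub_cancel, Complex.mul_conj']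
      push_cast; rfl
    · exact Continuous.intervalIntegrable (by fun_prop) _ _
    · exact Continuous.intervalIntegrable (by fun_prop) _ _
  rw [dist_zero_right] at h1 ⊢
  rw [e]
  have h2 : ‖mean (fun t => F t * (starRingEnd ℂ) (F t - trigPoly s b t)) L‖ ≤ ε / 2 := by
    refine norm_mean_le (fun t => ?_) hL
    rw [norm_mul, RCLike.norm_conj]
    calc _ ≤ (B + 1) * (ε / (2 * (B + 1))) :=
          mul_le_mul (by linarith [hB t]) (h t) (norm_nonneg _) (by positivity)
      _ = ε / 2 := by field_simp
  linarith [norm_add_le (mean (fun t => F t * (starRingEnd ℂ) (trigPoly s b t)) L)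
    (mean (fun t => F t * (starRingEnd ℂ) (F t - trigPoly s b t)) L)]

/-- Relative density of almost periods, in covering form. -/
lemma IsUniformAP.exists_finset_near {F : ℝ → ℂ} (hF : IsUniformAP F) (x : ℝ) {ε : ℝ} (hε : 0 < ε) :
    ∃ T : Finset ℝ, ∀ t, ∃ c ∈ T, ‖F (x + (t - c)) - F x‖ < ε := by
  obtain ⟨s, b, h⟩ := hF (ε / 3) (by positivity)
  -- The phases (e^{irt}), r ∈ s, stay in a compact set, so finitely many points τ suffice for every
  -- t to have nearly the phases of some τ. Then t - τ is an almost period of the polynomial.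
  set Φ : ℝ → (s → ℂ) := fun t r => Complex.exp (Complex.I * (r : ℝ) * t) with hΦ
  have hbd : TotallyBounded (Set.range Φ) := by
    have : Set.range Φ ⊆ Metric.closedBall 0 1 := by
      rintro _ ⟨t, rfl⟩
      rw [mem_closedBall_zero_iff, pi_norm_le_iff_of_nonneg zero_le_one]
      intro r
      exact (norm_exp_I r t).le
    exact (isCompact_closedBall (0 : s → ℂ) 1).totallyBounded.subset this
  set Bd : ℝ := ∑ r ∈ s, ‖b r‖ with hBd
  have hη : 0 < ε / (3 * (Bd + 1)) := by positivity
  obtain ⟨T, hTs, hTf, hcov⟩ := Metric.finite_approx_of_totallyBounded hbd _ hη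
  have hTs' : ∀ y ∈ T, ∃ t, Φ t = y := hTs
  choose! τ hτ using hTs'
  refine ⟨hTf.toFinset.image τ, fun t => ?_⟩
  obtain ⟨y, hyT, hy⟩ := Set.mem_iUnion₂.mp (hcov (Set.mem_range_self t))
  refine ⟨τ y, Finset.mem_image_of_mem _ (hTf.mem_toFinset.mpr hyT), ?_⟩
  rw [← hτ y hyT, Metric.mem_ball, dist_eq_norm] at hy
  have hP : ‖trigPoly s b (x + (t - τ y)) - trigPoly s b x‖ ≤ Bd * (ε / (3 * (Bd + 1))) := by
    rw [trigPoly, trigPoly, ← Finset.sum_sub_distrib, hBd, Finset.sum_mul]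
    refine (norm_sum_le _ _).trans (Finset.sum_le_sum fun r hr => ?_)
    rw [← mul_sub, norm_mul]
    gcongr
    have h1 : ‖Φ t ⟨r, hr⟩ - Φ (τ y) ⟨r, hr⟩‖ ≤ ε / (3 * (Bd + 1)) :=
      (norm_le_pi_norm (Φ t - Φ (τ y)) ⟨r, hr⟩).trans hy.le
    calc _ = ‖Complex.exp (Complex.I * r * x) * Complex.exp (-(Complex.I * r * (τ y))) *
          (Φ t ⟨r, hr⟩ - Φ (τ y) ⟨r, hr⟩)‖ := by
          simp only [hΦ]
          rw [mul_sub, ← Complex.exp_add, ← Complex.exp_add, ← Complex.exp_add]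
          congr 3 <;> (push_cast; ring)
      _ ≤ _ := by rwa [norm_mul, norm_mul, norm_exp_I, norm_exp_neg_I, one_mul, one_mul]
  have h4 : Bd * (ε / (3 * (Bd + 1))) < ε / 3 := by
    rw [← mul_div_assoc, div_lt_div_iff₀ (by positivity) (by positivity)]
    nlinarith
  have e : F (x + (t - τ y)) - F x = (F (x + (t - τ y)) - trigPoly s b (x + (t - τ y)))
      + (trigPoly s b (x + (t - τ y)) - trigPoly s b x) - (F x - trigPoly s b x) := by ring
  rw [e]
  have n1 := norm_sub_le ((F (x + (t - τ y)) - trigPoly s b (x + (t - τ y)))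
      + (trigPoly s b (x + (t - τ y)) - trigPoly s b x)) (F x - trigPoly s b x)
  have n2 := norm_add_le (F (x + (t - τ y)) - trigPoly s b (x + (t - τ y)))
    (trigPoly s b (x + (t - τ y)) - trigPoly s b x)
  linarith [h x, h (x + (t - τ y))]

lemma tendsto_mean_shift {u : ℝ → ℂ} (hu : Continuous u) {B : ℝ} (hB : ∀ t, ‖u t‖ ≤ B)
    (h : Tendsto (mean u) atTop (𝓝 0)) (y : ℝ) :
    Tendsto (mean fun t => u (t + y)) atTop (𝓝 0) := by
  have hd : Tendsto (fun L => mean (fun t => u (t + y)) L - mean u L) atTop (𝓝 0) := by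
    rw [tendsto_zero_iff_norm_tendsto_zero]
    refine squeeze_zero' (g := fun L : ℝ => L⁻¹ * (2 * B * |y|))
      (Eventually.of_forall fun _ => norm_nonneg _) ?_
      (by simpa using tendsto_inv_atTop_zero.mul_const (2 * B * |y|))
    filter_upwards [eventually_gt_atTop 0] with L hL
    rw [mean, mean, ← mul_sub, norm_mul, Complex.norm_real, Real.norm_of_nonneg (by positivity),
      one_div, intervalIntegral.integral_comp_add_right (fun t => u t), zero_add]
    gcongr
    have hi : ∀ a b : ℝ, IntervalIntegrable u volume a b := fun a b => hu.intervalIntegrable a b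
    rw [intervalIntegral.integral_interval_sub_interval_comm (hi _ _) (hi _ _) (hi _ _)]
    have h1 : ‖∫ t in y..0, u t‖ ≤ B * |0 - y| :=
      intervalIntegral.norm_integral_le_of_norm_le_const fun t _ => hB t
    have h2 : ‖∫ t in (L + y)..L, u t‖ ≤ B * |L - (L + y)| :=
      intervalIntegral.norm_integral_le_of_norm_le_const fun t _ => hB t
    have e1 : |0 - y| = |y| := by simp
    have e2 : |L - (L + y)| = |y| := by simp
    rw [e1] at h1
    rw [e2] at h2
    linarith [norm_sub_le (∫ t in y..0, u t) (∫ t in (L + y)..L, u t)]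
  simpa using hd.add h

/-- If F(x) ≠ 0, finitely many translates of F suffice for one of them to exceed |F(x)|/2 in modulus
at each t. The mean of the sum of their squares then stays at least (|F(x)|/2)², while each summand
has quadratic mean 0. -/
lemma IsUniformAP.eq_zero {F : ℝ → ℂ} (hF : IsUniformAP F)
    (h0 : ∀ r, Tendsto (mean (twist F r)) atTop (𝓝 0)) (x : ℝ) : F x = 0 := by
  by_contra hx
  have hx' : 0 < ‖F x‖ := norm_pos_iff.mpr hx
  obtain ⟨T, hT⟩ := hF.exists_finset_near x (half_pos hx')
  obtain ⟨B, hB0, hB⟩ := hF.exists_bound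
  have hc := hF.continuous
  have hm : ∀ c : ℝ, Tendsto (mean fun t => ((‖F (t + (x - c))‖ ^ 2 : ℝ) : ℂ)) atTop (𝓝 0) :=
    fun c => tendsto_mean_shift (u := fun t => ((‖F t‖ ^ 2 : ℝ) : ℂ)) (by fun_prop) (B := B ^ 2)
      (fun t => by
        rw [Complex.norm_real, Real.norm_of_nonneg (by positivity)]
        have := hB t
        gcongr) (hF.tendsto_mean_normSq h0) (x - c)
  have hs : Tendsto (fun L => (∑ c ∈ T, mean (fun t => ((‖F (t + (x - c))‖ ^ 2 : ℝ) : ℂ)) L).re)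
      atTop (𝓝 0) := by
    have := (Complex.continuous_re.tendsto _).comp (tendsto_finsetSum T fun c _ => hm c)
    simpa [Function.comp_def] using this
  have hge : ∀ᶠ L : ℝ in atTop, (‖F x‖ / 2) ^ 2 ≤
      (∑ c ∈ T, mean (fun t => ((‖F (t + (x - c))‖ ^ 2 : ℝ) : ℂ)) L).re := by
    filter_upwards [eventually_gt_atTop 0] with L hL
    have e : (∑ c ∈ T, mean (fun t => ((‖F (t + (x - c))‖ ^ 2 : ℝ) : ℂ)) L).re
        = 1 / L * ∫ t in (0 : ℝ)..L, ∑ c ∈ T, ‖F (t + (x - c))‖ ^ 2 := by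
      simp only [mean, intervalIntegral.integral_ofReal]
      rw [intervalIntegral.integral_finsetSum
        (fun c _ => Continuous.intervalIntegrable (by fun_prop) _ _), Finset.mul_sum]
      rw [← Complex.ofReal_re (∑ c ∈ T, _)]
      push_cast; rfl
    rw [e]
    have h2 : ∫ t in (0 : ℝ)..L, (‖F x‖ / 2) ^ 2 ≤
        ∫ t in (0 : ℝ)..L, ∑ c ∈ T, ‖F (t + (x - c))‖ ^ 2 := by
      refine intervalIntegral.integral_mono_on hL.le (by simp)
        (Continuous.intervalIntegrable (by fun_prop) _ _) fun t _ => ?_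
      obtain ⟨c, hcT, hc⟩ := hT t
      rw [show x + (t - c) = t + (x - c) by ring] at hc
      have h3 : ‖F x‖ / 2 ≤ ‖F (t + (x - c))‖ := by
        have := norm_sub_norm_le (F x) (F (t + (x - c)))
        rw [norm_sub_rev] at this
        linarith
      calc (‖F x‖ / 2) ^ 2 ≤ ‖F (t + (x - c))‖ ^ 2 := by gcongr
        _ ≤ _ := Finset.single_le_sum (f := fun c => ‖F (t + (x - c))‖ ^ 2)
          (fun _ _ => by positivity) hcT
    rw [intervalIntegral.integral_const, sub_zero, smul_eq_mul] at h2
    calc (‖F x‖ / 2) ^ 2 = 1 / L * (L * (‖F x‖ / 2) ^ 2) := by field_simp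
      _ ≤ _ := by gcongr
  have := ge_of_tendsto hs hge
  have h5 : 0 < (‖F x‖ / 2) ^ 2 := by positivity
  linarith

lemma trigPoly_sub (s s' : Finset ℝ) (b b' : ℝ → ℂ) (t : ℝ) :
    trigPoly s b t - trigPoly s' b' t = trigPoly (s ∪ s')
      (fun r => (if r ∈ s then b r else 0) - if r ∈ s' then b' r else 0) t := by
  simp only [trigPoly, sub_mul, Finset.sum_sub_distrib, ite_mul, zero_mul, Finset.sum_ite_mem]
  rw [Finset.inter_eq_right.mpr Finset.subset_union_left,
    Finset.inter_eq_right.mpr Finset.subset_union_right]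

/-- Uniqueness: a uniformly almost periodic function with finite spectrum is a polynomial. -/
lemma IsUniformAP.eq_trigPoly {F : ℝ → ℂ} (hF : IsUniformAP F) (s : Finset ℝ) (b : ℝ → ℂ)
    (h : ∀ r, fourierCoef F r = if r ∈ s then b r else 0) (x : ℝ) : F x = trigPoly s b x := by
  have hG : IsUniformAP (fun t => F t - trigPoly s b t) := by
    intro ε hε
    obtain ⟨s', b', h'⟩ := hF ε hε
    refine ⟨s' ∪ s, fun r => (if r ∈ s' then b' r else 0) - if r ∈ s then b r else 0, fun t => ?_⟩
    rw [← trigPoly_sub]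
    simpa using h' t
  have := hG.eq_zero (fun r => ?_) x
  · exact sub_eq_zero.mp this
  · have h1 := tendsto_fourierCoef hF.isStepanovAP hF.continuous.locallyIntegrable r
    have h2 := tendsto_mean_trigPoly s b r
    have h3 := h1.sub h2
    rw [h, sub_self] at h3
    refine h3.congr fun L => ?_
    rw [← mean_sub (locallyIntegrable_twist hF.continuous.locallyIntegrable r)
      (locallyIntegrable_twist (continuous_trigPoly s b).locallyIntegrable r)]
    simp only [mean, twist, sub_mul]

/-! ### Convolution with the kernel -/

lemma aestronglyMeasurable_add_left {f : ℝ → ℂ} (hf : AEStronglyMeasurable f) (x : ℝ) :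
    AEStronglyMeasurable (fun t => f (x + t)) :=
  hf.comp_quasiMeasurePreserving (measurePreserving_add_left volume x).quasiMeasurePreserving

lemma aestronglyMeasurable_sub_left {f : ℝ → ℂ} (hf : AEStronglyMeasurable f) (x : ℝ) :
    AEStronglyMeasurable (fun t => f (x - t)) :=
  hf.comp_quasiMeasurePreserving (Measure.measurePreserving_sub_left volume x).quasiMeasurePreserving

lemma lintegral_Ioc_add_le {u : ℝ → ℂ} (hu : AEStronglyMeasurable u) (x : ℝ) {T : ℝ} (hT : Real.pi ≤ T) :
    ∫⁻ t in Set.Ioc 0 T, ‖u (x + t) + u (x - t)‖ₑ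
      ≤ 4 * stepanovNorm u * ENNReal.ofReal (T ^ 1) := by
  have hT0 : 0 < T := Real.pi_pos.trans_le hT
  have h1 : ∫⁻ t in Set.Ioc 0 T, ‖u (x + t)‖ₑ = ∫⁻ t in Set.Ioc x (x + T), ‖u t‖ₑ := by
    rw [← (measurePreserving_add_left volume x).setLIntegral_comp_preimage_emb
      (measurableEmbedding_addLeft x) (fun t => ‖u t‖ₑ)]
    simp
  have h2 : ∫⁻ t in Set.Ioc 0 T, ‖u (x - t)‖ₑ = ∫⁻ t in Set.Ioc (x - T) (x - T + T), ‖u t‖ₑ := by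
    rw [setLIntegral_congr (Ioc_ae_eq_Icc (α := ℝ) (μ := volume)),
      setLIntegral_congr (s := Set.Ioc (x - T) _) (Ioc_ae_eq_Icc (α := ℝ) (μ := volume)),
      ← (Measure.measurePreserving_sub_left volume x).setLIntegral_comp_preimage_emb
      (MeasurableEquiv.subLeft x).measurableEmbedding (fun t => ‖u t‖ₑ)]
    simp
  calc _ ≤ ∫⁻ t in Set.Ioc 0 T, (‖u (x + t)‖ₑ + ‖u (x - t)‖ₑ) := by
        gcongr with t; exact enorm_add_le _ _
    _ ≤ ENNReal.ofReal (2 * T) * stepanovNorm u + ENNReal.ofReal (2 * T) * stepanovNorm u := by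
        rw [lintegral_add_left' (aestronglyMeasurable_add_left hu x).enorm.restrict, h1, h2]
        exact add_le_add (lintegral_Ioc_le_two_mul u _ hT) (lintegral_Ioc_le_two_mul u _ hT)
    _ = _ := by
        rw [ENNReal.ofReal_mul (by norm_num), pow_one, ENNReal.ofReal_ofNat]; ring

/-- Convolution of `f` with the trapezoidal kernel. -/
noncomputable def conv (h l : ℝ) (f : ℝ → ℂ) (x : ℝ) : ℂ :=
  ∫ t in Set.Ioi (0 : ℝ), (f (x + t) + f (x - t)) * (kernel h l t : ℂ)

/-- Convolution maps the Stepanov norm boundedly to the supremum norm: the kernel is O(1/(1+t²)),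
and the mass of |u| over an interval of length T ≥ π is O(T). Stepanov approximation of f thus
becomes uniform approximation of `conv h l f`. -/
lemma exists_lintegral_kernel_le (h l : ℝ) : ∃ D : ℝ, 0 ≤ D ∧ ∀ (u : ℝ → ℂ) (x : ℝ),
    AEStronglyMeasurable u →
    ∫⁻ t in Set.Ioi (0 : ℝ), ‖(u (x + t) + u (x - t)) * (kernel h l t : ℂ)‖ₑ
      ≤ ENNReal.ofReal D * stepanovNorm u := by
  obtain ⟨D, hD0, hD⟩ := exists_abs_kernel_le h l
  have hp := Real.pi_pos
  refine ⟨D * (4 * Real.pi) + D * (4 * (2 ^ 2 / Real.pi)), by positivity, fun u x hu => ?_⟩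
  have hk : ∀ t, ‖(u (x + t) + u (x - t)) * (kernel h l t : ℂ)‖ₑ
      = ‖u (x + t) + u (x - t)‖ₑ * ENNReal.ofReal |kernel h l t| := fun t => by
    rw [enorm_mul, ← ofReal_norm (kernel h l t : ℂ), Complex.norm_real, Real.norm_eq_abs]
  simp only [hk]
  rw [← Set.Ioc_union_Ioi_eq_Ioi hp.le]
  refine (lintegral_union_le _ _ _).trans ?_
  rw [ENNReal.ofReal_add (by positivity) (by positivity), add_mul]
  refine add_le_add ?_ ?_
  · calc _ ≤ ∫⁻ t in Set.Ioc 0 Real.pi, ‖u (x + t) + u (x - t)‖ₑ * ENNReal.ofReal D := by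
          gcongr with t
          refine (hD t).trans (mul_le_of_le_one_right hD0 (inv_le_one_of_one_le₀ ?_))
          nlinarith [sq_nonneg t]
      _ ≤ (4 * stepanovNorm u * ENNReal.ofReal (Real.pi ^ 1)) * ENNReal.ofReal D := by
          rw [lintegral_mul_const' _ _ ENNReal.ofReal_ne_top]
          gcongr
          exact lintegral_Ioc_add_le hu x le_rfl
      _ = _ := by
          rw [ENNReal.ofReal_mul hD0, ENNReal.ofReal_mul (by norm_num), ENNReal.ofReal_ofNat, pow_one]
          ring
  · calc _ ≤ ∫⁻ t in Set.Ioi Real.pi, ‖u (x + t) + u (x - t)‖ₑ *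
          ENNReal.ofReal (1 / t ^ (1 + 1)) * ENNReal.ofReal D := by
          refine setLIntegral_mono' measurableSet_Ioi fun t ht => ?_
          have ht : 0 < t := hp.trans ht
          rw [mul_assoc, ← ENNReal.ofReal_mul (by positivity)]
          gcongr
          refine (hD t).trans ?_
          rw [mul_comm, one_div]
          gcongr
          norm_num
      _ ≤ (4 * stepanovNorm u * ENNReal.ofReal (2 ^ (1 + 1) / Real.pi)) * ENNReal.ofReal D := by
          rw [lintegral_mul_const' _ _ ENNReal.ofReal_ne_top]
          gcongr
          exact lintegral_Ioi_mul_le hp 1 fun T hT => lintegral_Ioc_add_le hu x hT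
      _ = _ := by
          rw [ENNReal.ofReal_mul hD0, ENNReal.ofReal_mul (by norm_num), ENNReal.ofReal_ofNat]
          ring

lemma integrable_mul_kernel {v : ℝ → ℂ} (hv : AEStronglyMeasurable v) {B : ℝ}
    (hB : ∀ t, ‖v t‖ ≤ B) (h l : ℝ) : Integrable (fun t => v t * (kernel h l t : ℂ)) := by
  have := (integrable_kernel h l).ofReal (𝕜 := ℂ)
  exact this.bdd_mul hv (Eventually.of_forall hB)

lemma conv_sub {f g : ℝ → ℂ} (hf : AEStronglyMeasurable f) (hg : AEStronglyMeasurable g) {B B' : ℝ}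
    (hB : ∀ t, ‖f t‖ ≤ B) (hB' : ∀ t, ‖g t‖ ≤ B') (h l x : ℝ) :
    conv h l (fun t => f t - g t) x = conv h l f x - conv h l g x := by
  have hi : ∀ {f : ℝ → ℂ} {B : ℝ}, AEStronglyMeasurable f → (∀ t, ‖f t‖ ≤ B) →
      IntegrableOn (fun t => (f (x + t) + f (x - t)) * (kernel h l t : ℂ)) (Set.Ioi 0) :=
    fun hf hB => (integrable_mul_kernel ((aestronglyMeasurable_add_left hf x).add
      (aestronglyMeasurable_sub_left hf x))
      (fun t => (norm_add_le _ _).trans (add_le_add (hB _) (hB _))) h l).integrableOn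
  rw [conv, conv, conv, ← integral_sub (hi hf hB) (hi hg hB')]
  congr 1; funext t; ring

lemma conv_trigPoly {h : ℝ} (hh : 0 < h) (l : ℝ) (s : Finset ℝ) (b : ℝ → ℂ) (x : ℝ) :
    conv h l (trigPoly s b) x = trigPoly s (fun r => b r * trapezoid h l r) x := by
  have e : ∀ t, (trigPoly s b (x + t) + trigPoly s b (x - t)) * (kernel h l t : ℂ)
      = ∑ r ∈ s, b r * Complex.exp (Complex.I * r * x) *
        ((2 * Real.cos (r * t) * kernel h l t : ℝ) : ℂ) := by
    intro t
    rw [trigPoly, trigPoly, ← Finset.sum_add_distrib, Finset.sum_mul]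
    refine Finset.sum_congr rfl fun r _ => ?_
    have h1 : Complex.exp (Complex.I * r * (x + t : ℝ)) + Complex.exp (Complex.I * r * (x - t : ℝ))
        = Complex.exp (Complex.I * r * x) * (2 * Complex.cos (r * t)) := by
      rw [Complex.two_cos, mul_add, ← Complex.exp_add, ← Complex.exp_add]
      congr 2 <;> (push_cast; ring)
    rw [← mul_add, h1]; push_cast; ring
  simp only [conv, e]
  rw [integral_finsetSum]
  · refine Finset.sum_congr rfl fun r _ => ?_
    rw [integral_const_mul, integral_complex_ofReal, integral_kernel_mul_cos hh]; ring
  · intro r _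
    refine Integrable.const_mul (Integrable.ofReal (𝕜 := ℂ) ?_) _
    refine (integrable_kernel h l).integrableOn.bdd_mul (c := 2) (Measurable.aestronglyMeasurable (by fun_prop))
      (Eventually.of_forall fun t => ?_)
    rw [norm_mul, Real.norm_ofNat]
    have := Real.abs_cos_le_one (r * t)
    rw [Real.norm_eq_abs]; linarith

/-- One polynomial serves twice, for f and, after multiplication of its coefficients by the
trapezoid, for the convolution. This is what ties the Fourier coefficients of the two functions
together. -/
lemma conv_approx {f : ℝ → ℂ} (hf : IsStepanovAP f) {B : ℝ} (hB : ∀ t, ‖f t‖ ≤ B) {h : ℝ} (hh : 0 < h)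
    (l : ℝ) {ε : ℝ} (hε : 0 < ε) : ∃ (s : Finset ℝ) (b : ℝ → ℂ),
      stepanovNorm (fun t => f t - trigPoly s b t) ≤ ENNReal.ofReal ε ∧
      ∀ x, ‖conv h l f x - trigPoly s (fun r => b r * trapezoid h l r) x‖ ≤ ε := by
  obtain ⟨D, hD0, hD⟩ := exists_lintegral_kernel_le h l
  obtain ⟨s, b, hsb⟩ := hf.2 (ENNReal.ofReal (ε / (D + 1))) (by rw [ENNReal.ofReal_pos]; positivity)
  refine ⟨s, b, hsb.le.trans (ENNReal.ofReal_le_ofReal (div_le_self hε.le (by linarith))), fun x => ?_⟩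
  rw [← conv_trigPoly hh, ← conv_sub hf.1 (continuous_trigPoly s b).aestronglyMeasurable hB
    (norm_trigPoly_le s b)]
  rw [← ENNReal.ofReal_le_ofReal_iff hε.le, ofReal_norm]
  calc _ ≤ ENNReal.ofReal D * stepanovNorm (fun t => f t - trigPoly s b t) :=
        (enorm_integral_le_lintegral_enorm _).trans (hD _ x
          (hf.1.sub (continuous_trigPoly s b).aestronglyMeasurable))
    _ ≤ ENNReal.ofReal D * ENNReal.ofReal (ε / (D + 1)) := by gcongr
    _ = ENNReal.ofReal (D * (ε / (D + 1))) := by rw [ENNReal.ofReal_mul hD0]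
    _ ≤ _ := by
        apply ENNReal.ofReal_le_ofReal
        rw [← mul_div_assoc, div_le_iff₀ (by linarith)]
        nlinarith

lemma conv_isUniformAP {f : ℝ → ℂ} (hf : IsStepanovAP f) {B : ℝ} (hB : ∀ t, ‖f t‖ ≤ B) {h : ℝ}
    (hh : 0 < h) (l : ℝ) : IsUniformAP (conv h l f) := fun ε hε => by
  obtain ⟨s, b, -, H⟩ := conv_approx hf hB hh l hε
  exact ⟨s, _, H⟩

lemma fourierCoef_conv {f : ℝ → ℂ} (hf : IsStepanovAP f) (hl : LocallyIntegrable f) {B : ℝ}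
    (hB : ∀ t, ‖f t‖ ≤ B) {h : ℝ} (hh : 0 < h) (l r : ℝ) :
    fourierCoef (conv h l f) r = fourierCoef f r * trapezoid h l r := by
  have hF := conv_isUniformAP hf hB hh l
  rw [← sub_eq_zero, ← norm_le_zero_iff]
  refine le_of_forall_pos_le_add fun ε hε => ?_
  obtain ⟨s, b, h1, h2⟩ := conv_approx hf hB hh l (ε := ε / 4) (by linarith)
  have toReal : ∀ {z : ℂ} {N : ℝ≥0∞}, ‖z‖ₑ ≤ 2 * N → N ≤ ENNReal.ofReal (ε / 4) → ‖z‖ ≤ ε / 2 := by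
    intro z N hz hN
    rw [← ENNReal.ofReal_le_ofReal_iff (by linarith), ofReal_norm]
    refine hz.trans ((mul_le_mul_right hN 2).trans (le_of_eq ?_))
    rw [← ENNReal.ofReal_ofNat, ← ENNReal.ofReal_mul (by norm_num)]
    congr 1; ring
  have h3 := toReal (fourierCoef_sub_trigPoly_le hf hl s b r) h1
  have h4 := toReal (fourierCoef_sub_trigPoly_le hF.isStepanovAP hF.continuous.locallyIntegrable s
    (fun r => b r * trapezoid h l r) r) (stepanovNorm_le_of_norm_le h2)
  have e : fourierCoef (conv h l f) r - fourierCoef f r * trapezoid h l r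
      = (fourierCoef (conv h l f) r - if r ∈ s then b r * trapezoid h l r else 0)
        - (fourierCoef f r - if r ∈ s then b r else 0) * trapezoid h l r := by
    split_ifs <;> ring
  rw [e, zero_add]
  refine (norm_sub_le _ _).trans ?_
  rw [norm_mul, Complex.norm_real, Real.norm_eq_abs]
  have := abs_trapezoid_le hh l r
  nlinarith [norm_nonneg (fourierCoef f r - if r ∈ s then b r else 0)]

/-! ### Separated exponents and partial sums -/

/-- The sign of r and the integer part of |r|/α determine r: distinct positive |r| differ by at
least α and so have different integer parts, and the sign isolates r = 0. -/
lemma MemOmega.finite_exponents {α : ℝ} (hα : 0 < α) {f : ℝ → ℂ} (hf : MemOmega α f) (γ : ℝ) :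
    {r | r ∈ exponents f ∧ |r| ≤ γ}.Finite := by
  refine Set.Finite.of_injOn (f := fun r : ℝ => (SignType.sign r, ⌊|r| / α⌋₊))
    (t := Set.univ ×ˢ Set.Iic ⌊γ / α⌋₊) ?_ ?_ (Set.finite_univ.prod (Set.finite_Iic _))
  · rintro r ⟨-, hr⟩
    exact ⟨trivial, Nat.floor_le_floor (by gcongr)⟩
  · rintro r ⟨hr, -⟩ s ⟨hs, -⟩ hrs
    simp only [Prod.mk.injEq] at hrs
    obtain ⟨h1, h2⟩ := hrs
    have key : ∀ r ∈ exponents f, ∀ s ∈ exponents f, 0 < |r| → |r| < |s| →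
        ⌊|r| / α⌋₊ ≠ ⌊|s| / α⌋₊ := by
      intro r hr s hs h0 hlt heq
      have h3 := hf.gap r hr s hs h0 hlt
      have h4 : |r| / α + 1 ≤ |s| / α := by
        rw [div_add_one hα.ne']
        gcongr; linarith
      have h5 := Nat.floor_le_floor h4
      rw [Nat.floor_add_one (by positivity), heq] at h5
      omega
    rcases eq_or_ne r 0 with rfl | hr0
    · rw [sign_zero, eq_comm, sign_eq_zero_iff] at h1; exact h1.symm
    have hs0 : s ≠ 0 := by
      rintro rfl
      rw [sign_zero, sign_eq_zero_iff] at h1; exact hr0 h1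
    have habs : |r| = |s| := by
      rcases lt_trichotomy |r| |s| with h | h | h
      · exact absurd h2 (key r hr s hs (abs_pos.mpr hr0) h)
      · exact h
      · exact absurd h2.symm (key s hs r hr (abs_pos.mpr hs0) h)
    rw [← sign_mul_abs r, ← sign_mul_abs s, h1, habs]

/-- The contribution of the exponents in a short window is controlled by best approximation. -/
lemma MemOmega.enorm_trigPoly_le {α : ℝ} (hα : 0 < α) {f : ℝ → ℂ} (hf : MemOmega α f) {l : ℝ}
    (hl : 0 ≤ l) {T : Finset ℝ} (hT : ∀ r ∈ T, r ∈ exponents f ∧ l < |r| ∧ |r| ≤ l + α / 2)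
    {b : ℝ → ℂ} (hb : ∀ r, ‖b r‖ ≤ ‖fourierCoef f r‖) (x : ℝ) :
    ‖trigPoly T b x‖ₑ ≤ 4 * bestApprox l f := by
  -- The window has length α/2 < α, so all its exponents share one absolute value. Two exponents at
  -- 2E_l each give the factor 4.
  have hcard : T.card ≤ 2 := by
    rcases T.eq_empty_or_nonempty with rfl | ⟨r, hr⟩
    · simp
    · have : T ⊆ {r, -r} := by
        intro s hs
        obtain ⟨hr1, hr2, hr3⟩ := hT r hr
        obtain ⟨hs1, hs2, hs3⟩ := hT s hs
        have : |s| = |r| := by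
          rcases lt_trichotomy |r| |s| with h1 | h1 | h1
          · have := hf.gap r hr1 s hs1 (by linarith) h1
            linarith
          · exact h1.symm
          · have := hf.gap s hs1 r hr1 (by linarith) h1
            linarith
        rw [abs_eq_abs] at this
        simpa using this
      exact (Finset.card_le_card this).trans Finset.card_le_two
  rw [trigPoly]
  refine (enorm_sum_le _ _).trans ?_
  calc _ ≤ ∑ r ∈ T, 2 * bestApprox l f := by
        refine Finset.sum_le_sum fun r hr => ?_
        refine le_trans ?_ (enorm_fourierCoef_le hf.almostPeriodic hf.locallyIntegrable (hT r hr).2.1)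
        rw [← ofReal_norm, ← ofReal_norm]
        apply ENNReal.ofReal_le_ofReal
        rw [norm_mul, norm_exp_I, mul_one]
        exact hb r
    _ ≤ 4 * bestApprox l f := by
        rw [Finset.sum_const, nsmul_eq_mul, ← mul_assoc]
        gcongr
        have : (T.card : ℝ≥0∞) ≤ 2 := by exact_mod_cast hcard
        calc _ ≤ (2 : ℝ≥0∞) * 2 := by gcongr
          _ = 4 := by norm_num

lemma MemOmega.partialSum_eq {α : ℝ} (hα : 0 < α) {f : ℝ → ℂ} (hf : MemOmega α f) {γ γ' : ℝ}
    (hγ : γ ≤ γ') (x : ℝ) : partialSum f γ x =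
      trigPoly ((hf.finite_exponents hα γ').toFinset.filter fun r => |r| ≤ γ) (fourierCoef f) x := by
  rw [partialSum, trigPoly, ← finsum_mem_coe_finset]
  refine finsum_mem_congr ?_ fun _ _ => rfl
  ext r
  simp only [Finset.coe_filter, Set.Finite.mem_toFinset, Set.mem_ofPred_eq]
  exact ⟨fun ⟨h1, h2⟩ => ⟨⟨h1, h2.trans hγ⟩, h2⟩, fun ⟨⟨h1, _⟩, h2⟩ => ⟨h1, h2⟩⟩

/-- Needed at l = 0 to reach index k = 0, since the block estimates start at frequency α/2. -/
lemma MemOmega.enorm_partialSum_sub_partialSum_le {α : ℝ} (hα : 0 < α) {f : ℝ → ℂ}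
    (hf : MemOmega α f) {l : ℝ} (hl : 0 ≤ l) (x : ℝ) :
    ‖partialSum f l x - partialSum f (l + α / 2) x‖ₑ ≤ 4 * bestApprox l f := by
  have h1 := hf.partialSum_eq hα (by linarith : l ≤ l + α / 2) x
  have h2 := hf.partialSum_eq hα (le_refl (l + α / 2)) x
  set S := (hf.finite_exponents hα (l + α / 2)).toFinset with hS
  have h3 : ∀ r ∈ S, r ∈ exponents f ∧ |r| ≤ l + α / 2 := fun r hr => by simpa [hS] using hr
  rw [Finset.filter_true_of_mem fun r hr => (h3 r hr).2] at h2
  have e : partialSum f l x - partialSum f (l + α / 2) x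
      = -trigPoly (S.filter fun r => ¬ |r| ≤ l) (fourierCoef f) x := by
    rw [h1, h2, trigPoly, trigPoly, trigPoly,
      ← Finset.sum_filter_add_sum_filter_not S (fun r => |r| ≤ l)]
    ring
  rw [e, enorm_neg]
  refine hf.enorm_trigPoly_le hα hl (fun r hr => ?_) (fun r => le_rfl) x
  rw [Finset.mem_filter, not_le] at hr
  exact ⟨(h3 r hr.1).1, hr.2, (h3 r hr.1).2⟩

/-- The deviation of a partial sum is controlled by an integral of `φ_x` against the kernel. -/
lemma MemOmega.enorm_partialSum_sub_le {α : ℝ} (hα : 0 < α) {f : ℝ → ℂ} (hf : MemOmega α f) {l : ℝ}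
    (hl : 0 ≤ l) (x : ℝ) : ‖partialSum f l x - f x‖ₑ ≤
      ‖∫ t in Set.Ioi (0 : ℝ), phi f x t * (kernel (α / 2) l t : ℂ)‖ₑ + 4 * bestApprox l f := by
  have hfl := hf.locallyIntegrable
  obtain ⟨B, hB⟩ := hf.bounded
  have hh : 0 < α / 2 := by linarith
  set h := α / 2 with hdef
  set S : Finset ℝ := (hf.finite_exponents hα (l + h)).toFinset with hS
  have hmemS : ∀ r, r ∈ S ↔ r ∈ exponents f ∧ |r| ≤ l + h := fun r => by simp [hS]
  have hF := conv_isUniformAP hf.almostPeriodic hB hh l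
  have hconv : conv h l f x = trigPoly S (fun r => fourierCoef f r * trapezoid h l r) x := by
    -- Beyond l + h the trapezoid vanishes and below there are finitely many exponents, so the
    -- convolution has the spectrum of a polynomial.
    refine hF.eq_trigPoly S _ (fun r => ?_) x
    rw [fourierCoef_conv hf.almostPeriodic hfl hB hh]
    split_ifs with hr
    · rfl
    · rw [hmemS, not_and_or] at hr
      rcases hr with hr | hr
      · rw [exponents, Set.mem_ofPred_eq, not_not] at hr
        rw [hr, zero_mul]
      · rw [trapezoid_eq_zero hh hl (not_le.mp hr).le]; simp
  have hpart : partialSum f l x = trigPoly (S.filter fun r => |r| ≤ l) (fourierCoef f) x :=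
    hf.partialSum_eq hα (by linarith) x
  have hsplit : conv h l f x = partialSum f l x +
      trigPoly (S.filter fun r => ¬ |r| ≤ l) (fun r => fourierCoef f r * trapezoid h l r) x := by
    rw [hconv, hpart, trigPoly, trigPoly, trigPoly, ← Finset.sum_filter_add_sum_filter_not S (fun r => |r| ≤ l)]
    congr 1
    refine Finset.sum_congr rfl fun r hr => ?_
    rw [trapezoid_eq_one hh (Finset.mem_filter.mp hr).2]; simp
  have hrest : ‖trigPoly (S.filter fun r => ¬ |r| ≤ l)
      (fun r => fourierCoef f r * trapezoid h l r) x‖ₑ ≤ 4 * bestApprox l f := by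
    refine hf.enorm_trigPoly_le hα hl (fun r hr => ?_) (fun r => ?_) x
    · rw [Finset.mem_filter, hmemS, not_le] at hr
      exact ⟨hr.1.1, hr.2, hr.1.2⟩
    · rw [norm_mul, Complex.norm_real, Real.norm_eq_abs]
      exact mul_le_of_le_one_right (norm_nonneg _) (abs_trapezoid_le hh l r)
  have hphi : ∫ t in Set.Ioi (0 : ℝ), phi f x t * (kernel h l t : ℂ) = conv h l f x - f x := by
    have e : ∀ t, phi f x t * (kernel h l t : ℂ)
        = (f (x + t) + f (x - t)) * (kernel h l t : ℂ) - f x * ((2 * kernel h l t : ℝ) : ℂ) := by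
      intro t; rw [phi]; push_cast; ring
    simp only [e]
    rw [integral_sub, integral_const_mul, integral_complex_ofReal, integral_two_mul_kernel hh hl]
    · simp [conv]
    · exact (integrable_mul_kernel ((aestronglyMeasurable_add_left hf.almostPeriodic.1 x).add
        (aestronglyMeasurable_sub_left hf.almostPeriodic.1 x))
        (fun t => (norm_add_le _ _).trans (add_le_add (hB _) (hB _))) h l).integrableOn
    · exact (((integrable_kernel h l).const_mul 2).ofReal (𝕜 := ℂ)).integrableOn.const_mul _
  have e : partialSum f l x - f x = (∫ t in Set.Ioi (0 : ℝ), phi f x t * (kernel h l t : ℂ))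
      - trigPoly (S.filter fun r => ¬ |r| ≤ l) (fun r => fourierCoef f r * trapezoid h l r) x := by
    rw [hphi, hsplit]; ring
  rw [e]
  exact enorm_sub_le.trans (add_le_add le_rfl hrest)

/-! ### A large sieve inequality -/

/-- Telescoping with 1/(1+n)² ≤ 1/n - 1/(n+1). This fails at n = 0, where 1/0 = 0, hence the
separate case. -/
lemma sum_one_div_succ_sq_le (n : ℕ) : ∑ i ∈ Finset.range n, 1 / (1 + (i : ℝ)) ^ 2 ≤ 2 - 1 / (n : ℝ) := by
  induction n with
  | zero => simp
  | succ n ih =>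
    rw [Finset.sum_range_succ]
    rcases Nat.eq_zero_or_pos n with rfl | hn
    · norm_num
    · have hn' : (0 : ℝ) < n := by exact_mod_cast hn
      have : 1 / (1 + (n : ℝ)) ^ 2 ≤ 1 / n - 1 / ((n + 1 : ℕ) : ℝ) := by
        push_cast
        rw [div_sub_div _ _ hn'.ne' (by positivity), div_le_div_iff₀ (by positivity) (by positivity)]
        nlinarith
      linarith

lemma sum_one_div_dist_sq_le {N j : ℕ} (hj : j < N) :
    ∑ l ∈ Finset.range N, 1 / (1 + |(j : ℝ) - l|) ^ 2 ≤ 4 := by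
  obtain ⟨n, rfl⟩ := Nat.exists_eq_add_of_lt hj
  rw [show j + n + 1 = (j + 1) + n by ring, Finset.sum_range_add]
  have h1 : ∑ l ∈ Finset.range (j + 1), 1 / (1 + |(j : ℝ) - l|) ^ 2
      = ∑ i ∈ Finset.range (j + 1), 1 / (1 + (i : ℝ)) ^ 2 := by
    rw [← Finset.sum_range_reflect]
    refine Finset.sum_congr rfl fun l hl => ?_
    have hl : l ≤ j := Nat.lt_succ_iff.mp (Finset.mem_range.mp hl)
    have : ((j + 1 - 1 - l : ℕ) : ℝ) = j - l := by
      rw [Nat.add_sub_cancel, Nat.cast_sub hl]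
    rw [this]
    simp
  have h2 : ∑ l ∈ Finset.range n, 1 / (1 + |(j : ℝ) - ((j + 1 + l : ℕ) : ℝ)|) ^ 2
      ≤ ∑ i ∈ Finset.range n, 1 / (1 + (i : ℝ)) ^ 2 := by
    refine Finset.sum_le_sum fun l _ => ?_
    have : |(j : ℝ) - ((j + 1 + l : ℕ) : ℝ)| = 1 + l := by
      push_cast
      rw [show (j : ℝ) - (j + 1 + l) = -(1 + l) by ring, abs_neg, abs_of_nonneg (by positivity)]
    rw [this]
    gcongr
    linarith
  rw [h1]
  have h3 := sum_one_div_succ_sq_le (j + 1)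
  have h4 := sum_one_div_succ_sq_le n
  have h5 : (0 : ℝ) ≤ 1 / ((j + 1 : ℕ) : ℝ) := by positivity
  have h6 : (0 : ℝ) ≤ 1 / (n : ℝ) := by positivity
  linarith

/-- Schur's test for the kernel `(1 + |j - l|)⁻²`. -/
lemma sum_sum_mul_div_dist_sq_le (N : ℕ) (J : ℕ → ℝ) :
    ∑ j ∈ Finset.range N, ∑ l ∈ Finset.range N, J j * J l * (1 / (1 + |(j : ℝ) - l|) ^ 2)
      ≤ 4 * ∑ j ∈ Finset.range N, J j ^ 2 := by
  have h1 : ∀ (F : ℕ → ℕ → ℝ), (∀ j l, F j l = J j ^ 2 * (1 / (1 + |(j : ℝ) - l|) ^ 2)) →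
      ∑ j ∈ Finset.range N, ∑ l ∈ Finset.range N, F j l ≤ 4 * ∑ j ∈ Finset.range N, J j ^ 2 := by
    intro F hF
    rw [Finset.mul_sum]
    refine Finset.sum_le_sum fun j hj => ?_
    simp only [hF]
    rw [← Finset.mul_sum, mul_comm 4]
    exact mul_le_mul_of_nonneg_left (sum_one_div_dist_sq_le (Finset.mem_range.mp hj)) (sq_nonneg _)
  have h2 := h1 _ fun j l => rfl
  have h3 : ∑ j ∈ Finset.range N, ∑ l ∈ Finset.range N, J l ^ 2 * (1 / (1 + |(j : ℝ) - l|) ^ 2)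
      ≤ 4 * ∑ j ∈ Finset.range N, J j ^ 2 := by
    rw [Finset.sum_comm]
    refine h1 _ fun j l => ?_
    rw [abs_sub_comm]
  have h4 : ∑ j ∈ Finset.range N, ∑ l ∈ Finset.range N, J j * J l * (1 / (1 + |(j : ℝ) - l|) ^ 2)
      ≤ ∑ j ∈ Finset.range N, ∑ l ∈ Finset.range N,
        (1 / 2) * (J j ^ 2 * (1 / (1 + |(j : ℝ) - l|) ^ 2) +
          J l ^ 2 * (1 / (1 + |(j : ℝ) - l|) ^ 2)) := by
    refine Finset.sum_le_sum fun j _ => Finset.sum_le_sum fun l _ => ?_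
    rw [← add_mul, ← mul_assoc]
    refine mul_le_mul_of_nonneg_right ?_ (by positivity)
    nlinarith [sq_nonneg (J j - J l)]
  simp only [← Finset.mul_sum, Finset.sum_add_distrib] at h4
  simp only [← Finset.mul_sum] at h2 h3
  linarith

/-- A geometric sum of 2m unimodular terms is at most 2m and at most 2/|z - 1|. The first bound
serves cells at distance d ≤ 1. For d ≥ 2 the second gives |S|(d - 1) ≤ 2m, hence |S|(d + 1) ≤ 6m,
and 36 = 6². -/
lemma norm_sum_exp_sq_le {m : ℕ} (hm : 0 < m) {h δ : ℝ} (hδ : 0 < δ)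
    (hh : |h| * δ = Real.pi / (2 * m)) {j l : ℕ} (hj : j ≤ m) (hl : l ≤ m) {t s : ℝ}
    (ht : t ∈ Set.Ioc (j * δ) ((j + 1) * δ)) (hs : s ∈ Set.Ioc (l * δ) ((l + 1) * δ)) :
    ‖∑ a ∈ Finset.range (2 * m), Complex.exp (Complex.I * (h * (t - s) : ℝ)) ^ a‖ ^ 2
      ≤ 36 * m ^ 2 * (1 / (1 + |(j : ℝ) - l|) ^ 2) := by
  have hm' : (0 : ℝ) < m := by exact_mod_cast hm
  have hp := Real.pi_pos
  set z := Complex.exp (Complex.I * (h * (t - s) : ℝ)) with hz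
  have hz1 : ‖z‖ = 1 := by rw [hz, Complex.norm_exp]; simp
  set S := ∑ a ∈ Finset.range (2 * m), z ^ a with hS
  have hS1 : ‖S‖ ≤ 2 * m := by
    refine (norm_sum_le _ _).trans (le_of_eq ?_)
    simp [norm_pow, hz1]
  set d := |(j : ℝ) - l| with hd
  have hd0 : 0 ≤ d := abs_nonneg _
  have hmain : ‖S‖ ≤ 6 * m / (1 + d) := by
    rw [le_div_iff₀ (by positivity)]
    rcases le_or_gt d 1 with h1 | h1
    · nlinarith
    · have hd2 : 2 ≤ d := by
        have h1' : (1 : ℤ) < |(j : ℤ) - l| := by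
          rw [hd] at h1
          exact_mod_cast h1
        have : (2 : ℤ) ≤ |(j : ℤ) - l| := h1'
        rw [hd]; exact_mod_cast this
      have hts : (d - 1) * δ ≤ |t - s| := by
        rcases abs_cases ((j : ℝ) - l) with ⟨h2, h3⟩ | ⟨h2, h3⟩
        · rw [hd, h2]; exact le_trans (by nlinarith [ht.1, hs.2]) (le_abs_self _)
        · rw [hd, h2]; exact le_trans (by nlinarith [hs.1, ht.2]) (neg_le_abs _)
      have hts2 : |t - s| ≤ (m + 1) * δ := by
        have hj' : (j : ℝ) ≤ m := by exact_mod_cast hj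
        have hl' : (l : ℝ) ≤ m := by exact_mod_cast hl
        have : 0 ≤ (j : ℝ) * δ := by positivity
        have : 0 ≤ (l : ℝ) * δ := by positivity
        rw [abs_le]; constructor <;> nlinarith [ht.1, ht.2, hs.1, hs.2]
      have hθ : (d - 1) * (Real.pi / (2 * m)) ≤ |h * (t - s)| := by
        rw [abs_mul, ← hh]
        calc _ = |h| * ((d - 1) * δ) := by ring
          _ ≤ _ := by gcongr
      -- The choice |h|δ = π/(2m) keeps the phase within π, so Jordan's inequality applies to its
      -- half and z does not return to 1.
      have hθ2 : |h * (t - s)| ≤ Real.pi := by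
        have h1m : (1 : ℝ) ≤ m := by exact_mod_cast hm
        calc |h * (t - s)| ≤ |h| * ((m + 1) * δ) := by rw [abs_mul]; gcongr
          _ = (m + 1) * (Real.pi / (2 * m)) := by rw [← hh]; ring
          _ ≤ Real.pi := by
            rw [← mul_div_assoc, div_le_iff₀ (by positivity)]
            nlinarith
      have hgeo : S * (z - 1) = z ^ (2 * m) - 1 := geom_sum_mul z _
      have h2 : ‖S‖ * ‖z - 1‖ ≤ 2 := by
        rw [← norm_mul, hgeo]
        refine (norm_sub_le _ _).trans ?_
        rw [norm_pow, hz1]; norm_num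
      have h3 : 2 / Real.pi * |h * (t - s)| ≤ ‖z - 1‖ := by
        rw [hz, Complex.norm_exp_I_mul_ofReal_sub_one, norm_mul, Real.norm_ofNat, Real.norm_eq_abs]
        have := Real.mul_abs_le_abs_sin (x := h * (t - s) / 2)
          (by rw [abs_div, abs_two]; linarith)
        rw [abs_div, abs_two] at this
        linarith
      have h4 : (d - 1) / m ≤ ‖z - 1‖ := by
        refine le_trans ?_ h3
        calc (d - 1) / m = 2 / Real.pi * ((d - 1) * (Real.pi / (2 * m))) := by field_simp
          _ ≤ _ := by gcongr
      have h5 : ‖S‖ * (d - 1) ≤ 2 * m := by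
        have h6 : ‖S‖ * ((d - 1) / m) ≤ 2 := (mul_le_mul_of_nonneg_left h4 (norm_nonneg _)).trans h2
        rwa [← mul_div_assoc, div_le_iff₀ hm'] at h6
      nlinarith [norm_nonneg S]
  calc ‖S‖ ^ 2 ≤ (6 * m / (1 + d)) ^ 2 := by gcongr
    _ = _ := by rw [div_pow]; ring

/-- A bilinear estimate for exponential integrals over two sets. -/
lemma norm_sum_integral_mul_conj_le {ι : Type*} (A : Finset ι) (κ : ι → ℝ) {E F : Set ℝ}
    (hE : MeasurableSet E) (hF : MeasurableSet F) {g : ℝ → ℂ} (hgE : IntegrableOn g E)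
    (hgF : IntegrableOn g F) {B : ℝ}
    (hB : ∀ t ∈ E, ∀ s ∈ F, ‖∑ i ∈ A, Complex.exp (Complex.I * κ i * (t - s : ℝ))‖ ≤ B) :
    ‖∑ i ∈ A, (∫ t in E, g t * Complex.exp (Complex.I * κ i * t)) *
      (starRingEnd ℂ) (∫ t in F, g t * Complex.exp (Complex.I * κ i * t))‖
      ≤ (∫ t in E, ‖g t‖) * (∫ t in F, ‖g t‖) * B := by
  have hint : ∀ {G : Set ℝ}, IntegrableOn g G → ∀ k : ℝ,
      IntegrableOn (fun t => g t * Complex.exp (Complex.I * k * t)) G := by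
    intro G hG k
    refine Integrable.mul_bdd (c := 1) hG
      (Continuous.aestronglyMeasurable (by fun_prop)) (Eventually.of_forall fun t => ?_)
    rw [norm_exp_I]
  have hinner : ∀ t ∈ E, ‖∑ i ∈ A, Complex.exp (Complex.I * κ i * t) *
      (starRingEnd ℂ) (∫ s in F, g s * Complex.exp (Complex.I * κ i * s))‖
        ≤ (∫ s in F, ‖g s‖) * B := by
    intro t ht
    have e : ∑ i ∈ A, Complex.exp (Complex.I * κ i * t) *
        (starRingEnd ℂ) (∫ s in F, g s * Complex.exp (Complex.I * κ i * s))
        = ∫ s in F, (starRingEnd ℂ) (g s) *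
          ∑ i ∈ A, Complex.exp (Complex.I * κ i * (t - s : ℝ)) := by
      have hc : ∀ i, IntegrableOn (fun s => Complex.exp (Complex.I * κ i * t) *
          (starRingEnd ℂ) (g s * Complex.exp (Complex.I * κ i * s))) F := fun i =>
        (Complex.conjLIE.integrable_comp_iff.mpr (hint hgF (κ i))).const_mul _
      simp only [← integral_conj, ← integral_const_mul]
      rw [← integral_finsetSum _ fun i _ => hc i]
      congr 1; funext s
      rw [Finset.mul_sum]
      refine Finset.sum_congr rfl fun i _ => ?_
      rw [map_mul, ← Complex.exp_conj, map_mul, map_mul, Complex.conj_I, Complex.conj_ofReal,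
        Complex.conj_ofReal, mul_left_comm, ← Complex.exp_add]
      congr 2; push_cast; ring
    rw [e, ← integral_mul_const]
    refine norm_integral_le_of_norm_le (hgF.norm.mul_const B) ?_
    filter_upwards [ae_restrict_mem hF] with s hs
    rw [norm_mul, RCLike.norm_conj]
    exact mul_le_mul_of_nonneg_left (hB t ht s hs) (norm_nonneg _)
  have e : ∑ i ∈ A, (∫ t in E, g t * Complex.exp (Complex.I * κ i * t)) *
      (starRingEnd ℂ) (∫ t in F, g t * Complex.exp (Complex.I * κ i * t))
      = ∫ t in E, g t * ∑ i ∈ A, Complex.exp (Complex.I * κ i * t) *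
      (starRingEnd ℂ) (∫ s in F, g s * Complex.exp (Complex.I * κ i * s)) := by
    simp only [← integral_mul_const]
    rw [← integral_finsetSum _ fun i _ => (hint hgE (κ i)).mul_const _]
    congr 1; funext t
    rw [Finset.mul_sum]
    exact Finset.sum_congr rfl fun i _ => mul_assoc _ _ _
  rw [e, mul_assoc, ← integral_mul_const]
  refine norm_integral_le_of_norm_le (hgE.norm.mul_const _) ?_
  filter_upwards [ae_restrict_mem hE] with t ht
  rw [norm_mul]
  exact mul_le_mul_of_nonneg_left (hinner t ht) (norm_nonneg _)

/-- Each i < m is the difference of at least m pairs, (i + b, b) with b < m. The larger sum over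
pairs is preferable because its exponential kernel is the square |∑ zᵃ|², of Fejér type, which
decays quadratically and suits Schur's test. -/
lemma mul_sum_le_sum_sum_sub (m : ℕ) {P : ℤ → ℝ} (hP : ∀ d, 0 ≤ P d) :
    m * ∑ i ∈ Finset.range m, P i ≤
      ∑ a ∈ Finset.range (2 * m), ∑ b ∈ Finset.range (2 * m), P ((a : ℤ) - b) := by
  rw [Finset.sum_comm]
  calc m * ∑ i ∈ Finset.range m, P i = ∑ b ∈ Finset.range m, ∑ i ∈ Finset.range m, P i := by
        rw [Finset.sum_const, Finset.card_range, nsmul_eq_mul]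
    _ ≤ ∑ b ∈ Finset.range m, ∑ a ∈ Finset.range (2 * m), P ((a : ℤ) - b) := by
        refine Finset.sum_le_sum fun b hb => ?_
        have hb := Finset.mem_range.mp hb
        have : ∑ i ∈ Finset.range m, P i
            = ∑ a ∈ (Finset.range m).map (addRightEmbedding b), P ((a : ℤ) - b) := by
          rw [Finset.sum_map]
          refine Finset.sum_congr rfl fun i _ => ?_
          simp
        rw [this]
        refine Finset.sum_le_sum_of_subset_of_nonneg ?_ fun _ _ _ => hP _
        intro a ha
        obtain ⟨i, hi, rfl⟩ := Finset.mem_map.mp ha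
        have hi := Finset.mem_range.mp hi
        simp only [addRightEmbedding_apply, Finset.mem_range]
        omega
    _ ≤ _ := Finset.sum_le_sum_of_subset_of_nonneg
        (Finset.range_subset_range.mpr (by omega)) fun _ _ _ => Finset.sum_nonneg fun _ _ => hP _

/-- A large sieve inequality in mixed `ℓ²(L¹)` norm. -/
lemma large_sieve {m : ℕ} (hm : 0 < m) {h δ : ℝ} (hδ : 0 < δ)
    (hh : |h| * δ = Real.pi / (2 * m)) {E : ℕ → Set ℝ} (hE : ∀ j, MeasurableSet (E j))
    (hEs : ∀ j : ℕ, E j ⊆ Set.Ioc (j * δ) ((j + 1) * δ)) {g : ℝ → ℂ}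
    (hg : ∀ j, IntegrableOn g (E j)) :
    ∑ i ∈ Finset.range m, ‖∑ j ∈ Finset.range (m + 1),
      ∫ t in E j, g t * Complex.exp (Complex.I * (h * i : ℝ) * t)‖ ^ 2
      ≤ 144 * m * ∑ j ∈ Finset.range (m + 1), (∫ t in E j, ‖g t‖) ^ 2 := by
  have hm' : (0 : ℝ) < m := by exact_mod_cast hm
  set p : ℕ → ℤ → ℂ := fun j d => ∫ t in E j, g t * Complex.exp (Complex.I * (h * d : ℝ) * t) with hp
  set P : ℤ → ℂ := fun d => ∑ j ∈ Finset.range (m + 1), p j d with hPdef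
  have h1 := mul_sum_le_sum_sum_sub m (P := fun d => ‖P d‖ ^ 2) fun d => by positivity
  set R := Finset.range (2 * m) ×ˢ Finset.range (2 * m) with hR
  have h2 : ((∑ a ∈ Finset.range (2 * m), ∑ b ∈ Finset.range (2 * m), ‖P ((a : ℤ) - b)‖ ^ 2 : ℝ) : ℂ)
      = ∑ j ∈ Finset.range (m + 1), ∑ l ∈ Finset.range (m + 1),
        ∑ q ∈ R, p j ((q.1 : ℤ) - q.2) * (starRingEnd ℂ) (p l ((q.1 : ℤ) - q.2)) := by
    rw [← Finset.sum_product' (f := fun a b : ℕ => ‖P ((a : ℤ) - b)‖ ^ 2)]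
    push_cast
    simp only [← Complex.mul_conj', hPdef, map_sum, Finset.sum_mul_sum]
    rw [Finset.sum_comm]
    exact Finset.sum_congr rfl fun j _ => Finset.sum_comm
  have h3 : ∀ j ∈ Finset.range (m + 1), ∀ l ∈ Finset.range (m + 1),
      ‖∑ q ∈ R, p j ((q.1 : ℤ) - q.2) * (starRingEnd ℂ) (p l ((q.1 : ℤ) - q.2))‖
      ≤ 36 * m ^ 2 * ((∫ t in E j, ‖g t‖) * (∫ t in E l, ‖g t‖) * (1 / (1 + |(j : ℝ) - l|) ^ 2)) := by
    intro j hj l hl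
    refine (norm_sum_integral_mul_conj_le R (fun q => h * ((q.1 : ℤ) - q.2 : ℤ)) (hE j) (hE l)
      (hg j) (hg l) (B := 36 * m ^ 2 * (1 / (1 + |(j : ℝ) - l|) ^ 2)) ?_).trans (le_of_eq (by ring))
    intro t ht s hs
    refine le_trans (le_of_eq ?_) (norm_sum_exp_sq_le hm hδ hh
      (Nat.lt_succ_iff.mp (Finset.mem_range.mp hj)) (Nat.lt_succ_iff.mp (Finset.mem_range.mp hl))
      (hEs j ht) (hEs l hs))
    set z := Complex.exp (Complex.I * (h * (t - s) : ℝ)) with hz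
    -- The sum over differences a - b factors into a geometric sum times its conjugate.
    have e : ∑ q ∈ R, Complex.exp (Complex.I * (h * ((q.1 : ℤ) - q.2 : ℤ) : ℝ) * (t - s : ℝ))
        = (∑ a ∈ Finset.range (2 * m), z ^ a) * (starRingEnd ℂ) (∑ a ∈ Finset.range (2 * m), z ^ a) := by
      rw [map_sum, Finset.sum_mul_sum, hR, Finset.sum_product]
      refine Finset.sum_congr rfl fun a _ => Finset.sum_congr rfl fun b _ => ?_
      rw [map_pow, hz, ← Complex.exp_conj, map_mul, Complex.conj_I, Complex.conj_ofReal,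
        ← Complex.exp_nat_mul, ← Complex.exp_nat_mul, ← Complex.exp_add]
      congr 1; push_cast; ring
    rw [e, norm_mul, RCLike.norm_conj, sq]
  have h4 : ∑ a ∈ Finset.range (2 * m), ∑ b ∈ Finset.range (2 * m), ‖P ((a : ℤ) - b)‖ ^ 2
      ≤ 36 * m ^ 2 * (4 * ∑ j ∈ Finset.range (m + 1), (∫ t in E j, ‖g t‖) ^ 2) := by
    have h0 : 0 ≤ ∑ a ∈ Finset.range (2 * m), ∑ b ∈ Finset.range (2 * m), ‖P ((a : ℤ) - b)‖ ^ 2 := by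
      positivity
    rw [← Real.norm_of_nonneg h0, ← Complex.norm_real, h2]
    refine (norm_sum_le _ _).trans ?_
    calc _ ≤ ∑ j ∈ Finset.range (m + 1), ∑ l ∈ Finset.range (m + 1), 36 * (m : ℝ) ^ 2 *
          ((∫ t in E j, ‖g t‖) * (∫ t in E l, ‖g t‖) * (1 / (1 + |(j : ℝ) - l|) ^ 2)) :=
          Finset.sum_le_sum fun j hj => (norm_sum_le _ _).trans
            (Finset.sum_le_sum fun l hl => h3 j hj l hl)
      _ ≤ _ := by
          simp only [← Finset.mul_sum]
          gcongr
          exact sum_sum_mul_div_dist_sq_le (m + 1) fun j => ∫ t in E j, ‖g t‖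
  have h5 : (m : ℝ) * ∑ i ∈ Finset.range m, ‖P i‖ ^ 2 ≤
      m * (144 * m * ∑ j ∈ Finset.range (m + 1), (∫ t in E j, ‖g t‖) ^ 2) := by
    refine h1.trans (h4.trans (le_of_eq ?_)); ring
  have h6 := le_of_mul_le_mul_left h5 hm'
  simpa [hPdef, hp] using h6

/-! ### The tail of the kernel integral -/

namespace IsModulusType
variable {w : ℝ → ℝ}

lemma nonneg (hw : IsModulusType w) {s : ℝ} (hs : 0 ≤ s) : 0 ≤ w s := by
  rw [← hw.zero]; exact hw.monotoneOn (Set.mem_Ici.mpr le_rfl) (Set.mem_Ici.mpr hs) hs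

lemma mono (hw : IsModulusType w) {s t : ℝ} (hs : 0 ≤ s) (hst : s ≤ t) : w s ≤ w t :=
  hw.monotoneOn (Set.mem_Ici.mpr hs) (Set.mem_Ici.mpr (hs.trans hst)) hst

lemma nat_mul_le (hw : IsModulusType w) (n : ℕ) {s : ℝ} (hs : 0 ≤ s) : w (n * s) ≤ n * w s := by
  induction n with
  | zero => simp [hw.zero]
  | succ n ih =>
    have := hw.subadd (n * s) s (by positivity) hs
    push_cast
    rw [add_mul, one_mul, add_mul, one_mul]
    linarith

lemma mul_le (hw : IsModulusType w) {a s : ℝ} (ha : 0 ≤ a) (hs : 0 ≤ s) :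
    w (a * s) ≤ (a + 1) * w s := by
  calc w (a * s) ≤ w (⌈a⌉₊ * s) := hw.mono (by positivity) (by gcongr; exact Nat.le_ceil a)
    _ ≤ ⌈a⌉₊ * w s := hw.nat_mul_le _ hs
    _ ≤ _ := by
      have := hw.nonneg hs
      gcongr
      exact (Nat.ceil_lt_add_one ha).le

lemma le_of_le_mul (hw : IsModulusType w) {a s t : ℝ} (ha : 0 ≤ a) (hs : 0 ≤ s) (ht : 0 ≤ t)
    (h : t ≤ a * s) : w t ≤ (a + 1) * w s :=
  (hw.mono ht h).trans (hw.mul_le ha hs)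

end IsModulusType

namespace MemOmegaW
variable {α M x : ℝ} {w : ℝ → ℝ} {f : ℝ → ℂ}

lemma lintegral_sub_le (hf : MemOmegaW α M w x f) {γ T : ℝ} (hγ : 0 < γ) (hT : 0 < T) :
    ∫⁻ t in Set.Ioc 0 T, ‖phi f x t - phi f x (t + γ)‖ₑ
      ≤ ENNReal.ofReal (M * w γ) * ENNReal.ofReal T := by
  have h := hf.shift_add γ T hγ hT
  calc _ = ENNReal.ofReal T * (ENNReal.ofReal (1 / T) *
        ∫⁻ t in Set.Ioc 0 T, ‖phi f x t - phi f x (t + γ)‖ₑ) := by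
        rw [← mul_assoc, ← ENNReal.ofReal_mul hT.le, mul_one_div_cancel hT.ne', ENNReal.ofReal_one,
          one_mul]
    _ ≤ _ := by rw [mul_comm]; gcongr

lemma sum_sq_le (hf : MemOmegaW α M w x f) {δ : ℝ} (hδ : 0 < δ) :
    ∑ k ∈ Finset.range (⌊Real.pi / (α * δ)⌋₊ + 1),
      (ENNReal.ofReal (1 / (((k : ℝ) + 1) * δ)) *
      ∫⁻ t in Set.Ioc ((k : ℝ) * δ) (((k : ℝ) + 1) * δ), ‖phi f x t‖ₑ) ^ (2 : ℝ)
      ≤ ENNReal.ofReal (M * w δ) ^ (2 : ℝ) := by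
  have h := hf.gabisonia_le δ hδ
  rw [gabisonia] at h
  have h2 := ENNReal.rpow_le_rpow h (z := 2) (by norm_num)
  rwa [← ENNReal.rpow_mul, one_div, inv_mul_cancel₀ (by norm_num), ENNReal.rpow_one] at h2

lemma lintegral_phi_block_le (hf : MemOmegaW α M w x f) {δ : ℝ} (hδ : 0 < δ) {j : ℕ}
    (hj : j ≤ ⌊Real.pi / (α * δ)⌋₊) :
    ∫⁻ t in Set.Ioc ((j : ℝ) * δ) (((j : ℝ) + 1) * δ), ‖phi f x t‖ₑ
      ≤ ENNReal.ofReal (((j : ℝ) + 1) * δ) * ENNReal.ofReal (M * w δ) := by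
  have h := (Finset.single_le_sum (f := fun k : ℕ => (ENNReal.ofReal (1 / (((k : ℝ) + 1) * δ)) *
      ∫⁻ t in Set.Ioc ((k : ℝ) * δ) (((k : ℝ) + 1) * δ), ‖phi f x t‖ₑ) ^ (2 : ℝ))
      (fun _ _ => zero_le) (Finset.mem_range.mpr (Nat.lt_succ_of_le hj))).trans (hf.sum_sq_le hδ)
  have h1 := (ENNReal.rpow_le_rpow_iff (by norm_num : (0 : ℝ) < 2)).mp h
  have hp : 0 < ((j : ℝ) + 1) * δ := by positivity
  calc _ = ENNReal.ofReal (((j : ℝ) + 1) * δ) * (ENNReal.ofReal (1 / (((j : ℝ) + 1) * δ)) *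
        ∫⁻ t in Set.Ioc ((j : ℝ) * δ) (((j : ℝ) + 1) * δ), ‖phi f x t‖ₑ) := by
        rw [← mul_assoc, ← ENNReal.ofReal_mul hp.le, mul_one_div_cancel hp.ne', ENNReal.ofReal_one,
          one_mul]
    _ ≤ _ := by gcongr

lemma lintegral_phi_le (hf : MemOmegaW α M w x f) {T : ℝ} (hT : 0 < T) :
    ∫⁻ t in Set.Ioc 0 T, ‖phi f x t‖ₑ ≤ ENNReal.ofReal T * ENNReal.ofReal (M * w T) := by
  simpa using hf.lintegral_phi_block_le hT (j := 0) (Nat.zero_le _)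

/-- Integrating over all of (0, A + γ] would only give w(A + γ), useless for small γ. Instead, for γ
≤ A, the interval is covered by two consecutive cells of mesh γ, each controlled by the second
condition of the class with w(γ). For A < γ ≤ 4A the crude bound suffices, as A + γ ≤ 2γ. -/
lemma lintegral_boundary_le (hα : 0 < α) (hM : 0 ≤ M) (hw : IsModulusType w)
    (hf : MemOmegaW α M w x f) {A γ : ℝ} (hA : A = Real.pi / (2 * α)) (hγ : 0 < γ)
    (hγA : γ ≤ 4 * A) :
    ∫⁻ t in Set.Ioc A (A + γ), ‖phi f x t‖ₑ ≤ ENNReal.ofReal (10 * A * (M * w γ)) := by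
  have hp := Real.pi_pos
  have hA0 : 0 < A := by rw [hA]; positivity
  have hwγ := hw.nonneg hγ.le
  rcases le_or_gt γ A with h | h
  · set j := ⌊A / γ⌋₊ with hj
    have hj1 : (j : ℝ) * γ ≤ A := by
      rw [← le_div_iff₀ hγ]; exact Nat.floor_le (by positivity)
    have hj2 : A ≤ ((j : ℝ) + 1) * γ := by
      rw [← div_le_iff₀ hγ]; exact (Nat.lt_floor_add_one _).le
    -- Here A = π/(2α) matters: the cells of the second condition reach up to about π/α = 2A, which
    -- leaves room for the cell after the one containing A.
    have hle : j + 1 ≤ ⌊Real.pi / (α * γ)⌋₊ := by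
      refine Nat.le_floor ?_
      rw [le_div_iff₀ (by positivity)]
      push_cast
      have : Real.pi = 2 * α * A := by rw [hA]; field_simp
      rw [this]
      nlinarith
    calc _ ≤ ∫⁻ t in Set.Ioc ((j : ℝ) * γ) (((j : ℝ) + 1) * γ) ∪
          Set.Ioc (((j + 1 : ℕ) : ℝ) * γ) ((((j + 1 : ℕ) : ℝ) + 1) * γ), ‖phi f x t‖ₑ := by
          refine lintegral_mono_set ?_
          push_cast
          rw [Set.Ioc_union_Ioc_eq_Ioc (by nlinarith) (by nlinarith)]
          exact Set.Ioc_subset_Ioc hj1 (by nlinarith)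
      _ ≤ ENNReal.ofReal (((j : ℝ) + 1) * γ) * ENNReal.ofReal (M * w γ) +
          ENNReal.ofReal ((((j + 1 : ℕ) : ℝ) + 1) * γ) * ENNReal.ofReal (M * w γ) :=
          (lintegral_union_le _ _ _).trans (add_le_add
            (hf.lintegral_phi_block_le hγ (by omega)) (hf.lintegral_phi_block_le hγ hle))
      _ ≤ _ := by
          rw [← add_mul, ← ENNReal.ofReal_add (by positivity) (by positivity),
            ← ENNReal.ofReal_mul (by positivity)]
          apply ENNReal.ofReal_le_ofReal
          gcongr
          push_cast
          nlinarith
  · calc _ ≤ ∫⁻ t in Set.Ioc 0 (A + γ), ‖phi f x t‖ₑ :=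
          lintegral_mono_set (Set.Ioc_subset_Ioc_left hA0.le)
      _ ≤ _ := hf.lintegral_phi_le (by linarith)
      _ ≤ _ := by
          rw [← ENNReal.ofReal_mul (by positivity)]
          apply ENNReal.ofReal_le_ofReal
          have h1 : w (A + γ) ≤ 2 * w γ := by
            have := hw.nat_mul_le 2 hγ.le
            push_cast at this
            exact (hw.mono (by positivity) (by linarith)).trans this
          have h2 := hw.nonneg (by positivity : 0 ≤ A + γ)
          calc (A + γ) * (M * w (A + γ)) ≤ (5 * A) * (M * (2 * w γ)) := by
                gcongr; linarith
            _ = _ := by ring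

end MemOmegaW

lemma abs_inv_sq_sub_inv_sq_le {t γ : ℝ} (ht : 0 < t) (hγ : 0 < γ) :
    |1 / t ^ 2 - 1 / (t + γ) ^ 2| ≤ 2 * γ * (1 / t ^ 3) := by
  have e : 1 / t ^ 2 - 1 / (t + γ) ^ 2 = γ * (2 * t + γ) / (t ^ 2 * (t + γ) ^ 2) := by
    field_simp; ring
  rw [e, abs_of_nonneg (by positivity), mul_one_div, div_le_div_iff₀ (by positivity) (by positivity)]
  have : 0 ≤ 2 * γ * t ^ 2 * ((t + γ) ^ 2 - t * (t + γ / 2)) := by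
    have : 0 ≤ (t + γ) ^ 2 - t * (t + γ / 2) := by nlinarith
    positivity
  nlinarith

/-- Integration of an oscillating factor by a half-period shift. -/
lemma enorm_integral_cos_le {φ : ℝ → ℂ} (hm : AEStronglyMeasurable φ) {B : ℝ}
    (hB : ∀ t, ‖φ t‖ ≤ B) {A μ : ℝ} (hA : 0 < A) (hμ : 0 < μ) :
    2 * ‖∫ t in Set.Ioi A, φ t * ((1 / t ^ 2 * Real.cos (μ * t) : ℝ) : ℂ)‖ₑ ≤
      (∫⁻ t in Set.Ioi A, ‖φ t - φ (t + Real.pi / μ)‖ₑ * ENNReal.ofReal (1 / t ^ 2)) +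
      (∫⁻ t in Set.Ioi A, ‖φ t‖ₑ * ENNReal.ofReal (1 / t ^ 3)) * ENNReal.ofReal (2 * (Real.pi / μ))
      + (∫⁻ t in Set.Ioc A (A + Real.pi / μ), ‖φ t‖ₑ) * ENNReal.ofReal (1 / A ^ 2) := by
  have hp := Real.pi_pos
  set γ := Real.pi / μ with hγdef
  have hγ : 0 < γ := by positivity
  have hμγ : μ * γ = Real.pi := by rw [hγdef]; field_simp
  set G : ℝ → ℂ := fun t => φ t * ((1 / t ^ 2 : ℝ) : ℂ) with hG
  set H : ℝ → ℂ := fun t => G t * (Real.cos (μ * t) : ℂ) with hH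
  have hGi : ∀ a : ℝ, 0 < a → IntegrableOn G (Set.Ioi a) := by
    intro a ha
    have h1 : IntegrableOn (fun t : ℝ => ((1 / t ^ 2 : ℝ) : ℂ)) (Set.Ioi a) := by
      have := (integrableOn_Ioi_rpow_of_lt (by norm_num : (-2 : ℝ) < -1) ha).ofReal (𝕜 := ℂ)
      refine IntegrableOn.congr_fun this (fun t ht => ?_) measurableSet_Ioi
      have ht : 0 < t := ha.trans ht
      rw [Real.rpow_neg ht.le, one_div]; norm_cast
    exact Integrable.bdd_mul (c := B) h1 hm.restrict (Eventually.of_forall hB)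
  have hcos : ∀ {F : ℝ → ℂ} {S : Set ℝ}, IntegrableOn F S →
      IntegrableOn (fun t => F t * (Real.cos (μ * t) : ℂ)) S := by
    intro F S hF
    refine Integrable.mul_bdd (c := 1) hF (Continuous.aestronglyMeasurable (by fun_prop))
      (Eventually.of_forall fun t => ?_)
    rw [Complex.norm_real]; exact Real.abs_cos_le_one _
  have hHi : ∀ a : ℝ, 0 < a → IntegrableOn H (Set.Ioi a) := fun a ha => hcos (hGi a ha)
  have hpre : (fun t => t + γ) ⁻¹' Set.Ioi (A + γ) = Set.Ioi A := by ext t; simp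
  have hGs : IntegrableOn (fun t => G (t + γ)) (Set.Ioi A) := by
    have := ((measurePreserving_add_right volume γ).integrableOn_comp_preimage
      (measurableEmbedding_addRight γ) (f := G) (s := Set.Ioi (A + γ))).mpr (hGi _ (by linarith))
    rwa [hpre] at this
  -- Since μγ = π, the shift by γ changes the sign of the cosine.
  have hshift : ∫ t in Set.Ioi A, G (t + γ) * (Real.cos (μ * t) : ℂ) = -∫ t in Set.Ioi (A + γ), H t := by
    have := (measurePreserving_add_right volume γ).setIntegral_preimage_emb
      (measurableEmbedding_addRight γ) H (Set.Ioi (A + γ))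
    rw [hpre] at this
    rw [← this, ← integral_neg]
    congr 1; funext t
    simp only [hH]
    rw [mul_add μ, hμγ, Real.cos_add_pi]; push_cast; ring
  have hsplit : ∫ t in Set.Ioi A, H t = (∫ t in Set.Ioc A (A + γ), H t) + ∫ t in Set.Ioi (A + γ), H t := by
    rw [← Set.Ioc_union_Ioi_eq_Ioi (by linarith : A ≤ A + γ)]
    exact setIntegral_union (Set.Ioc_disjoint_Ioi le_rfl) measurableSet_Ioi
      ((hHi A hA).mono_set Set.Ioc_subset_Ioi_self) (hHi _ (by linarith))
  have hI : ∫ t in Set.Ioi A, φ t * ((1 / t ^ 2 * Real.cos (μ * t) : ℝ) : ℂ) = ∫ t in Set.Ioi A, H t := by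
    congr 1; funext t
    simp only [hH, hG]; push_cast; ring
  have h2I : 2 * ∫ t in Set.Ioi A, H t =
      (∫ t in Set.Ioi A, (G t - G (t + γ)) * (Real.cos (μ * t) : ℂ)) + ∫ t in Set.Ioc A (A + γ), H t := by
    have : ∫ t in Set.Ioi A, (G t - G (t + γ)) * (Real.cos (μ * t) : ℂ) =
        (∫ t in Set.Ioi A, H t) + ∫ t in Set.Ioi (A + γ), H t := by
      simp only [sub_mul]
      rw [integral_sub (hHi A hA) (hcos hGs), hshift, sub_neg_eq_add]
    rw [this]
    linear_combination hsplit
  have hcosn : ∀ (z : ℂ) (t : ℝ), ‖z * (Real.cos (μ * t) : ℂ)‖ₑ ≤ ‖z‖ₑ := by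
    intro z t
    rw [← ofReal_norm, ← ofReal_norm]
    apply ENNReal.ofReal_le_ofReal
    rw [norm_mul, Complex.norm_real]
    exact mul_le_of_le_one_right (norm_nonneg _) (Real.abs_cos_le_one _)
  have hmul : ∀ (z : ℂ) (y : ℝ), ‖z * (y : ℂ)‖ₑ = ‖z‖ₑ * ENNReal.ofReal |y| := by
    intro z y
    rw [enorm_mul, ← ofReal_norm (y : ℂ), Complex.norm_real, Real.norm_eq_abs]
  have e2 : (2 : ℝ≥0∞) = ‖(2 : ℂ)‖ₑ := by
    rw [← ofReal_norm, Complex.norm_ofNat, ENNReal.ofReal_ofNat]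
  rw [hI, e2, ← enorm_mul, h2I]
  refine (enorm_add_le _ _).trans (add_le_add ?_ ?_)
  · refine (enorm_integral_le_lintegral_enorm _).trans ?_
    rw [← lintegral_mul_const' _ _ ENNReal.ofReal_ne_top, ← lintegral_add_right']
    · refine setLIntegral_mono' measurableSet_Ioi fun t ht => (hcosn _ _).trans ?_
      have ht : 0 < t := hA.trans ht
      -- The difference falls on φ, where the shift condition acts, or on the weight 1/t², which
      -- gains a factor γ/t.
      have e : G t - G (t + γ) = (φ t - φ (t + γ)) * ((1 / (t + γ) ^ 2 : ℝ) : ℂ)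
          + φ t * ((1 / t ^ 2 - 1 / (t + γ) ^ 2 : ℝ) : ℂ) := by
        simp only [hG]; push_cast; ring
      rw [e]
      refine (enorm_add_le _ _).trans ?_
      rw [hmul, hmul, mul_assoc ‖φ t‖ₑ, ← ENNReal.ofReal_mul (by positivity), mul_comm (1 / t ^ 3)]
      have h1 : |1 / (t + γ) ^ 2| ≤ 1 / t ^ 2 := by
        rw [abs_of_nonneg (by positivity)]
        gcongr; linarith
      have h2 := abs_inv_sq_sub_inv_sq_le ht hγ
      gcongr
    · refine AEMeasurable.mul_const (AEMeasurable.mul hm.enorm.restrict ?_) _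
      exact Measurable.aemeasurable (by fun_prop)
  · refine (enorm_integral_le_lintegral_enorm _).trans ?_
    rw [← lintegral_mul_const' _ _ ENNReal.ofReal_ne_top]
    refine setLIntegral_mono' measurableSet_Ioc fun t ht => (hcosn _ _).trans ?_
    simp only [hG]
    rw [hmul]
    have := ht.1
    rw [abs_of_nonneg (by positivity)]
    gcongr

lemma aestronglyMeasurable_phi {f : ℝ → ℂ} (hf : AEStronglyMeasurable f) (x : ℝ) :
    AEStronglyMeasurable (phi f x) :=
  ((aestronglyMeasurable_add_left hf x).add (aestronglyMeasurable_sub_left hf x)).sub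
    aestronglyMeasurable_const

lemma norm_phi_le {f : ℝ → ℂ} {B : ℝ} (hB : ∀ t, ‖f t‖ ≤ B) (x t : ℝ) : ‖phi f x t‖ ≤ 4 * B := by
  rw [phi]
  refine (norm_sub_le _ _).trans ?_
  rw [norm_mul, Complex.norm_ofNat]
  linarith [norm_add_le (f (x + t)) (f (x - t)), hB (x + t), hB (x - t), hB x]

/-- Each of the three terms of the half-period shift is O(M w(γ)). The difference term uses the
shift condition on dyadic intervals. In the 1/t³ term, w(T) ≤ (T/γ + 1)w(γ) gives ∫₀ᵀ|φ| = O(T²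
w(γ)/γ), and the prefactor 2γ cancels the loss 1/γ. The last term is `lintegral_boundary_le`. -/
lemma MemOmegaW.norm_integral_tail_cos_le {α M x : ℝ} {w : ℝ → ℝ} {f : ℝ → ℂ} (hα : 0 < α)
    (hM : 0 ≤ M) (hw : IsModulusType w) (hf : MemOmegaW α M w x f) {A μ : ℝ}
    (hA : A = Real.pi / (2 * α)) (hμ : 0 < μ) (hγA : Real.pi / μ ≤ 4 * A) :
    ‖∫ t in Set.Ioi A, phi f x t * ((1 / t ^ 2 * Real.cos (μ * t) : ℝ) : ℂ)‖
      ≤ 50 / A * (M * w (Real.pi / μ)) := by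
  have hp := Real.pi_pos
  have hA0 : 0 < A := by rw [hA]; positivity
  obtain ⟨B, hB⟩ := hf.bounded
  have hmain := enorm_integral_cos_le (aestronglyMeasurable_phi hf.almostPeriodic.1 x)
    (norm_phi_le hB x) hA0 hμ
  set γ := Real.pi / μ with hγdef
  have hγ : 0 < γ := by positivity
  have hW : 0 ≤ M * w γ := mul_nonneg hM (hw.nonneg hγ.le)
  set W := M * w γ with hWdef
  have h1 : ∫⁻ t in Set.Ioi A, ‖phi f x t - phi f x (t + γ)‖ₑ * ENNReal.ofReal (1 / t ^ 2)
      ≤ ENNReal.ofReal (W * (4 / A)) := by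
    have := lintegral_Ioi_mul_le (g := fun t => ‖phi f x t - phi f x (t + γ)‖ₑ) hA0 1
      (D := ENNReal.ofReal W) fun T hT => by
        rw [pow_one]; exact hf.lintegral_sub_le hγ (hA0.trans_le hT)
    refine this.trans (le_of_eq ?_)
    rw [← ENNReal.ofReal_mul hW]; norm_num
  have h2 : ∫⁻ t in Set.Ioi A, ‖phi f x t‖ₑ * ENNReal.ofReal (1 / t ^ 3)
      ≤ ENNReal.ofReal ((1 / γ + 1 / A) * W * (8 / A)) := by
    have := lintegral_Ioi_mul_le (g := fun t => ‖phi f x t‖ₑ) hA0 2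
      (D := ENNReal.ofReal ((1 / γ + 1 / A) * W)) fun T hT => by
        have hT0 : 0 < T := hA0.trans_le hT
        refine (hf.lintegral_phi_le hT0).trans ?_
        rw [← ENNReal.ofReal_mul hT0.le, ← ENNReal.ofReal_mul (by positivity)]
        apply ENNReal.ofReal_le_ofReal
        have h3 : w T ≤ (T / γ + 1) * w γ :=
          hw.le_of_le_mul (by positivity) hγ.le hT0.le (by field_simp; rfl)
        have h4 : T / γ + 1 ≤ T * (1 / γ + 1 / A) := by
          rw [mul_add, mul_one_div, mul_one_div]
          gcongr
          rwa [one_le_div hA0]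
        have hw0 := hw.nonneg hγ.le
        calc T * (M * w T) ≤ T * (M * ((T * (1 / γ + 1 / A)) * w γ)) := by
              gcongr
              exact h3.trans (by gcongr)
          _ = _ := by rw [hWdef]; ring
    refine this.trans (le_of_eq ?_)
    rw [← ENNReal.ofReal_mul (by positivity)]; norm_num
  have h3 := hf.lintegral_boundary_le hα hM hw hA hγ hγA
  have h4 : 2 * ‖∫ t in Set.Ioi A, phi f x t * ((1 / t ^ 2 * Real.cos (μ * t) : ℝ) : ℂ)‖
      ≤ W * (4 / A) + (1 / γ + 1 / A) * W * (8 / A) * (2 * γ) + 10 * A * W * (1 / A ^ 2) := by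
    rw [← ENNReal.ofReal_le_ofReal_iff (by positivity), ENNReal.ofReal_mul (by norm_num),
      ENNReal.ofReal_ofNat, ofReal_norm]
    refine hmain.trans ?_
    rw [ENNReal.ofReal_add (by positivity) (by positivity),
      ENNReal.ofReal_add (by positivity) (by positivity),
      ENNReal.ofReal_mul (q := 2 * γ) (by positivity),
      ENNReal.ofReal_mul (q := 1 / A ^ 2) (by positivity)]
    gcongr
  -- With γ/A ≤ 4 the constant is at most 30 + 64 ≤ 100, and the factor 2 on the left halves it to
  -- 50.
  have h5 : W * (4 / A) + (1 / γ + 1 / A) * W * (8 / A) * (2 * γ) + 10 * A * W * (1 / A ^ 2)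
      = (30 + 16 * (γ / A)) / A * W := by
    field_simp; ring
  have h6 : γ / A ≤ 4 := by rwa [div_le_iff₀ hA0]
  have h7 : (30 + 16 * (γ / A)) / A * W ≤ 100 / A * W := by gcongr; linarith
  have h8 : 100 / A * W = 2 * (50 / A * W) := by ring
  linarith

lemma MemOmegaW.norm_integral_tail_kernel_le {α M x : ℝ} {w : ℝ → ℝ} {f : ℝ → ℂ} (hα : 0 < α)
    (hM : 0 ≤ M) (hw : IsModulusType w) (hf : MemOmegaW α M w x f) {A l : ℝ}
    (hA : A = Real.pi / (2 * α)) (hl : 0 < l) (hγA : Real.pi / l ≤ 4 * A) :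
    ‖∫ t in Set.Ioi A, phi f x t * (kernel (α / 2) l t : ℂ)‖
      ≤ 100 / (Real.pi * cosConst) * (2 * (M * w (Real.pi / l))) := by
  have hp := Real.pi_pos
  have hc := cosConst_pos
  have hA0 : 0 < A := by rw [hA]; positivity
  obtain ⟨B, hB⟩ := hf.bounded
  have hlh : Real.pi / (l + α / 2) ≤ Real.pi / l := by gcongr; linarith
  have h1 := hf.norm_integral_tail_cos_le hα hM hw hA hl hγA
  have h2 := hf.norm_integral_tail_cos_le hα hM hw hA (by positivity : 0 < l + α / 2) (hlh.trans hγA)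
  have h3 : w (Real.pi / (l + α / 2)) ≤ w (Real.pi / l) := hw.mono (by positivity) hlh
  have hint : ∀ μ : ℝ, IntegrableOn
      (fun t => phi f x t * ((1 / t ^ 2 * Real.cos (μ * t) : ℝ) : ℂ)) (Set.Ioi A) := by
    intro μ
    have h1 : IntegrableOn (fun t : ℝ => t ^ (-2 : ℝ)) (Set.Ioi A) :=
      integrableOn_Ioi_rpow_of_lt (by norm_num) hA0
    have h2 : IntegrableOn (fun t : ℝ => 1 / t ^ 2 * Real.cos (μ * t)) (Set.Ioi A) := by
      refine Integrable.mono' h1 (Measurable.aestronglyMeasurable (by fun_prop)) ?_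
      filter_upwards [ae_restrict_mem measurableSet_Ioi] with t ht
      have ht : 0 < t := hA0.trans ht
      rw [norm_mul, Real.norm_of_nonneg (by positivity), Real.rpow_neg ht.le, one_div,
        Real.rpow_ofNat]
      exact mul_le_of_le_one_right (by positivity) (Real.abs_cos_le_one _)
    exact Integrable.bdd_mul (c := 4 * B) (h2.ofReal (𝕜 := ℂ))
      (aestronglyMeasurable_phi hf.almostPeriodic.1 x).restrict
      (Eventually.of_forall (norm_phi_le hB x))
  have e : ∫ t in Set.Ioi A, phi f x t * (kernel (α / 2) l t : ℂ) =
      ((1 / (cosConst * α) : ℝ) : ℂ) *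
      ((∫ t in Set.Ioi A, phi f x t * ((1 / t ^ 2 * Real.cos (l * t) : ℝ) : ℂ)) -
      ∫ t in Set.Ioi A, phi f x t * ((1 / t ^ 2 * Real.cos ((l + α / 2) * t) : ℝ) : ℂ)) := by
    rw [← integral_sub (hint _) (hint _), ← integral_const_mul]
    congr 1; funext t
    have : kernel (α / 2) l t = 1 / (cosConst * α) *
        (1 / t ^ 2 * Real.cos (l * t) - 1 / t ^ 2 * Real.cos ((l + α / 2) * t)) := by
      rw [kernel, ← mul_sub, ← mul_assoc, ← one_div_mul_one_div_rev]
      field_simp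
    rw [this]; push_cast; ring
  rw [e, norm_mul, Complex.norm_real, Real.norm_of_nonneg (by positivity)]
  calc _ ≤ 1 / (cosConst * α) * (50 / A * (M * w (Real.pi / l)) + 50 / A * (M * w (Real.pi / l))) := by
        gcongr
        refine (norm_sub_le _ _).trans (add_le_add h1 (h2.trans ?_))
        gcongr
    _ = _ := by
        rw [hA]; field_simp; ring

/-! ### Quadratic means of the kernel integrals over a block -/

/-- The slowly varying factor of the kernel. -/
noncomputable def kernelAmp (h t : ℝ) : ℝ := Real.sin (h * t / 2) / (cosConst * h * t ^ 2)

/-- The amplitude is free of l. For l = h(m + i) only the sine depends on i, and its frequencies hm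
+ h/2 + hi form an arithmetic progression, as the large sieve requires. -/
lemma kernel_eq_amp_mul_sin (h l t : ℝ) :
    kernel h l t = kernelAmp h t * Real.sin ((l + h / 2) * t) := by
  have e : Real.cos (l * t) - Real.cos ((l + h) * t)
      = 2 * (Real.sin (h * t / 2) * Real.sin ((l + h / 2) * t)) := by
    rw [Real.cos_sub_cos, show (l * t + (l + h) * t) / 2 = (l + h / 2) * t by ring,
      show (l * t - (l + h) * t) / 2 = -(h * t / 2) by ring, Real.sin_neg]
    ring
  rw [kernel, kernelAmp, e, mul_assoc 2 cosConst, mul_assoc 2 (cosConst * h),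
    mul_div_mul_left _ _ (two_ne_zero)]
  ring

/-- The decay 1/t matches the weights 1/((k+1)δ) in the second condition of the class. -/
lemma abs_kernelAmp_le {h t : ℝ} (hh : 0 < h) (ht : 0 < t) :
    |kernelAmp h t| ≤ 1 / (2 * cosConst * t) := by
  have hc := cosConst_pos
  rw [kernelAmp, abs_div, abs_of_pos (by positivity : 0 < cosConst * h * t ^ 2),
    div_le_div_iff₀ (by positivity) (by positivity)]
  have h1 := Real.abs_sin_le_abs (x := h * t / 2)
  rw [abs_of_pos (by positivity : 0 < h * t / 2)] at h1
  have : 0 < 2 * cosConst * t := by positivity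
  nlinarith

lemma abs_kernel_le {h l t : ℝ} (hh : 0 < h) (hl : 0 ≤ l) (ht : 0 < t) :
    |kernel h l t| ≤ (l + h / 2) / (2 * cosConst) := by
  have hc := cosConst_pos
  rw [kernel_eq_amp_mul_sin, abs_mul]
  have h1 := Real.abs_sin_le_abs (x := (l + h / 2) * t)
  rw [abs_of_nonneg (by positivity : 0 ≤ (l + h / 2) * t)] at h1
  calc _ ≤ 1 / (2 * cosConst * t) * ((l + h / 2) * t) :=
        mul_le_mul (abs_kernelAmp_le hh ht) h1 (abs_nonneg _) (by positivity)
    _ = _ := by field_simp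

lemma add_add_sq_le (a b c : ℝ) : (a + b + c) ^ 2 ≤ 3 * (a ^ 2 + b ^ 2 + c ^ 2) := by
  nlinarith [sq_nonneg (a - b), sq_nonneg (a - c), sq_nonneg (b - c)]

lemma measurable_kernelAmp (h : ℝ) : Measurable (kernelAmp h) := by
  unfold kernelAmp; fun_prop

/-- Sine version of the large sieve with half-integral frequencies. -/
lemma large_sieve_sin {m : ℕ} (hm : 0 < m) {h δ : ℝ} (hδ : 0 < δ)
    (hh : |h| * δ = Real.pi / (2 * m)) {E : ℕ → Set ℝ} (hE : ∀ j, MeasurableSet (E j))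
    (hEs : ∀ j : ℕ, E j ⊆ Set.Ioc (j * δ) ((j + 1) * δ)) {g : ℝ → ℂ}
    (hg : ∀ j, IntegrableOn g (E j)) (l : ℝ) :
    ∑ i ∈ Finset.range m, ‖∑ j ∈ Finset.range (m + 1),
      ∫ t in E j, g t * (Real.sin ((l + h * i) * t) : ℂ)‖ ^ 2
      ≤ 144 * m * ∑ j ∈ Finset.range (m + 1), (∫ t in E j, ‖g t‖) ^ 2 := by
  have hint : ∀ {g : ℝ → ℂ} {S : Set ℝ}, IntegrableOn g S → ∀ k : ℝ,
      IntegrableOn (fun t => g t * Complex.exp (Complex.I * k * t)) S := by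
    intro g S hg k
    refine Integrable.mul_bdd (c := 1) hg
      (Continuous.aestronglyMeasurable (by fun_prop)) (Eventually.of_forall fun t => ?_)
    rw [norm_exp_I]
  have hs : ∀ (h' l' : ℝ), |h'| * δ = Real.pi / (2 * m) →
      ∑ i ∈ Finset.range m, ‖∑ j ∈ Finset.range (m + 1),
      ∫ t in E j, (g t * Complex.exp (Complex.I * l' * t)) * Complex.exp (Complex.I * (h' * i : ℝ) * t)‖ ^ 2
      ≤ 144 * m * ∑ j ∈ Finset.range (m + 1), (∫ t in E j, ‖g t‖) ^ 2 := by
    intro h' l' hh'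
    have := large_sieve hm hδ hh' hE hEs (g := fun t => g t * Complex.exp (Complex.I * l' * t))
      fun j => hint (hg j) l'
    simpa only [norm_mul, norm_exp_I, mul_one] using this
  have h1 := hs h l hh
  -- The sine is a combination of e^{±i(l + hi)t}. The constant phase e^{±ilt} is absorbed into `g`
  -- without changing |g|, and the negative frequencies need step -h.
  have h2 := hs (-h) (-l) (by rwa [abs_neg])
  have key : ∀ i ∈ Finset.range m, ‖∑ j ∈ Finset.range (m + 1),
      ∫ t in E j, g t * (Real.sin ((l + h * i) * t) : ℂ)‖ ^ 2 ≤ 1 / 2 * (‖∑ j ∈ Finset.range (m + 1),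
      ∫ t in E j, (g t * Complex.exp (Complex.I * l * t)) * Complex.exp (Complex.I * (h * i : ℝ) * t)‖ ^ 2
      + ‖∑ j ∈ Finset.range (m + 1), ∫ t in E j, (g t * Complex.exp (Complex.I * (-l : ℝ) * t)) *
        Complex.exp (Complex.I * (-h * i : ℝ) * t)‖ ^ 2) := by
    intro i _
    set X := ∑ j ∈ Finset.range (m + 1),
      ∫ t in E j, (g t * Complex.exp (Complex.I * l * t)) * Complex.exp (Complex.I * (h * i : ℝ) * t)
    set Y := ∑ j ∈ Finset.range (m + 1), ∫ t in E j, (g t * Complex.exp (Complex.I * (-l : ℝ) * t)) *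
        Complex.exp (Complex.I * (-h * i : ℝ) * t)
    have e : ∑ j ∈ Finset.range (m + 1), ∫ t in E j, g t * (Real.sin ((l + h * i) * t) : ℂ)
        = (Complex.I / 2) * (Y - X) := by
      rw [← Finset.sum_sub_distrib, Finset.mul_sum]
      refine Finset.sum_congr rfl fun j _ => ?_
      rw [← integral_sub (hint (hint (hg j) _) _) (hint (hint (hg j) _) _), ← integral_const_mul]
      congr 1; funext t
      have e1 : (Real.sin ((l + h * i) * t) : ℂ) = (Complex.I / 2) *
          (Complex.exp (Complex.I * (-l : ℝ) * t) * Complex.exp (Complex.I * (-h * i : ℝ) * t) -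
          Complex.exp (Complex.I * l * t) * Complex.exp (Complex.I * (h * i : ℝ) * t)) := by
        rw [Complex.ofReal_sin, Complex.sin, ← Complex.exp_add, ← Complex.exp_add]
        rw [show -(((l + h * i) * t : ℝ) : ℂ) * Complex.I = Complex.I * (-l : ℝ) * t +
          Complex.I * (-h * i : ℝ) * t by push_cast; ring,
          show (((l + h * i) * t : ℝ) : ℂ) * Complex.I = Complex.I * l * t +
          Complex.I * (h * i : ℝ) * t by push_cast; ring]
        ring
      rw [e1]; ring
    rw [e, norm_mul, norm_div, Complex.norm_I, Complex.norm_ofNat, mul_pow]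
    have hn := norm_sub_le Y X
    have : ‖Y - X‖ ^ 2 ≤ (‖Y‖ + ‖X‖) ^ 2 := by gcongr
    nlinarith [sq_nonneg (‖X‖ - ‖Y‖)]
  refine (Finset.sum_le_sum key).trans ?_
  rw [← Finset.mul_sum, Finset.sum_add_distrib]
  linarith

namespace MemOmegaW
variable {α M x : ℝ} {w : ℝ → ℝ} {f : ℝ → ℂ}

lemma integrableOn_phi (hf : MemOmegaW α M w x f) {S : Set ℝ} (hS : volume S ≠ ⊤) :
    IntegrableOn (phi f x) S := by
  obtain ⟨B, hB⟩ := hf.bounded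
  exact Measure.integrableOn_of_bounded hS (aestronglyMeasurable_phi hf.almostPeriodic.1 x)
    (Eventually.of_forall (norm_phi_le hB x))

lemma sum_sq_average_le (hα : 0 < α) (hM : 0 ≤ M) (hw : IsModulusType w) (hf : MemOmegaW α M w x f)
    {m : ℕ} (hm : 0 < m) {δ : ℝ} (hδ : δ = Real.pi / (α * m)) :
    ∑ j ∈ Finset.range (m + 1), (1 / (((j : ℝ) + 1) * δ) *
      ∫ t in Set.Ioc ((j : ℝ) * δ) (((j : ℝ) + 1) * δ), ‖phi f x t‖) ^ 2 ≤ (M * w δ) ^ 2 := by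
  have hp := Real.pi_pos
  have hm' : (0 : ℝ) < m := by exact_mod_cast hm
  have hδ0 : 0 < δ := by rw [hδ]; positivity
  -- For this δ the quotient π/(αδ) is exactly m, so the second condition has exactly the m + 1
  -- cells of the large sieve.
  have hfl : ⌊Real.pi / (α * δ)⌋₊ = m := by
    rw [hδ, show Real.pi / (α * (Real.pi / (α * m))) = m by field_simp, Nat.floor_natCast]
  have h := hf.sum_sq_le hδ0
  rw [hfl, ENNReal.rpow_two, ← ENNReal.ofReal_pow (mul_nonneg hM (hw.nonneg hδ0.le))] at h
  rw [← ENNReal.ofReal_le_ofReal_iff (by positivity), ENNReal.ofReal_sum_of_nonneg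
    (fun _ _ => by positivity)]
  refine le_trans (Finset.sum_le_sum fun j _ => le_of_eq ?_) h
  rw [ENNReal.rpow_two, ENNReal.ofReal_pow (by positivity), ENNReal.ofReal_mul (by positivity),
    ofReal_integral_norm_eq_lintegral_enorm (hf.integrableOn_phi (by simp))]

set_option maxHeartbeats 800000 in
/-- The quadratic mean of the kernel integrals over a dyadic block of frequencies. -/
lemma sum_sq_norm_integral_le (hα : 0 < α) (hM : 0 ≤ M) (hw : IsModulusType w)
    (hf : MemOmegaW α M w x f) {m : ℕ} (hm : 0 < m) {δ : ℝ} (hδ : δ = Real.pi / (α * m)) :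
    ∑ i ∈ Finset.range m, ‖∫ t in Set.Ioi (0 : ℝ),
      phi f x t * (kernel (α / 2) (α / 2 * (m + i)) t : ℂ)‖ ^ 2
      ≤ 3 * ((Real.pi / (2 * cosConst)) ^ 2 + 144 * (1 / cosConst) ^ 2 +
        (100 / (Real.pi * cosConst) * 4) ^ 2) * m * (M * w δ) ^ 2 := by
  have hp := Real.pi_pos
  have hc := cosConst_pos
  have hm' : (0 : ℝ) < m := by exact_mod_cast hm
  have hm1 : (1 : ℝ) ≤ m := by exact_mod_cast hm
  have hδ0 : 0 < δ := by rw [hδ]; positivity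
  obtain ⟨B, hB⟩ := hf.bounded
  have hφm := aestronglyMeasurable_phi hf.almostPeriodic.1 x
  have hφB := norm_phi_le hB x
  set W := M * w δ with hW
  have hW0 : 0 ≤ W := mul_nonneg hM (hw.nonneg hδ0.le)
  set h := α / 2 with hh
  have hh0 : 0 < h := by positivity
  set A := Real.pi / (2 * α) with hA
  have hA0 : 0 < A := by positivity
  have hδA : δ * m = 2 * A := by rw [hδ, hA]; field_simp
  have hhδ : |h| * δ = Real.pi / (2 * m) := by
    rw [abs_of_pos hh0, hh, hδ]; field_simp
  set I : ℕ → Set ℝ := fun j => Set.Ioc ((j : ℝ) * δ) (((j : ℝ) + 1) * δ) with hI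
  -- Cells cut off at A; those lying beyond A become empty.
  set a : ℕ → ℝ := fun j => min (j * δ) A with ha
  set E : ℕ → Set ℝ := fun j => Set.Ioc (a j) (a (j + 1)) with hE
  have hEI : ∀ j, E j ⊆ I j := by
    intro j t ht
    simp only [hE, ha, Set.mem_Ioc, min_lt_iff, le_min_iff] at ht
    obtain ⟨h1, h2, h3⟩ := ht
    push_cast at h2
    exact ⟨h1.resolve_right (not_lt.mpr h3), h2⟩
  -- The cell at the origin is removed: the bound 1/t is not comparable with 1/δ there. It is
  -- treated separately through |kernel| ≤ hm/`cosConst`.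
  set E' : ℕ → Set ℝ := fun j => if j = 0 then ∅ else E j with hE'
  have hE'E : ∀ j, E' j ⊆ E j := by
    intro j
    simp only [hE']
    split_ifs
    · exact Set.empty_subset _
    · exact subset_rfl
  have hE'm : ∀ j, MeasurableSet (E' j) := by
    intro j
    simp only [hE']
    split_ifs
    · exact MeasurableSet.empty
    · exact measurableSet_Ioc
  have hIfin : ∀ j, volume (I j) ≠ ⊤ := fun j => by simp [hI]
  set g : ℝ → ℂ := fun t => phi f x t * (kernelAmp h t : ℂ) with hg
  have hE'pos : ∀ j, ∀ t ∈ E' j, (j : ℝ) ≠ 0 ∧ t ∈ I j := by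
    intro j t ht
    refine ⟨?_, hEI j (hE'E j ht)⟩
    rintro hj
    have hj : j = 0 := by exact_mod_cast hj
    simp [hE', hj] at ht
  have hgle : ∀ j, ∀ t ∈ E' j, ‖g t‖ ≤ 1 / cosConst * (1 / ((j + 1) * δ)) * ‖phi f x t‖ := by
    intro j t ht
    obtain ⟨hj0, ht1, ht2⟩ := hE'pos j t ht
    have hj1 : (1 : ℝ) ≤ j := by
      have : j ≠ 0 := by exact_mod_cast hj0
      exact_mod_cast Nat.one_le_iff_ne_zero.mpr this
    have ht0 : 0 < t := lt_trans (by positivity) ht1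
    simp only [hg]
    rw [norm_mul, mul_comm, Complex.norm_real, Real.norm_eq_abs]
    gcongr
    -- For j ≥ 1 one has (j + 1)δ ≤ 2jδ < 2t.
    have h2t : (j + 1) * δ ≤ 2 * t := by nlinarith
    refine (abs_kernelAmp_le hh0 ht0).trans ?_
    rw [one_div_mul_one_div]
    exact one_div_le_one_div_of_le (by positivity) (by nlinarith)
  have hgint : ∀ j, IntegrableOn g (E' j) := by
    intro j
    have h1 : IntegrableOn (fun t => 1 / cosConst * (1 / ((j + 1) * δ)) * ‖phi f x t‖) (E' j) :=
      (((hf.integrableOn_phi (hIfin j)).mono_set ((hE'E j).trans (hEI j))).norm).const_mul _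
    refine Integrable.mono' h1 ?_ ?_
    · exact (hφm.mul (Complex.measurable_ofReal.comp
        (measurable_kernelAmp h)).aestronglyMeasurable).restrict
    · filter_upwards [ae_restrict_mem (hE'm j)] with t ht using hgle j t ht
  have hJ : ∀ j, ∫ t in E' j, ‖g t‖ ≤ 1 / cosConst * (1 / ((j + 1) * δ) * ∫ t in I j, ‖phi f x t‖) := by
    intro j
    calc _ ≤ ∫ t in E' j, 1 / cosConst * (1 / ((j + 1) * δ)) * ‖phi f x t‖ :=
          setIntegral_mono_on (hgint j).norm ((((hf.integrableOn_phi (hIfin j)).mono_set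
            ((hE'E j).trans (hEI j))).norm).const_mul _) (hE'm j) (hgle j)
      _ = 1 / cosConst * (1 / ((j + 1) * δ) * ∫ t in E' j, ‖phi f x t‖) := by
          rw [integral_const_mul, mul_assoc]
      _ ≤ _ := by
          gcongr
          · exact Eventually.of_forall fun t => norm_nonneg _
          · exact (hf.integrableOn_phi (hIfin j)).norm
          · exact (hE'E j).trans (hEI j)
  have hsumJ : ∑ j ∈ Finset.range (m + 1), (∫ t in E' j, ‖g t‖) ^ 2 ≤ (1 / cosConst) ^ 2 * W ^ 2 := by
    refine le_trans ?_ (mul_le_mul_of_nonneg_left (hf.sum_sq_average_le hα hM hw hm hδ)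
      (by positivity))
    rw [Finset.mul_sum]
    refine Finset.sum_le_sum fun j _ => ?_
    rw [← mul_pow]
    gcongr
    exact hJ j
  have hsieve := large_sieve_sin hm hδ0 hhδ hE'm (fun j => (hE'E j).trans (hEI j)) hgint
    (h * m + h / 2)
  have hdecomp : ∀ i ∈ Finset.range m, ‖∫ t in Set.Ioi (0 : ℝ),
      phi f x t * (kernel h (h * (m + i)) t : ℂ)‖ ^ 2 ≤ 3 * ((Real.pi / (2 * cosConst) * W) ^ 2 +
      ‖∑ j ∈ Finset.range (m + 1),
        ∫ t in E' j, g t * (Real.sin ((h * m + h / 2 + h * i) * t) : ℂ)‖ ^ 2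
      + (100 / (Real.pi * cosConst) * 4 * W) ^ 2) := by
    intro i hi
    have hi' : (i : ℝ) + 1 ≤ m := by exact_mod_cast Finset.mem_range.mp hi
    set l := h * (m + i) with hl
    have hl0 : 0 < l := by positivity
    have hK : Integrable (fun t => phi f x t * (kernel h l t : ℂ)) :=
      integrable_mul_kernel hφm hφB h l
    have ha0 : a 0 = 0 := by simp [ha, hA0.le]
    -- The cells exhaust (0, A], since (m + 1)δ > mδ = 2A.
    have ham : a (m + 1) = A := by
      simp only [ha]
      rw [min_eq_right]
      push_cast; nlinarith
    have hamono : ∀ j, a j ≤ a (j + 1) := fun j => by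
      simp only [ha]; push_cast
      exact min_le_min_right _ (by nlinarith)
    have hsplit : ∫ t in Set.Ioi (0 : ℝ), phi f x t * (kernel h l t : ℂ) =
        (∫ t in E 0, phi f x t * (kernel h l t : ℂ)) + (∑ j ∈ Finset.range (m + 1),
        ∫ t in E' j, g t * (Real.sin ((h * m + h / 2 + h * i) * t) : ℂ))
        + ∫ t in Set.Ioi A, phi f x t * (kernel h l t : ℂ) := by
      have e1 : ∫ t in Set.Ioc 0 A, phi f x t * (kernel h l t : ℂ)
          = ∑ j ∈ Finset.range (m + 1), ∫ t in E j, phi f x t * (kernel h l t : ℂ) := by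
        rw [← intervalIntegral.integral_of_le hA0.le, ← ham, ← ha0,
          ← intervalIntegral.sum_integral_adjacent_intervals fun j _ => hK.intervalIntegrable]
        exact Finset.sum_congr rfl fun j _ => intervalIntegral.integral_of_le (hamono j)
      rw [← Set.Ioc_union_Ioi_eq_Ioi hA0.le, setIntegral_union (Set.Ioc_disjoint_Ioi le_rfl)
        measurableSet_Ioi hK.integrableOn hK.integrableOn, e1, Finset.sum_range_succ',
        Finset.sum_range_succ' (fun j => ∫ t in E' j, _)]
      have e0 : E' 0 = ∅ := by simp [hE']
      rw [e0, Measure.restrict_empty, integral_zero_measure, add_zero, add_comm (∫ t in E 0, _)]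
      congr 2
      refine Finset.sum_congr rfl fun j _ => ?_
      have : E' (j + 1) = E (j + 1) := by simp [hE']
      rw [this]
      congr 1; funext t
      rw [kernel_eq_amp_mul_sin, hl,
        show h * (m + i) + h / 2 = h * m + h / 2 + h * i by ring]
      simp only [hg]; push_cast; ring
    have hhead : ‖∫ t in E 0, phi f x t * (kernel h l t : ℂ)‖ ≤ Real.pi / (2 * cosConst) * W := by
      have hE0 : E 0 ⊆ Set.Ioc 0 δ := by simpa [hI] using hEI 0
      have hi1 := hf.integrableOn_phi (S := Set.Ioc 0 δ) (by simp)
      have hblock : ∫ t in Set.Ioc 0 δ, ‖phi f x t‖ ≤ δ * W := by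
        rw [← ENNReal.ofReal_le_ofReal_iff (by positivity), ENNReal.ofReal_mul hδ0.le,
          ofReal_integral_norm_eq_lintegral_enorm hi1]
        exact hf.lintegral_phi_le hδ0
      calc _ ≤ ∫ t in E 0, ‖phi f x t‖ * (h * m / cosConst) := by
            refine norm_integral_le_of_norm_le ((hi1.mono_set hE0).norm.mul_const _) ?_
            filter_upwards [ae_restrict_mem measurableSet_Ioc] with t ht
            rw [norm_mul, Complex.norm_real, Real.norm_eq_abs]
            gcongr
            refine (abs_kernel_le hh0 hl0.le (hE0 ht).1).trans ?_
            rw [div_le_div_iff₀ (by positivity) hc, hl]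
            have : h * (m + i) + h / 2 ≤ h * (2 * m) := by nlinarith
            nlinarith
        _ = (∫ t in E 0, ‖phi f x t‖) * (h * m / cosConst) := integral_mul_const _ _
        _ ≤ (δ * W) * (h * m / cosConst) := by
            gcongr
            refine le_trans ?_ hblock
            exact setIntegral_mono_set hi1.norm (Eventually.of_forall fun t => norm_nonneg _)
              (Eventually.of_forall hE0)
        _ = _ := by
            rw [hδ, hh]; field_simp
    have htail : ‖∫ t in Set.Ioi A, phi f x t * (kernel h l t : ℂ)‖
        ≤ 100 / (Real.pi * cosConst) * 4 * W := by
      -- All frequencies of the block are at least αm/2, so their half-periods are at most 2δ.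
      have hπl : Real.pi / l ≤ 2 * δ := by
        rw [div_le_iff₀ hl0, hl, hδ, hh]
        calc Real.pi = Real.pi / m * m := by field_simp
          _ ≤ Real.pi / m * (m + i) := by gcongr; linarith [(Nat.cast_nonneg i : (0 : ℝ) ≤ i)]
          _ = _ := by field_simp
      have hδ2A : δ ≤ 2 * A := by rw [← hδA]; nlinarith
      refine (hf.norm_integral_tail_kernel_le hα hM hw hA hl0 (by linarith)).trans ?_
      rw [mul_assoc _ 4 W]
      gcongr 100 / (Real.pi * cosConst) * ?_
      have h1 : w (Real.pi / l) ≤ 2 * w δ := by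
        have := hw.nat_mul_le 2 hδ0.le
        push_cast at this
        exact (hw.mono (by positivity) hπl).trans this
      calc 2 * (M * w (Real.pi / l)) ≤ 2 * (M * (2 * w δ)) := by gcongr
        _ = _ := by rw [hW]; ring
    rw [hsplit]
    refine le_trans (pow_le_pow_left₀ (norm_nonneg _) norm_add₃_le 2) ?_
    refine (add_add_sq_le _ _ _).trans ?_
    gcongr
  refine (Finset.sum_le_sum hdecomp).trans ?_
  rw [← Finset.mul_sum, Finset.sum_add_distrib, Finset.sum_add_distrib, Finset.sum_const,
    Finset.sum_const, Finset.card_range, nsmul_eq_mul, nsmul_eq_mul]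
  have h5 : 144 * (m : ℝ) * ∑ j ∈ Finset.range (m + 1), (∫ t in E' j, ‖g t‖) ^ 2
      ≤ 144 * m * ((1 / cosConst) ^ 2 * W ^ 2) := by gcongr
  rw [mul_pow, mul_pow _ W]
  calc _ ≤ 3 * (m * ((Real.pi / (2 * cosConst)) ^ 2 * W ^ 2) +
        144 * m * ((1 / cosConst) ^ 2 * W ^ 2) +
        m * ((100 / (Real.pi * cosConst) * 4) ^ 2 * W ^ 2)) := by
        gcongr
        exact hsieve.trans h5
    _ = _ := by ring

end MemOmegaW

/-! ### From quadratic block means to the weighted strong mean -/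

lemma tsum_le_dyadic (x : ℕ → ℝ≥0∞) :
    ∑' k, x k ≤ x 0 + ∑' s : ℕ, ∑ k ∈ Finset.Ico (2 ^ s) (2 * 2 ^ s), x k := by
  have h1 : ∀ k, x k ≤ (if k = 0 then x 0 else 0) +
      ∑' s : ℕ, if k ∈ Finset.Ico (2 ^ s) (2 * 2 ^ s) then x k else 0 := by
    intro k
    rcases Nat.eq_zero_or_pos k with rfl | hk
    · simp
    · refine le_add_left ?_
      refine le_trans ?_ (ENNReal.le_tsum (Nat.log 2 k))
      rw [if_pos]
      rw [Finset.mem_Ico, ← pow_succ']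
      exact ⟨Nat.pow_log_le_self 2 hk.ne', Nat.lt_pow_succ_log_self (by norm_num) k⟩
  refine (ENNReal.tsum_le_tsum h1).trans ?_
  rw [ENNReal.tsum_add, tsum_ite_eq, ENNReal.tsum_comm]
  gcongr with s
  rw [tsum_eq_sum (s := Finset.Ico (2 ^ s) (2 * 2 ^ s)) fun k hk => if_neg hk]
  exact Finset.sum_le_sum fun k hk => by rw [if_pos hk]

/-- If k lies in `T s₀` and `T (s₀ + d)`, then 2^d ≤ D² < 2^N. Hence each k occurs in at most N of
the sets, counted from the first one containing it. -/
lemma tsum_sum_le_of_overlap (y : ℕ → ℝ≥0∞) {D : ℝ} (hD : 0 ≤ D) {N : ℕ} (hN : D * D < 2 ^ N)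
    (T : ℕ → Finset ℕ) (hT : ∀ s, ∀ k ∈ T s, (2 : ℝ) ^ s ≤ D * (k + 1) ∧ (k : ℝ) + 1 ≤ D * 2 ^ s) :
    ∑' s : ℕ, ∑ k ∈ T s, y k ≤ N * ∑' k, y k := by
  have h1 : ∀ s, ∑ k ∈ T s, y k = ∑' k, if k ∈ T s then y k else 0 := fun s => by
    rw [tsum_eq_sum (s := T s) fun k hk => if_neg hk]
    exact Finset.sum_congr rfl fun k hk => by rw [if_pos hk]
  simp only [h1]
  rw [ENNReal.tsum_comm, ← ENNReal.tsum_mul_left]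
  refine ENNReal.tsum_le_tsum fun k => ?_
  by_cases hex : ∃ s, k ∈ T s
  · classical
    set s₀ := Nat.find hex with hs₀
    have hs₀T : k ∈ T s₀ := Nat.find_spec hex
    calc _ ≤ ∑' s : ℕ, if s ∈ Finset.Ico s₀ (s₀ + N) then y k else 0 := by
          refine ENNReal.tsum_le_tsum fun s => ?_
          by_cases hs : k ∈ T s
          · rw [if_pos hs, if_pos]
            have hle : s₀ ≤ s := Nat.find_min' hex hs
            refine Finset.mem_Ico.mpr ⟨hle, ?_⟩
            obtain ⟨d, rfl⟩ := Nat.exists_eq_add_of_le hle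
            have h2 := (hT _ k hs).1
            have h3 := (hT _ k hs₀T).2
            have h4 : (2 : ℝ) ^ d < 2 ^ N := by
              refine lt_of_le_of_lt ?_ hN
              have h5 : (2 : ℝ) ^ s₀ * 2 ^ d ≤ 2 ^ s₀ * (D * D) := by
                rw [← pow_add]
                calc _ ≤ D * (k + 1) := h2
                  _ ≤ D * (D * 2 ^ s₀) := by gcongr
                  _ = _ := by ring
              exact le_of_mul_le_mul_left h5 (by positivity)
            have := (pow_lt_pow_iff_right₀ (by norm_num : (1 : ℝ) < 2)).mp h4
            omega
          · rw [if_neg hs]; exact zero_le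
      _ = N * y k := by
          rw [tsum_eq_sum (s := Finset.Ico s₀ (s₀ + N)) fun s hs => if_neg hs,
            Finset.sum_congr rfl fun s hs => if_pos hs]
          simp
  · push Not at hex
    simp [hex]

/-- Power mean inequality in unnormalized form. -/
lemma sum_rpow_le_of_sum_sq_le {ι : Type*} {S : Finset ι} {m : ℕ} (hm : 0 < m) (hS : S.card = m)
    {b : ι → ℝ≥0∞} {q : ℝ} (hq : 0 < q) (hq2 : q ≤ 2) {C ρ : ℝ≥0∞}
    (h : ∑ k ∈ S, b k ^ (2 : ℝ) ≤ C * m * ρ ^ (2 : ℝ)) :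
    ∑ k ∈ S, b k ^ q ≤ C ^ (q / 2) * m * ρ ^ q := by
  have hm0 : (m : ℝ≥0∞) ≠ 0 := by exact_mod_cast hm.ne'
  have hmt : (m : ℝ≥0∞) ≠ ⊤ := ENNReal.natCast_ne_top m
  -- Jensen with equal weights 1/m and exponent 2/q ≥ 1; this is where q ≤ 2 enters.
  have h1 := ENNReal.rpow_arith_mean_le_arith_mean_rpow S (fun _ => (m : ℝ≥0∞)⁻¹) (fun k => b k ^ q)
    (by rw [Finset.sum_const, hS, nsmul_eq_mul, ENNReal.mul_inv_cancel hm0 hmt]) (p := 2 / q)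
    (by rw [one_le_div hq]; exact hq2)
  simp only [← Finset.mul_sum, ← ENNReal.rpow_mul, mul_div_cancel₀ (2 : ℝ) hq.ne'] at h1
  have h2 : (m : ℝ≥0∞)⁻¹ * ∑ k ∈ S, b k ^ (2 : ℝ) ≤ C * ρ ^ (2 : ℝ) := by
    calc _ ≤ (m : ℝ≥0∞)⁻¹ * (C * m * ρ ^ (2 : ℝ)) := by gcongr
      _ = ((m : ℝ≥0∞)⁻¹ * m) * (C * ρ ^ (2 : ℝ)) := by ring
      _ = _ := by rw [ENNReal.inv_mul_cancel hm0 hmt, one_mul]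
  have h3 := ENNReal.rpow_le_rpow (h1.trans h2) (by positivity : 0 ≤ q / 2)
  rw [← ENNReal.rpow_mul, show 2 / q * (q / 2) = 1 by field_simp, ENNReal.rpow_one,
    ENNReal.mul_rpow_of_nonneg _ _ (by positivity), ← ENNReal.rpow_mul,
    show 2 * (q / 2) = q by ring] at h3
  calc _ = m * ((m : ℝ≥0∞)⁻¹ * ∑ k ∈ S, b k ^ q) := by
        rw [← mul_assoc, ENNReal.mul_inv_cancel hm0 hmt, one_mul]
    _ ≤ m * (C ^ (q / 2) * ρ ^ q) := by gcongr
    _ = _ := by ring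

/-- The deviation `|S_{αk/2} f(x) - f(x)|`. -/
noncomputable def deviation (α : ℝ) (f : ℝ → ℂ) (x : ℝ) (k : ℕ) : ℝ≥0∞ :=
  ‖partialSum f (α * k / 2) x - f x‖ₑ

/-- The majorant `w(π/(m+1)) + E_{αm/2}(f)`. -/
noncomputable def majorant (α : ℝ) (w : ℝ → ℝ) (f : ℝ → ℂ) (m : ℕ) : ℝ≥0∞ :=
  ENNReal.ofReal (w (Real.pi / (m + 1))) + bestApprox (α * m / 2) f

lemma add_sq_le_ennreal (a b : ℝ≥0∞) : (a + b) ^ (2 : ℝ) ≤ 2 * (a ^ (2 : ℝ) + b ^ (2 : ℝ)) := by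
  have := ENNReal.rpow_add_le_mul_rpow_add_rpow a b (p := 2) (by norm_num)
  simpa [show (2 : ℝ) - 1 = 1 by norm_num] using this

/-- Strong approximation over dyadic blocks, quadratic means. -/
lemma exists_sum_deviation_sq_le {α M : ℝ} (hα : 0 < α) (hM : 0 ≤ M) :
    ∃ C : ℝ≥0∞, C ≠ ⊤ ∧ ∀ (w : ℝ → ℝ) (x : ℝ) (f : ℝ → ℂ), IsModulusType w →
      MemOmegaW α M w x f → ∀ m : ℕ, 0 < m →
      ∑ k ∈ Finset.Ico m (2 * m), deviation α f x k ^ (2 : ℝ)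
        ≤ C * m * majorant α w f m ^ (2 : ℝ) := by
  obtain ⟨C₀, hC₀, hblock⟩ : ∃ C₀ : ℝ, 0 ≤ C₀ ∧ ∀ (w : ℝ → ℝ) (x : ℝ) (f : ℝ → ℂ),
      IsModulusType w → MemOmegaW α M w x f → ∀ m : ℕ, 0 < m →
      ∑ i ∈ Finset.range m, ‖∫ t in Set.Ioi (0 : ℝ),
        phi f x t * (kernel (α / 2) (α / 2 * (m + i)) t : ℂ)‖ ^ 2
        ≤ C₀ * m * (w (Real.pi / (m + 1))) ^ 2 := by
    refine ⟨3 * ((Real.pi / (2 * cosConst)) ^ 2 + 144 * (1 / cosConst) ^ 2 +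
        (100 / (Real.pi * cosConst) * 4) ^ 2) * (M * (2 / α + 1)) ^ 2, by positivity, ?_⟩
    intro w x f hw hf m hm
    have hp := Real.pi_pos
    have hm1 : (1 : ℝ) ≤ m := by exact_mod_cast hm
    refine (hf.sum_sq_norm_integral_le hα hM hw hm rfl).trans ?_
    -- As m + 1 ≤ 2m, the argument grows at most by the factor 2/α.
    have h1 : w (Real.pi / (α * m)) ≤ (2 / α + 1) * w (Real.pi / (m + 1)) := by
      refine hw.le_of_le_mul (by positivity) (by positivity) (by positivity) ?_
      rw [div_mul_div_comm, div_le_div_iff₀ (by positivity) (by positivity)]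
      have : 0 < Real.pi * α := by positivity
      nlinarith
    have h2 := hw.nonneg (by positivity : 0 ≤ Real.pi / (α * m))
    calc _ ≤ 3 * ((Real.pi / (2 * cosConst)) ^ 2 + 144 * (1 / cosConst) ^ 2 +
        (100 / (Real.pi * cosConst) * 4) ^ 2) * m *
          (M * ((2 / α + 1) * w (Real.pi / (m + 1)))) ^ 2 := by gcongr
      _ = _ := by ring
  -- From (X + 4e)² ≤ 2(X² + 16e²).
  refine ⟨2 * ENNReal.ofReal C₀ + 32, by simp [ENNReal.mul_eq_top], fun w x f hw hf m hm => ?_⟩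
  set W := w (Real.pi / (m + 1)) with hW
  set e := bestApprox (α * m / 2) f with he
  have hp := Real.pi_pos
  have hW0 : 0 ≤ W := hw.nonneg (by positivity)
  set X : ℕ → ℝ := fun i => ‖∫ t in Set.Ioi (0 : ℝ),
    phi f x t * (kernel (α / 2) (α / 2 * (m + i)) t : ℂ)‖ with hX
  have hdev : ∀ i, deviation α f x (m + i) ^ (2 : ℝ) ≤
      2 * (ENNReal.ofReal (X i ^ 2) + 16 * e ^ (2 : ℝ)) := by
    intro i
    have h1 : deviation α f x (m + i) ≤ ENNReal.ofReal (X i) + 4 * e := by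
      have hl : α * ((m + i : ℕ) : ℝ) / 2 = α / 2 * (m + i) := by push_cast; ring
      rw [deviation, hl]
      refine (hf.enorm_partialSum_sub_le hα (by positivity) x).trans (add_le_add ?_ ?_)
      · rw [← ofReal_norm]
      · gcongr 4 * ?_
        apply bestApprox_anti
        have : (0 : ℝ) ≤ i := Nat.cast_nonneg i
        nlinarith
    calc _ ≤ (ENNReal.ofReal (X i) + 4 * e) ^ (2 : ℝ) := by gcongr
      _ ≤ 2 * (ENNReal.ofReal (X i) ^ (2 : ℝ) + (4 * e) ^ (2 : ℝ)) := add_sq_le_ennreal _ _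
      _ = _ := by
        rw [ENNReal.mul_rpow_of_nonneg _ _ (by norm_num)]
        simp only [ENNReal.rpow_two]
        rw [ENNReal.ofReal_pow (norm_nonneg _), show (4 : ℝ≥0∞) ^ 2 = 16 by norm_num]
  rw [Finset.sum_Ico_eq_sum_range, show 2 * m - m = m by omega]
  calc _ ≤ ∑ i ∈ Finset.range m, 2 * (ENNReal.ofReal (X i ^ 2) + 16 * e ^ (2 : ℝ)) :=
        Finset.sum_le_sum fun i _ => hdev i
    _ = 2 * (ENNReal.ofReal (∑ i ∈ Finset.range m, X i ^ 2) + m * (16 * e ^ (2 : ℝ))) := by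
        rw [← Finset.mul_sum, Finset.sum_add_distrib, Finset.sum_const, Finset.card_range,
          nsmul_eq_mul, ENNReal.ofReal_sum_of_nonneg fun _ _ => by positivity]
    _ ≤ 2 * (ENNReal.ofReal (C₀ * m * W ^ 2) + m * (16 * e ^ (2 : ℝ))) := by
        gcongr
        exact hblock w x f hw hf m hm
    _ = 2 * ENNReal.ofReal C₀ * m * ENNReal.ofReal W ^ (2 : ℝ) + 32 * m * e ^ (2 : ℝ) := by
        rw [ENNReal.ofReal_mul (by positivity), ENNReal.ofReal_mul hC₀, ENNReal.ofReal_natCast,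
          ENNReal.ofReal_pow hW0]
        simp only [ENNReal.rpow_two]
        ring
    _ ≤ 2 * ENNReal.ofReal C₀ * m * majorant α w f m ^ (2 : ℝ) +
        32 * m * majorant α w f m ^ (2 : ℝ) := by
        gcongr
        · exact le_self_add
        · exact le_add_self
    _ = _ := by ring

/-- Variation condition: a term of a block is bounded by an average over a comparable range. -/
lemma IsGM.mul_le_sum {c K : ℝ} (hc : 1 < c) (hK : 0 ≤ K) {a : ℕ → ℝ} (ha : ∀ k, 0 ≤ a k)
    (hGM : IsGM c K a) {m : ℕ} (hm : c ≤ m) {k : ℕ} (hk : k ∈ Finset.Ico m (2 * m)) :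
    m * a k ≤ (1 + 2 * c * K) *
      ∑ j ∈ Finset.Ico m (2 * m) ∪ Finset.Icc ⌊(m : ℝ) / c⌋₊ ⌊c * (m : ℝ)⌋₊, a j := by
  have hc0 : 0 < c := by linarith
  have hm0 : (0 : ℝ) < m := by linarith
  set S := Finset.Ico m (2 * m) with hS
  set R := Finset.Icc ⌊(m : ℝ) / c⌋₊ ⌊c * (m : ℝ)⌋₊ with hR
  set V := ∑ j ∈ S, |a j - a (j + 1)| with hV
  have hvar : ∀ i j, m ≤ i → i ≤ j → j < 2 * m → |a i - a j| ≤ V := by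
    intro i j hi hij hj
    calc |a i - a j| = |∑ l ∈ Finset.Ico i j, (a l - a (l + 1))| := by
          have := Finset.sum_Ico_sub a hij
          rw [← neg_sub (a j), ← this, ← Finset.sum_neg_distrib]
          congr 1
          exact Finset.sum_congr rfl fun l _ => by ring
      _ ≤ ∑ l ∈ Finset.Ico i j, |a l - a (l + 1)| := Finset.abs_sum_le_sum_abs _ _
      _ ≤ V := Finset.sum_le_sum_of_subset_of_nonneg
          (Finset.Ico_subset_Ico hi hj.le) fun _ _ _ => abs_nonneg _
  -- The variation V over the block bounds the oscillation of `a` there; summing over the m indices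
  -- j compares `a k` with the block average.
  have hcmp : ∀ j ∈ S, a k ≤ a j + V := by
    intro j hj
    rw [hS, Finset.mem_Ico] at hj hk
    rcases le_total k j with h | h
    · linarith [(abs_le.mp (hvar k j hk.1 h hj.2)).2]
    · linarith [(abs_le.mp (hvar j k hj.1 h hk.2)).1]
  have hsum : m * a k ≤ ∑ j ∈ S, a j + m * V := by
    have := Finset.sum_le_sum hcmp
    rw [Finset.sum_const, Finset.sum_add_distrib, Finset.sum_const, hS, Nat.card_Ico,
      nsmul_eq_mul, nsmul_eq_mul, show 2 * m - m = m by omega] at this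
    exact this
  -- Since [m/c] ≥ 1, m/c < [m/c] + 1 ≤ 2[m/c]. Thus 1/j ≤ 2c/m on the whole range, which removes
  -- the denominators.
  have hfl : (m : ℝ) ≤ 2 * c * ⌊(m : ℝ) / c⌋₊ := by
    have h1 : 1 ≤ (m : ℝ) / c := by rwa [one_le_div hc0]
    have h2 := Nat.lt_floor_add_one ((m : ℝ) / c)
    have h3 : (1 : ℝ) ≤ ⌊(m : ℝ) / c⌋₊ := by exact_mod_cast (Nat.one_le_floor_iff _).mpr h1
    rw [div_lt_iff₀ hc0] at h2
    nlinarith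
  have hV2 : m * V ≤ 2 * c * K * ∑ j ∈ R, a j := by
    have h1 : V ≤ K * ∑ j ∈ R, |a j| / (j : ℝ) := hGM m hm
    calc m * V ≤ m * (K * ∑ j ∈ R, |a j| / (j : ℝ)) := by gcongr
      _ = K * ∑ j ∈ R, m * (|a j| / (j : ℝ)) := by rw [mul_left_comm, Finset.mul_sum]
      _ ≤ K * ∑ j ∈ R, 2 * c * a j := by
          refine mul_le_mul_of_nonneg_left (Finset.sum_le_sum fun j hj => ?_) hK
          rw [abs_of_nonneg (ha j)]
          have h2 : (⌊(m : ℝ) / c⌋₊ : ℝ) ≤ j := by exact_mod_cast (Finset.mem_Icc.mp hj).1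
          have h3 : (m : ℝ) ≤ 2 * c * j := hfl.trans (by gcongr)
          have hj0 : (0 : ℝ) < j := by
            by_contra h
            have : (j : ℝ) = 0 := le_antisymm (not_lt.mp h) (Nat.cast_nonneg j)
            rw [this] at h3; linarith
          rw [← mul_div_assoc, div_le_iff₀ hj0]
          nlinarith [ha j]
      _ = _ := by rw [← Finset.mul_sum]; ring
  have hSU : ∑ j ∈ S, a j ≤ ∑ j ∈ S ∪ R, a j :=
    Finset.sum_le_sum_of_subset_of_nonneg Finset.subset_union_left fun j _ _ => ha j
  have hRU : ∑ j ∈ R, a j ≤ ∑ j ∈ S ∪ R, a j :=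
    Finset.sum_le_sum_of_subset_of_nonneg Finset.subset_union_right fun j _ _ => ha j
  have : 2 * c * K * ∑ j ∈ R, a j ≤ 2 * c * K * ∑ j ∈ S ∪ R, a j := by gcongr
  linarith

/-- The majorant on the right-hand side of the strong approximation estimate. -/
noncomputable def slowMajorant (α c : ℝ) (w : ℝ → ℝ) (f : ℝ → ℂ) (k : ℕ) : ℝ≥0∞ :=
  ENNReal.ofReal (w (Real.pi / (k + 1))) + bestApprox (α * k / 2 ^ (1 + ⌊c⌋₊)) f

/-- In both cases k ≤ 2^{[c]}m, because c ≤ [c] + 1 ≤ 2^{[c]} and [c] ≥ 1. So αk/2^{1+[c]} ≤ αm/2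
and E decreases in its index. For w, the ratio (k+1)/(m+1) is at most c + 2, which costs c + 3. -/
lemma majorant_le_slowMajorant {α c : ℝ} (hα : 0 < α) (hc : 1 < c) {w : ℝ → ℝ}
    (hw : IsModulusType w) (f : ℝ → ℂ) {m k : ℕ} (hk : (k : ℝ) ≤ c * m ∨ k < 2 * m) :
    majorant α w f m ≤ ENNReal.ofReal (c + 3) * slowMajorant α c w f k := by
  have hp := Real.pi_pos
  have hfl : 1 ≤ ⌊c⌋₊ := (Nat.one_le_floor_iff c).mpr hc.le
  have hc2 : c ≤ 2 ^ ⌊c⌋₊ := by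
    have h1 : (⌊c⌋₊ + 1 : ℝ) ≤ 2 ^ ⌊c⌋₊ := by exact_mod_cast Nat.lt_two_pow_self
    linarith [(Nat.lt_floor_add_one c).le]
  have h2 : (2 : ℝ) ≤ 2 ^ ⌊c⌋₊ := by
    calc (2 : ℝ) = 2 ^ 1 := by norm_num
      _ ≤ _ := pow_le_pow_right₀ (by norm_num) hfl
  have hm0 : (0 : ℝ) ≤ m := Nat.cast_nonneg m
  have hkm : (k : ℝ) ≤ 2 ^ ⌊c⌋₊ * m := by
    rcases hk with hk | hk
    · exact hk.trans (by gcongr)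
    · have : (k : ℝ) ≤ 2 * m := by exact_mod_cast hk.le
      exact this.trans (by gcongr)
  have hkc : (k : ℝ) + 1 ≤ (c + 2) * (m + 1) := by
    rcases hk with hk | hk
    · nlinarith
    · have : (k : ℝ) ≤ 2 * m := by exact_mod_cast hk.le
      nlinarith
  rw [majorant, slowMajorant, mul_add]
  refine add_le_add ?_ ?_
  · rw [← ENNReal.ofReal_mul (by linarith)]
    apply ENNReal.ofReal_le_ofReal
    have := hw.le_of_le_mul (a := c + 2) (s := Real.pi / (k + 1)) (t := Real.pi / (m + 1))
      (by linarith) (by positivity) (by positivity) (by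
        rw [← mul_div_assoc, div_le_div_iff₀ (by positivity) (by positivity)]
        nlinarith)
    linarith
  · refine (bestApprox_anti (?_ : α * k / 2 ^ (1 + ⌊c⌋₊) ≤ α * m / 2) f).trans ?_
    · rw [pow_add, pow_one, div_le_div_iff₀ (by positivity) (by norm_num)]
      nlinarith
    · exact le_mul_of_one_le_left zero_le (by rw [ENNReal.one_le_ofReal]; linarith)

lemma majorant_le_slowMajorant_self {α c : ℝ} (hα : 0 < α) (w : ℝ → ℝ) (f : ℝ → ℂ) (k : ℕ) :
    majorant α w f k ≤ slowMajorant α c w f k := by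
  rw [majorant, slowMajorant]
  gcongr
  apply bestApprox_anti
  have h2 : (2 : ℝ) ≤ 2 ^ (1 + ⌊c⌋₊) := by
    rw [pow_add, pow_one]
    exact le_mul_of_one_le_right (by norm_num) (one_le_pow₀ (by norm_num))
  gcongr

/-- The strong approximation estimate for one row, with `q`-th powers. -/
lemma exists_tsum_deviation_le {α q c K M : ℝ} (hα : 0 < α) (hq : 0 < q) (hq2 : q ≤ 2) (hc : 1 < c)
    (hK : 0 ≤ K) (hM : 0 ≤ M) :
    ∃ C : ℝ≥0∞, C ≠ ⊤ ∧ ∀ (w : ℝ → ℝ) (x : ℝ) (f : ℝ → ℂ) (a : ℕ → ℝ), IsModulusType w →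
      MemOmegaW α M w x f → (∀ k, 0 ≤ a k) → IsGM c K a →
      ∑' k, ENNReal.ofReal (a k) * deviation α f x k ^ q
        ≤ C * ∑' k, ENNReal.ofReal (a k) * slowMajorant α c w f k ^ q := by
  obtain ⟨C₁, hC₁, hsq⟩ := exists_sum_deviation_sq_le hα hM
  set C₂ := C₁ ^ (q / 2) with hC₂
  have hC₂t : C₂ ≠ ⊤ := ENNReal.rpow_ne_top_of_nonneg (by positivity) hC₁
  obtain ⟨N, hN⟩ := pow_unbounded_of_one_lt ((c + 3) * (c + 3)) (by norm_num : (1 : ℝ) < 2)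
  set C₃ : ℝ≥0∞ := C₂ * ENNReal.ofReal (1 + 2 * c * K) * ENNReal.ofReal (c + 3) ^ q with hC₃
  set C₄ : ℝ≥0∞ := C₂ * ENNReal.ofReal (2 * c) with hC₄
  set C₅ : ℝ≥0∞ := (C₁ ^ (1 / 2 : ℝ) + 4) ^ q with hC₅
  have hC₃t : C₃ ≠ ⊤ := ENNReal.mul_ne_top (ENNReal.mul_ne_top hC₂t ENNReal.ofReal_ne_top)
    (ENNReal.rpow_ne_top_of_nonneg hq.le ENNReal.ofReal_ne_top)
  have hC₄t : C₄ ≠ ⊤ := ENNReal.mul_ne_top hC₂t ENNReal.ofReal_ne_top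
  have hC₅t : C₅ ≠ ⊤ := ENNReal.rpow_ne_top_of_nonneg hq.le (ENNReal.add_ne_top.mpr
    ⟨ENNReal.rpow_ne_top_of_nonneg (by norm_num) hC₁, by norm_num⟩)
  refine ⟨C₅ + (C₃ + C₄) * N, ENNReal.add_ne_top.mpr ⟨hC₅t, ENNReal.mul_ne_top
    (ENNReal.add_ne_top.mpr ⟨hC₃t, hC₄t⟩) (ENNReal.natCast_ne_top N)⟩, ?_⟩
  intro w x f a hw hf ha hGM
  set b := deviation α f x with hb
  set R := slowMajorant α c w f with hR
  have hblock : ∀ m : ℕ, 0 < m → ∑ k ∈ Finset.Ico m (2 * m), b k ^ q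
      ≤ C₂ * m * majorant α w f m ^ q := fun m hm =>
    sum_rpow_le_of_sum_sq_le hm (by rw [Nat.card_Ico]; omega) hq hq2 (hsq w x f hw hf m hm)
  -- The range over which a block of weights is averaged. For m < c the variation condition gives no
  -- information and the block itself is kept.
  set T : ℕ → Finset ℕ := fun m => if c ≤ m then
    Finset.Ico m (2 * m) ∪ Finset.Icc ⌊(m : ℝ) / c⌋₊ ⌊c * (m : ℝ)⌋₊ else Finset.Ico m (2 * m) with hT
  have hTdist : ∀ m, 0 < m → ∀ k ∈ T m, (m : ℝ) ≤ (c + 3) * (k + 1) ∧ (k : ℝ) + 1 ≤ (c + 3) * m := by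
    intro m hm k hk
    have hm1 : (1 : ℝ) ≤ m := by exact_mod_cast hm
    have hk0 : (0 : ℝ) ≤ k := Nat.cast_nonneg k
    have hIco : k ∈ Finset.Ico m (2 * m) →
        (m : ℝ) ≤ (c + 3) * (k + 1) ∧ (k : ℝ) + 1 ≤ (c + 3) * m := by
      intro h
      obtain ⟨h1, h2⟩ := Finset.mem_Ico.mp h
      have h1 : (m : ℝ) ≤ k := by exact_mod_cast h1
      have h2 : (k : ℝ) + 1 ≤ 2 * m := by exact_mod_cast h2
      constructor <;> nlinarith
    simp only [hT] at hk
    split_ifs at hk with hcm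
    · rcases Finset.mem_union.mp hk with h | h
      · exact hIco h
      · obtain ⟨h1, h2⟩ := Finset.mem_Icc.mp h
        have h3 := (Nat.le_floor_iff (by positivity)).mp h2
        have h4 := Nat.lt_floor_add_one ((m : ℝ) / c)
        have h5 : (⌊(m : ℝ) / c⌋₊ : ℝ) ≤ k := by exact_mod_cast h1
        rw [div_lt_iff₀ (by linarith)] at h4
        constructor <;> nlinarith
    · exact hIco hk
  have hdyadic : ∀ m : ℕ, 0 < m → ∑ k ∈ Finset.Ico m (2 * m), ENNReal.ofReal (a k) * b k ^ q
      ≤ (C₃ + C₄) * ∑ k ∈ T m, ENNReal.ofReal (a k) * R k ^ q := by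
    intro m hm
    have hm0 : (0 : ℝ) < m := by exact_mod_cast hm
    rw [add_mul]
    by_cases hcm : c ≤ m
    · refine le_add_right ?_
      have hTm : T m = Finset.Ico m (2 * m) ∪ Finset.Icc ⌊(m : ℝ) / c⌋₊ ⌊c * (m : ℝ)⌋₊ := if_pos hcm
      set A := ∑ j ∈ T m, a j with hA
      calc _ ≤ ∑ k ∈ Finset.Ico m (2 * m),
            ENNReal.ofReal ((1 + 2 * c * K) * A / m) * b k ^ q := by
            refine Finset.sum_le_sum fun k hk => ?_
            gcongr
            rw [le_div_iff₀ hm0, mul_comm, hA, hTm]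
            exact hGM.mul_le_sum hc hK ha hcm hk
        _ ≤ ENNReal.ofReal ((1 + 2 * c * K) * A / m) * (C₂ * m * majorant α w f m ^ q) := by
            rw [← Finset.mul_sum]
            gcongr
            exact hblock m hm
        _ = C₂ * ENNReal.ofReal (1 + 2 * c * K) * (ENNReal.ofReal A * majorant α w f m ^ q) := by
            rw [ENNReal.ofReal_div_of_pos hm0, ENNReal.ofReal_mul (by positivity),
              ENNReal.ofReal_natCast, div_eq_mul_inv]
            calc _ = C₂ * ENNReal.ofReal (1 + 2 * c * K) *
                  (ENNReal.ofReal A * majorant α w f m ^ q) * ((m : ℝ≥0∞)⁻¹ * m) := by ring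
              _ = _ := by
                rw [ENNReal.inv_mul_cancel (by exact_mod_cast hm.ne') (ENNReal.natCast_ne_top m),
                  mul_one]
        _ ≤ C₂ * ENNReal.ofReal (1 + 2 * c * K) * (ENNReal.ofReal (c + 3) ^ q *
              ∑ k ∈ T m, ENNReal.ofReal (a k) * R k ^ q) := by
            gcongr C₂ * ENNReal.ofReal (1 + 2 * c * K) * ?_
            rw [hA, ENNReal.ofReal_sum_of_nonneg fun k _ => ha k, Finset.sum_mul, Finset.mul_sum]
            refine Finset.sum_le_sum fun k hk => ?_
            have hk' : (k : ℝ) ≤ c * m ∨ k < 2 * m := by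
              rw [hTm, Finset.mem_union, Finset.mem_Ico, Finset.mem_Icc] at hk
              rcases hk with h | h
              · exact Or.inr h.2
              · exact Or.inl ((Nat.le_floor_iff (by positivity)).mp h.2)
            calc _ ≤ ENNReal.ofReal (a k) * (ENNReal.ofReal (c + 3) * R k) ^ q := by
                  gcongr
                  exact majorant_le_slowMajorant hα hc hw f hk'
              _ = _ := by rw [ENNReal.mul_rpow_of_nonneg _ _ hq.le]; ring
        _ = _ := by rw [hC₃]; ring
    -- Here k < 2m < 2c, so no averaging is needed: a single deviation is bounded by the whole block
    -- starting at k, whose length k costs only the constant 2c.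
    · refine le_add_left ?_
      have hTm : T m = Finset.Ico m (2 * m) := if_neg hcm
      rw [hTm, Finset.mul_sum]
      refine Finset.sum_le_sum fun k hk => ?_
      obtain ⟨hk1, hk2⟩ := Finset.mem_Ico.mp hk
      have hk0 : 0 < k := by omega
      have hkc : (k : ℝ) ≤ 2 * c := by
        have h1 : (k : ℝ) ≤ 2 * m := by exact_mod_cast hk2.le
        linarith [not_le.mp hcm]
      calc _ ≤ ENNReal.ofReal (a k) * (C₂ * k * majorant α w f k ^ q) := by
            gcongr
            refine le_trans ?_ (hblock k hk0)
            exact Finset.single_le_sum (f := fun k => b k ^ q) (fun _ _ => zero_le)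
              (Finset.mem_Ico.mpr ⟨le_rfl, by omega⟩)
        _ ≤ ENNReal.ofReal (a k) * (C₂ * ENNReal.ofReal (2 * c) * R k ^ q) := by
            gcongr
            · rw [← ENNReal.ofReal_natCast]; exact ENNReal.ofReal_le_ofReal hkc
            · exact majorant_le_slowMajorant_self hα w f k
        _ = _ := by rw [hC₄]; ring
  -- S₀f differs from S_{α/2}f by at most 4E₀(f), and the deviation at k = 1 is the one-term block m
  -- = 1. Its majorant is at most `R 0`, by monotonicity of w and E.
  have hzero : b 0 ^ q ≤ C₅ * R 0 ^ q := by
    have hb1 : b 1 ≤ C₁ ^ (1 / 2 : ℝ) * majorant α w f 1 := by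
      have h1 := hsq w x f hw hf 1 one_pos
      simp only [mul_one, Nat.Ico_succ_singleton, Finset.sum_singleton, Nat.cast_one] at h1
      have h2 := ENNReal.rpow_le_rpow h1 (by norm_num : (0 : ℝ) ≤ 1 / 2)
      rwa [ENNReal.mul_rpow_of_nonneg _ _ (by norm_num), ← ENNReal.rpow_mul, ← ENNReal.rpow_mul,
        mul_one_div_cancel two_ne_zero, ENNReal.rpow_one, ENNReal.rpow_one] at h2
    have hm1 : majorant α w f 1 ≤ R 0 := by
      rw [majorant, hR, slowMajorant]
      refine add_le_add (ENNReal.ofReal_le_ofReal (hw.mono (by positivity) ?_))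
        (bestApprox_anti ?_ f)
      · have := Real.pi_pos
        simp only [Nat.cast_one, Nat.cast_zero, zero_add, div_one]
        linarith
      · simp; positivity
    have hb0 : b 0 ≤ (C₁ ^ (1 / 2 : ℝ) + 4) * R 0 := by
      have h1 := hf.enorm_partialSum_sub_partialSum_le hα le_rfl x
      rw [zero_add] at h1
      have e : partialSum f (α * (0 : ℕ) / 2) x - f x =
          (partialSum f 0 x - partialSum f (α / 2) x) + (partialSum f (α * (1 : ℕ) / 2) x - f x) := by
        simp
      rw [hb, deviation, e]
      refine (enorm_add_le _ _).trans ?_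
      rw [add_comm, add_mul]
      refine add_le_add (hb1.trans (by gcongr)) (h1.trans ?_)
      gcongr
      rw [hR, slowMajorant]
      simp
    calc _ ≤ ((C₁ ^ (1 / 2 : ℝ) + 4) * R 0) ^ q := by gcongr
      _ = _ := ENNReal.mul_rpow_of_nonneg _ _ hq.le
  calc _ ≤ ENNReal.ofReal (a 0) * b 0 ^ q + ∑' s : ℕ, ∑ k ∈ Finset.Ico (2 ^ s) (2 * 2 ^ s),
        ENNReal.ofReal (a k) * b k ^ q := tsum_le_dyadic _
    _ ≤ C₅ * (ENNReal.ofReal (a 0) * R 0 ^ q) + ∑' s : ℕ, (C₃ + C₄) *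
        ∑ k ∈ T (2 ^ s), ENNReal.ofReal (a k) * R k ^ q := by
        refine add_le_add ?_ (ENNReal.tsum_le_tsum fun s => hdyadic _ (by positivity))
        rw [mul_left_comm]
        gcongr
    _ ≤ C₅ * (∑' k, ENNReal.ofReal (a k) * R k ^ q) + (C₃ + C₄) *
        (N * ∑' k, ENNReal.ofReal (a k) * R k ^ q) := by
        rw [ENNReal.tsum_mul_left]
        gcongr
        · exact ENNReal.le_tsum (f := fun k => ENNReal.ofReal (a k) * R k ^ q) 0
        · refine tsum_sum_le_of_overlap _ (by linarith) hN (fun s => T (2 ^ s)) fun s k hk => ?_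
          simpa using hTdist _ (by positivity) k hk
    _ = _ := by ring

end StepanovApprox

theorem theorem5 (α q c K M : ℝ) (hα : 0 < α) (hq : 0 < q) (hq2 : q ≤ 2) (hc : 1 < c)
    (hK : 0 ≤ K) (hM : 0 ≤ M) :
    ∃ C : ℝ, 0 < C ∧
      ∀ (w : ℝ → ℝ) (x : ℝ) (f : ℝ → ℂ) (a : ℕ → ℕ → ℝ),
        IsModulusType w → MemOmegaW α M w x f →
        (∀ n k, 0 ≤ a n k) → (∀ n, HasSum (a n) 1) → (∀ n, IsGM c K (a n)) →
        Tendsto (fun n => a n 0) atTop (𝓝 0) →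
        ∀ n : ℕ,
          strongMean q (a n) (fun k => α * k / 2) f x ≤
            ENNReal.ofReal C *
              (∑' k : ℕ, ENNReal.ofReal (a n k) *
                (ENNReal.ofReal (w (Real.pi / (k + 1))) +
                  bestApprox (α * k / 2 ^ (1 + ⌊c⌋₊)) f) ^ q) ^ (1 / q) := by
  obtain ⟨C, hC, H⟩ := exists_tsum_deviation_le hα hq hq2 hc hK hM
  -- The summand 1 only secures strict positivity.
  refine ⟨(C ^ (1 / q)).toReal + 1, by positivity, ?_⟩
  intro w x f a hw hf ha _ hGM _ n
  have h1 := ENNReal.rpow_le_rpow (H w x f (a n) hw hf (ha n) (hGM n))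
    (by positivity : 0 ≤ 1 / q)
  rw [ENNReal.mul_rpow_of_nonneg _ _ (by positivity)] at h1
  refine h1.trans ?_
  gcongr ?_ * _
  have hCt : C ^ (1 / q) ≠ ⊤ := ENNReal.rpow_ne_top_of_nonneg (by positivity) hC
  rw [← ENNReal.ofReal_toReal hCt]
  exact ENNReal.ofReal_le_ofReal (by simp)
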